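/- Consider the system $$\frac{dr}{dt}=f(r,\varphi,S(t),t),\qquad \frac{d\varphi}{dt}=\omega(r)+g(r,\varphi,S(t),t),\qquad |r|\le\mathcal R,\ \varphi\in\mathbb R,\ t>0, \tag{1}$$ where $\omega>0$, $f$, $g$ are $C^\infty$, $f,g$ are $2\pi$-periodic in $\varphi$ and $S$, and, for an integer $q\ge1$, $f\sim\sum_{j\ge1}t^{-j/q}f_j(r,\varphi,S)$, $g\sim\sum_{j\ge1}t^{-j/q}g_j(r,\varphi,S)$ as $t\to\infty$ uniformly in $|r|\le\mathcal R$, $(\varphi,S)\in\mathbb R^2$, with $f_j,g_j$ of class $C^\infty$ and $2\pi$-periodic in $\varphi,S$. Let $S(t)=s_0t+\sum_{j=1}^{q-1}s_jt^{1-j/q}+s_q\log t$ with $s_0>0$, and let $0<|a|<\mathcal R$ and coprime positive integers $\kappa,\varkappa$ satisfy $\kappa s_0=\varkappa\omega(a)$, $\eta:=\omega'(a)\ne0$. *Averaged coefficients.* With $r=a+t^{-1/(2q)}R$, $\varphi=\frac{\kappa}{\varkappa}S(t)+\Psi$, system (1) becomes $R'\sim\sum_{k\ge1}t^{-k/(2q)}F_k(R,\Psi,S)$,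 $\Psi'\sim\sum_{k\ge1}t^{-k/(2q)}G_k(R,\Psi,S)$ at $S=S(t)$. Let $\Lambda_k(\rho,\psi)$, $\Omega_k(\rho,\psi)$ ($k\ge1$) be the coefficients, independent of $S$, obtained by the formal change of variables $\rho=R+\sum_{k\ge1}t^{-k/(2q)}u_k(R,\Psi,S)$, $\psi=\Psi+\sum_{k\ge1}t^{-k/(2q)}v_k(R,\Psi,S)$, where $u_k,v_k$ are $2\pi\varkappa$-periodic in $S$ with zero mean: $\rho'\sim\sum_k t^{-k/(2q)}\Lambda_k(\rho,\psi)$, $\psi'\sim\sum_kt^{-k/(2q)}\Omega_k(\rho,\psi)$ (so $\Omega_1=\eta\rho$, and $\Lambda_1$ is the mean over $0\le S\le 2\pi\varkappa$ of $f_1(a,\kappa S/\varkappa+\psi,S)$). Let $1\le n\le2q$, $2\le m\le2q$ be integers with $\Lambda_i\equiv0$ for $i<n$, $\Lambda_n\not\equiv0$, $\Omega_j\equiv0$ for $1<j<m$, $\Omega_m\not\equiv0$. Let $\psi_0\in\mathbb R$ satisfy $\Lambda_n(0,\psi_0)=0$ and $\nu_n:=\partial_\psi\Lambda_n(0,\psi_0)\ne0$.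 Put $\lambda_n=\partial_\rho\Lambda_n(0,\psi_0)$, $\omega_m=\partial_\psi\Omega_m(0,\psi_0)$, let $d_{n,m}$ be $\lambda_n$ if $n<m$, $\lambda_n+\omega_m$ if $n=m$, $\omega_m$ if $n>m$, and put $\ell=\min\{m,n\}$. **Theorem.** Suppose $\nu_n\eta<0$, $d_{n,m}>0$ and $\ell+n-1<2q$. Then there are $N_0\in\mathbb N$ and $\varepsilon>0$ such that the following holds for all $N\ge N_0$. The truncated system $$\varrho'=\sum_{k=1}^Nt^{-k/(2q)}\Lambda_k(\varrho,\phi),\qquad \phi'=\sum_{k=1}^Nt^{-k/(2q)}\Omega_k(\varrho,\phi)$$ has a formal solution $\sum_{k\ge1}t^{-(k+m-2)/(2q)}\varrho_k$, $\psi_0+\sum_{k\ge1}t^{-k/(2q)}\phi_k$ (that is, for every $K$, all sufficiently long partial sums satisfy the system up to $\mathcal O(t^{-K/(2q)})$). For every such formal solution and every integer $M\ge0$, let $\varrho_{*,M}$, $\phi_{*,M}$ be the partial sums with $1\le k\le M$ and $$\operatorname{dist}_M(r,\varphi,t)=\bigl|r-a-t^{-1/(2q)}\varrho_{*,M}(t)\bigr|+\bigl|\varphi-\tfrac{\kappa}{\varkappa}S(t)-\phi_{*,M}(t)\bigr|.$$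 Then for every $\delta\in(0,\varepsilon)$ there is $T\ge1$ such that for every $t_*\ge T$ and all $r_*,\varphi_*$ with $\delta\le\operatorname{dist}_M(r_*,\varphi_*,t_*)<\varepsilon$ there is $t_e>t_*$ for which the solution of (1) with $r(t_*)=r_*$, $\varphi(t_*)=\varphi_*$ exists on $[t_*,t_e]$ and satisfies $\operatorname{dist}_M(r(t_e),\varphi(t_e),t_e)\ge\varepsilon$. In particular, the phase-locking regime is unstable: for each $\delta\in(0,\varepsilon)$ there are, at arbitrarily late times $t_*$, solutions at distance $\delta$ from it (and every such solution with $t_*\ge T$) that later leave its $\varepsilon$-neighbourhood. -/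

import Mathlib

open Filter Asymptotics
open scoped Topology ContDiff

noncomputable section

/-- The data of a perturbed oscillatory system
`r' = f(r, φ, S(t), t)`, `φ' = ω(r) + g(r, φ, S(t), t)` (with `ω = freq`) on
`|r| ≤ calR`, together with the coefficients `fc j`, `gc j` (`j ≥ 1`) of the expansions of `f`, `g` in powers of `t^(-1/q)`,
the coefficients `s 0, …, s q` of the phase `S`, the resonant amplitude `a` and the
resonance integers `kappa`, `varkappa`. -/
structure OscSystem where
  calR : ℝ
  q : ℕ
  freq : ℝ → ℝ
  f : ℝ → ℝ → ℝ → ℝ → ℝ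
  g : ℝ → ℝ → ℝ → ℝ → ℝ
  fc : ℕ → ℝ → ℝ → ℝ → ℝ
  gc : ℕ → ℝ → ℝ → ℝ → ℝ
  s : ℕ → ℝ
  a : ℝ
  kappa : ℕ
  varkappa : ℕ

/-- A perturbation `h(r, φ, S, t)` with coefficients `hc j` is of the admissible class on
`|r| ≤ c`: smooth, `2π`-periodic in `φ` and `S`, and
`h ∼ ∑_{j ≥ 1} t^(-j/q) hc j` as `t → ∞`, uniformly in `(r, φ, S)`. -/
structure IsDecayingPerturbation (c : ℝ) (q : ℕ) (h : ℝ → ℝ → ℝ → ℝ → ℝ)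
    (hc : ℕ → ℝ → ℝ → ℝ → ℝ) : Prop where
  smooth : ContDiffOn ℝ ∞ (fun p : ℝ × ℝ × ℝ × ℝ => h p.1 p.2.1 p.2.2.1 p.2.2.2)
    {p | |p.1| ≤ c ∧ 0 < p.2.2.2}
  periodic_phi : ∀ r φ S t, |r| ≤ c → 0 < t → h r (φ + 2 * Real.pi) S t = h r φ S t
  periodic_S : ∀ r φ S t, |r| ≤ c → 0 < t → h r φ (S + 2 * Real.pi) t = h r φ S t
  coeff_smooth : ∀ j, 1 ≤ j →
    ContDiffOn ℝ ∞ (fun p : ℝ × ℝ × ℝ => hc j p.1 p.2.1 p.2.2) {p | |p.1| ≤ c}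
  coeff_periodic_phi : ∀ j, 1 ≤ j → ∀ r φ S, |r| ≤ c →
    hc j r (φ + 2 * Real.pi) S = hc j r φ S
  coeff_periodic_S : ∀ j, 1 ≤ j → ∀ r φ S, |r| ≤ c →
    hc j r φ (S + 2 * Real.pi) = hc j r φ S
  expansion : ∀ K : ℕ, 1 ≤ K → ∃ C T : ℝ, 0 < T ∧ ∀ t, T ≤ t → ∀ r φ S, |r| ≤ c →
    |h r φ S t - ∑ j ∈ Finset.Ico 1 K, t ^ (-(j : ℝ) / q) * hc j r φ S|
      ≤ C * t ^ (-(K : ℝ) / q)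

namespace OscSystem

/-- The phase `S(t) = s₀ t + ∑_{j=1}^{q-1} s_j t^(1-j/q) + s_q log t`. -/
def phase (D : OscSystem) (t : ℝ) : ℝ :=
  D.s 0 * t + ∑ j ∈ Finset.Ico 1 D.q, D.s j * t ^ (1 - (j : ℝ) / D.q)
    + D.s D.q * Real.log t

/-- `η = ω'(a)`. -/
def eta (D : OscSystem) : ℝ := deriv D.freq D.a

/-- Standing assumptions on the system, including the resonance condition
`κ s₀ = ϰ ω(a)`, `ω'(a) ≠ 0`. -/
structure Valid (D : OscSystem) : Prop where
  q_pos : 1 ≤ D.q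
  freq_smooth : ContDiffOn ℝ ∞ D.freq {r | |r| ≤ D.calR}
  freq_pos : ∀ r, |r| ≤ D.calR → 0 < D.freq r
  f_class : IsDecayingPerturbation D.calR D.q D.f D.fc
  g_class : IsDecayingPerturbation D.calR D.q D.g D.gc
  s_zero_pos : 0 < D.s 0
  a_pos : 0 < |D.a|
  a_lt : |D.a| < D.calR
  kappa_pos : 1 ≤ D.kappa
  varkappa_pos : 1 ≤ D.varkappa
  coprime : Nat.Coprime D.kappa D.varkappa
  resonance : (D.kappa : ℝ) * D.s 0 = D.varkappa * D.freq D.a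
  eta_ne_zero : D.eta ≠ 0

/-- `(r, φ)` solves the system on the time interval `[t₁, t₂]`. -/
def IsSolutionOn (D : OscSystem) (t₁ t₂ : ℝ) (r φ : ℝ → ℝ) : Prop :=
  ∀ t ∈ Set.Icc t₁ t₂, |r t| ≤ D.calR ∧
    HasDerivWithinAt r (D.f (r t) (φ t) (D.phase t) t) (Set.Icc t₁ t₂) t ∧
    HasDerivWithinAt φ (D.freq (r t) + D.g (r t) (φ t) (D.phase t) t) (Set.Icc t₁ t₂) t

/-! ### The averaged system

With `r = a + t^(-1/(2q)) R`, `φ = (κ/ϰ) S + Ψ` the system becomes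
`R' ∼ ∑ t^(-k/(2q)) F_k(R, Ψ, S)`, `Ψ' ∼ ∑ t^(-k/(2q)) G_k(R, Ψ, S)`. The change of variables
`ρ = R + ∑ t^(-k/(2q)) u_k(R, Ψ, S)`, `ψ = Ψ + ∑ t^(-k/(2q)) v_k(R, Ψ, S)`, with `u_k`, `v_k`
of zero mean in `S`, then removes `S` from the coefficients and gives
`ρ' ∼ ∑ t^(-k/(2q)) Λ_k(ρ, ψ)`, `ψ' ∼ ∑ t^(-k/(2q)) Ω_k(ρ, ψ)`. -/

/-- The coefficient of `t^(-k/(2q))`, `k ≥ 1`, in `S'(t)`. -/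
def phaseCoeff (D : OscSystem) (k : ℕ) : ℝ :=
  if Even k ∧ k ≤ 2 * D.q then
    D.s (k / 2) * (1 - (k : ℝ) / (2 * D.q) + if k = 2 * D.q then 1 else 0)
  else 0

/-- `F_k(R, Ψ, S)`. -/
def Fcoef (D : OscSystem) (k : ℕ) (R Ψ S : ℝ) : ℝ :=
  (∑ p ∈ (Finset.range (k + 2) ×ˢ Finset.range (k + 2)).filter
      (fun p => 1 ≤ p.2 ∧ p.1 + 2 * p.2 = k + 1),
    iteratedDeriv p.1
      (fun r => D.fc p.2 r ((D.kappa : ℝ) / D.varkappa * S + Ψ) S) D.a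
        * R ^ p.1 / (Nat.factorial p.1 : ℝ))
  + (if k = 2 * D.q then R / (2 * D.q) else 0)

/-- `G_k(R, Ψ, S)`. -/
def Gcoef (D : OscSystem) (k : ℕ) (R Ψ S : ℝ) : ℝ :=
  iteratedDeriv k D.freq D.a * R ^ k / (Nat.factorial k : ℝ)
  - (D.kappa : ℝ) / D.varkappa * D.phaseCoeff k
  + ∑ p ∈ (Finset.range (k + 2) ×ˢ Finset.range (k + 2)).filter
      (fun p => 1 ≤ p.2 ∧ p.1 + 2 * p.2 = k),
    iteratedDeriv p.1
      (fun r => D.gc p.2 r ((D.kappa : ℝ) / D.varkappa * S + Ψ) S) D.a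
        * R ^ p.1 / (Nat.factorial p.1 : ℝ)

/-- The average over the period `2πϰ` in `S`. -/
def mean (D : OscSystem) (h : ℝ → ℝ) : ℝ :=
  1 / (2 * Real.pi * D.varkappa) * ∫ S in (0 : ℝ)..(2 * Real.pi * D.varkappa), h S

/-- The antiderivative of `h` with zero mean over the period `2πϰ`. -/
def zeroMeanPrimitive (D : OscSystem) (h : ℝ → ℝ) (S : ℝ) : ℝ :=
  (∫ x in (0 : ℝ)..S, h x) - D.mean (fun y => ∫ x in (0 : ℝ)..y, h x)

end OscSystem

/-- The terms of one order in the averaging procedure: the averaged right-hand sides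
`Lam = Λ_k`, `Om = Ω_k` and the terms `u = u_k`, `v = v_k` of the change of variables. -/
structure AvgTerm where
  Lam : ℝ → ℝ → ℝ
  Om : ℝ → ℝ → ℝ
  u : ℝ → ℝ → ℝ → ℝ
  v : ℝ → ℝ → ℝ → ℝ

/-- The term with all components zero. -/
def AvgTerm.zero : AvgTerm :=
  ⟨fun _ _ => 0, fun _ _ => 0, fun _ _ _ => 0, fun _ _ _ => 0⟩

namespace OscSystem

/-- The coefficient of `e^k` in the Taylor expansion at `e = 0` of
`∑_{j<k} e^j X_j(R + ∑_{i<k} e^i u_i, Ψ + ∑_{i<k} e^i v_i)`. -/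
def composeCoeff (k : ℕ) (X : ℕ → ℝ → ℝ → ℝ) (prev : ℕ → AvgTerm) (R Ψ S : ℝ) : ℝ :=
  iteratedDeriv k (fun e : ℝ =>
    ∑ j ∈ Finset.Ico 1 k, e ^ j *
      X j (R + ∑ i ∈ Finset.Ico 1 k, e ^ i * (prev i).u R Ψ S)
        (Ψ + ∑ i ∈ Finset.Ico 1 k, e ^ i * (prev i).v R Ψ S)) 0 / (Nat.factorial k : ℝ)

/-- The contribution of `w_1, …, w_{k-1}` to the coefficient of `t^(-k/(2q))` in the total time
derivative of `∑ t^(-i/(2q)) w_i(R, Ψ, S)`, apart from the term `s₀ ∂_S w_k`. -/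
def transportCoeff (D : OscSystem) (k : ℕ) (w : ℕ → ℝ → ℝ → ℝ → ℝ) (R Ψ S : ℝ) : ℝ :=
  ∑ j ∈ Finset.Ico 1 k,
    (D.Fcoef j R Ψ S * deriv (fun x => w (k - j) x Ψ S) R
      + D.Gcoef j R Ψ S * deriv (fun x => w (k - j) R x S) Ψ
      + D.phaseCoeff j * deriv (fun x => w (k - j) R Ψ x) S
      + (if j = 2 * D.q then (2 * (D.q : ℝ) - k) / (2 * D.q) else 0) * w (k - j) R Ψ S)

/-- Order `k` of the averaging procedure, from the orders `1, …, k-1` given by `prev`: `Λ_k`,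
`Ω_k` are the means in `S` of `F_k - F̃_k`, `G_k - G̃_k`, and `u_k`, `v_k` are the zero-mean
solutions of `s₀ ∂_S u_k = Λ_k - F_k + F̃_k`, `s₀ ∂_S v_k = Ω_k - G_k + G̃_k`. -/
def avgNext (D : OscSystem) (k : ℕ) (prev : ℕ → AvgTerm) : AvgTerm :=
  let X : ℝ → ℝ → ℝ → ℝ := fun R Ψ S =>
    D.Fcoef k R Ψ S - (composeCoeff k (fun j => (prev j).Lam) prev R Ψ S
      - D.transportCoeff k (fun j => (prev j).u) R Ψ S)
  let Y : ℝ → ℝ → ℝ → ℝ := fun R Ψ S =>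
    D.Gcoef k R Ψ S - (composeCoeff k (fun j => (prev j).Om) prev R Ψ S
      - D.transportCoeff k (fun j => (prev j).v) R Ψ S)
  { Lam := fun R Ψ => D.mean (X R Ψ)
    Om := fun R Ψ => D.mean (Y R Ψ)
    u := fun R Ψ S =>
      D.zeroMeanPrimitive (fun x => D.mean (X R Ψ) - X R Ψ x) S / D.s 0
    v := fun R Ψ S =>
      D.zeroMeanPrimitive (fun x => D.mean (Y R Ψ) - Y R Ψ x) S / D.s 0 }

/-- The terms of order `k ≥ 1` of the averaging procedure. -/
def avgTerm (D : OscSystem) (k : ℕ) : AvgTerm :=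
  D.avgNext k (fun i => if _h : i < k then avgTerm D i else AvgTerm.zero)
termination_by k

/-- `Λ_k(ρ, ψ)`. -/
def Lam (D : OscSystem) (k : ℕ) : ℝ → ℝ → ℝ := (D.avgTerm k).Lam

/-- `Ω_k(ρ, ψ)`. -/
def Om (D : OscSystem) (k : ℕ) : ℝ → ℝ → ℝ := (D.avgTerm k).Om

/-- The right-hand side `∑_{k=1}^N t^(-k/(2q)) Λ_k(ρ, ψ)` of the truncated system. -/
def LamHat (D : OscSystem) (N : ℕ) (ρ ψ t : ℝ) : ℝ :=
  ∑ k ∈ Finset.Icc 1 N, t ^ (-(k : ℝ) / (2 * D.q)) * D.Lam k ρ ψ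

/-- The right-hand side `∑_{k=1}^N t^(-k/(2q)) Ω_k(ρ, ψ)` of the truncated system. -/
def OmHat (D : OscSystem) (N : ℕ) (ρ ψ t : ℝ) : ℝ :=
  ∑ k ∈ Finset.Icc 1 N, t ^ (-(k : ℝ) / (2 * D.q)) * D.Om k ρ ψ

/-- `Λ_n` and, apart from `Ω_1`, `Ω_m` are the first coefficients that do not vanish
identically, `1 ≤ n ≤ 2q`, `2 ≤ m ≤ 2q`. -/
structure LeadingOrders (D : OscSystem) (n m : ℕ) : Prop where
  n_mem : n ∈ Set.Icc 1 (2 * D.q)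
  m_mem : m ∈ Set.Icc 2 (2 * D.q)
  Lam_zero : ∀ i, 1 ≤ i → i < n → ∀ ρ ψ, D.Lam i ρ ψ = 0
  Lam_ne : ∃ ρ ψ, D.Lam n ρ ψ ≠ 0
  Om_zero : ∀ j, 1 < j → j < m → ∀ ρ ψ, D.Om j ρ ψ = 0
  Om_ne : ∃ ρ ψ, D.Om m ρ ψ ≠ 0

/-- `ν_n = ∂_ψ Λ_n(0, ψ₀)`. -/
def nu (D : OscSystem) (n : ℕ) (ψ₀ : ℝ) : ℝ := deriv (fun ψ => D.Lam n 0 ψ) ψ₀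

/-- `λ_n = ∂_ρ Λ_n(0, ψ₀)`. -/
def lam (D : OscSystem) (n : ℕ) (ψ₀ : ℝ) : ℝ := deriv (fun ρ => D.Lam n ρ ψ₀) 0

/-- `ω_m = ∂_ψ Ω_m(0, ψ₀)`. -/
def om (D : OscSystem) (m : ℕ) (ψ₀ : ℝ) : ℝ := deriv (fun ψ => D.Om m 0 ψ) ψ₀

/-- `d_{n,m}`. -/
def dnm (D : OscSystem) (n m : ℕ) (ψ₀ : ℝ) : ℝ :=
  if n < m then D.lam n ψ₀
  else if n = m then D.lam n ψ₀ + D.om m ψ₀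
  else D.om m ψ₀

/-- The partial sum `∑_{k=1}^M t^(-(k+m-2)/(2q)) ϱ_k`. -/
def rhoSum (D : OscSystem) (m : ℕ) (ϱ : ℕ → ℝ) (M : ℕ) (t : ℝ) : ℝ :=
  ∑ k ∈ Finset.Icc 1 M, t ^ (-((k : ℝ) + m - 2) / (2 * D.q)) * ϱ k

/-- The partial sum `ψ₀ + ∑_{k=1}^M t^(-k/(2q)) ϕ_k`. -/
def phiSum (D : OscSystem) (ψ₀ : ℝ) (ϕ : ℕ → ℝ) (M : ℕ) (t : ℝ) : ℝ :=
  ψ₀ + ∑ k ∈ Finset.Icc 1 M, t ^ (-(k : ℝ) / (2 * D.q)) * ϕ k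

/-- The series `∑_{k≥1} t^(-(k+m-2)/(2q)) ϱ_k`, `ψ₀ + ∑_{k≥1} t^(-k/(2q)) ϕ_k` are a formal
solution of the truncated system `ϱ' = Λ̂_N(ϱ, ϕ, t)`, `ϕ' = Ω̂_N(ϱ, ϕ, t)`: the residuals of
their partial sums are of arbitrarily high order as `t → ∞`. -/
def IsFormalSolution (D : OscSystem) (N m : ℕ) (ψ₀ : ℝ) (ϱ ϕ : ℕ → ℝ) : Prop :=
  ∀ K : ℕ, ∀ᶠ M in atTop,
    (fun t => deriv (D.rhoSum m ϱ M) t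
        - D.LamHat N (D.rhoSum m ϱ M t) (D.phiSum ψ₀ ϕ M t) t)
      =O[atTop] (fun t : ℝ => t ^ (-(K : ℝ) / (2 * D.q))) ∧
    (fun t => deriv (D.phiSum ψ₀ ϕ M) t
        - D.OmHat N (D.rhoSum m ϱ M t) (D.phiSum ψ₀ ϕ M t) t)
      =O[atTop] (fun t : ℝ => t ^ (-(K : ℝ) / (2 * D.q)))

/-- The distance at time `t` of the state `(r, φ)` from the phase-locking regime
`r = a + t^(-1/(2q)) ϱ_{*,M}(t)`, `φ = (κ/ϰ) S(t) + ϕ_{*,M}(t)`. -/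
def regimeDist (D : OscSystem) (m : ℕ) (ψ₀ : ℝ) (ϱ ϕ : ℕ → ℝ) (M : ℕ) (r φ t : ℝ) : ℝ :=
  |r - D.a - t ^ (-1 / (2 * (D.q : ℝ))) * D.rhoSum m ϱ M t|
    + |φ - (D.kappa : ℝ) / D.varkappa * D.phase t - D.phiSum ψ₀ ϕ M t|

end OscSystem

end

noncomputable section

/-! ### Calculus with parameters -/

/-! Write `e = t^(-1/(2q))`. While `|r - a| ≤ e` and `Ψ` stays near `ψ₀`, the averaging change of
variables, truncated at order `N`, turns a solution of (1) into a pair `(ρ, ψ)` that solves the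
truncated averaged system up to `O(e^(N+1))` (`averaging`). The homological equations say that the
residual, as a function of `e`, has vanishing Taylor coefficients up to order `N`. Compactness in
`(R, Ψ)` and periodicity in `S` make the remainder uniform.

In the averaged system the amplitude is replaced by the rescaled phase velocity `z = η ρ + e^(m-1)
H`. Then `ψ' = e z` and `z' ≈ e^n P(ψ, e) + e^ℓ d z`: an oscillator in the potential `V = -∫ P`,
with a nondegenerate minimum near `ψ₀` because `ν η < 0`, and with negative friction because `d >
0`. The energy `z²/2 + e^(n-1) V` gains only from `z`, so a cross term `-c e^β z (ψ - ψ₀)` is added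
to spread the gain to `ψ - ψ₀`. The resulting `W` satisfies `W' ≥ γ e^θ (W - K e^n)` with `θ = β + 1
< 2q` (`exists_lyapunov`). Since `∫ e^θ dt` diverges while `W` is bounded near the equilibrium, no
pair with `|ψ - ψ₀| ≥ δ` initially can stay there (`averaged_instability`).

The distance in the theorem uses the unscaled amplitude, so a solution could be `ε`-close and yet
far outside the zone of width `e`. `exists_escape` excludes this: outside the zone `r` is almost
frozen for a time of order `|r - a| / e²`, during which the phase drifts at speed about `η (r - a)`,
too far to remain `ε`-close. Both facts combine in `exists_no_trapped_solution`. The partial sums of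
the regime tend to `0` and `ψ₀`, so the distance to the regime may be replaced by the distance to
`(a, ψ₀)`; `exists_exit` then produces the solution and its first exit time. The averaging order is
fixed at `4q`, so `ε` does not depend on `N`.

Formal solutions come from a recursion that is triangular at each order: `η ≠ 0` determines the
amplitude coefficient, then `ν ≠ 0` the phase coefficient (`formal_step`). -/

/-- Differentiation under the integral sign, by induction on the order. The codomain `F` is
quantified inside the induction because the differentiated integrand takes values in `E →L[ℝ] F`;
properness of `E` gives a constant dominating function on a closed ball. -/
theorem contDiff_nat_intervalIntegral_param {E : Type} [NormedAddCommGroup E] [NormedSpace ℝ E]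
    [ProperSpace E] (n : ℕ) : ∀ {F : Type} [NormedAddCommGroup F] [NormedSpace ℝ F]
    {H : E × ℝ → F}, ContDiff ℝ ∞ H →
    ContDiff ℝ n (fun x => ∫ s in (0 : ℝ)..1, H (x, s)) := by
  induction n with
  | zero =>
    intro F _ _ H hH
    refine contDiff_zero.2 ?_
    exact intervalIntegral.continuous_parametric_intervalIntegral_of_continuous'
      (f := fun x s => H (x, s)) hH.continuous 0 1
  | succ n ih =>
    intro F _ _ H hH
    set H' : E × ℝ → (E →L[ℝ] F) :=
      fun p => (fderiv ℝ H p).comp (ContinuousLinearMap.inl ℝ E ℝ) with hH'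
    have hH's : ContDiff ℝ ∞ H' :=
      (hH.fderiv_right (m := ∞) (by simp)).clm_comp contDiff_const
    have key : ∀ x, HasFDerivAt (fun x => ∫ s in (0 : ℝ)..1, H (x, s))
        (∫ s in (0 : ℝ)..1, H' (x, s)) x := by
      intro x
      have hcomp : IsCompact (Metric.closedBall x 1 ×ˢ Set.Icc (0 : ℝ) 1) :=
        (isCompact_closedBall x 1).prod isCompact_Icc
      obtain ⟨C, hC⟩ := hcomp.exists_bound_of_continuousOn hH's.continuous.continuousOn
      refine intervalIntegral.hasFDerivAt_integral_of_dominated_of_fderiv_le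
        (F := fun x s => H (x, s)) (F' := fun x s => H' (x, s)) (bound := fun _ => C)
        (Metric.closedBall_mem_nhds x one_pos) ?_ ?_ ?_ ?_ ?_ ?_
      · exact Eventually.of_forall fun y =>
          (hH.continuous.comp (by fun_prop : Continuous fun s : ℝ => (y, s))).aestronglyMeasurable
      · exact (hH.continuous.comp
          (by fun_prop : Continuous fun s : ℝ => (x, s))).intervalIntegrable _ _
      · exact (hH's.continuous.comp
          (by fun_prop : Continuous fun s : ℝ => (x, s))).aestronglyMeasurable
      · refine Eventually.of_forall fun t ht y hy => hC (y, t) ⟨hy, ?_⟩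
        rw [Set.uIoc_of_le zero_le_one] at ht
        exact ⟨ht.1.le, ht.2⟩
      · exact intervalIntegrable_const
      · refine Eventually.of_forall fun t _ y _ => ?_
        have h1 : HasFDerivAt H (fderiv ℝ H (y, t)) (y, t) :=
          (hH.differentiable (by simp) _).hasFDerivAt
        exact h1.comp y (hasFDerivAt_prodMk_left y t)
    push_cast
    exact contDiff_succ_iff_hasFDerivAt.2 ⟨_, ih hH's, key⟩

theorem ContDiff.intervalIntegral_param {E F : Type} [NormedAddCommGroup E] [NormedSpace ℝ E]
    [ProperSpace E] [NormedAddCommGroup F] [NormedSpace ℝ F] {H : E × ℝ → F}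
    (hH : ContDiff ℝ ∞ H) : ContDiff ℝ ∞ (fun x => ∫ s in (0 : ℝ)..1, H (x, s)) :=
  contDiff_infty.2 fun n => contDiff_nat_intervalIntegral_param n hH

/-- The integral `∫₀^b h(x, s) ds` depends smoothly on `(x, b)`. -/
theorem ContDiff.primitive_param {E : Type} [NormedAddCommGroup E] [NormedSpace ℝ E]
    [ProperSpace E] {H : E × ℝ → ℝ} (hH : ContDiff ℝ ∞ H) :
    ContDiff ℝ ∞ (fun p : E × ℝ => ∫ s in (0 : ℝ)..p.2, H (p.1, s)) := by
  have h1 : (fun p : E × ℝ => ∫ s in (0 : ℝ)..p.2, H (p.1, s))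
      -- Rescaling `s` moves the variable endpoint into the integrand, leaving an integral over a
      -- fixed interval.
      = fun p : E × ℝ => p.2 * ∫ s in (0 : ℝ)..1, H (p.1, p.2 * s) := by
    funext p
    have := intervalIntegral.mul_integral_comp_mul_left (a := 0) (b := 1)
      (f := fun s => H (p.1, s)) p.2
    simp only [mul_zero, mul_one] at this
    exact this.symm
  rw [h1]
  refine contDiff_snd.mul ?_
  refine ContDiff.intervalIntegral_param
    (H := fun z : (E × ℝ) × ℝ => H (z.1.1, z.1.2 * z.2)) ?_
  exact hH.comp (by fun_prop)

theorem ContDiff.deriv_param {E : Type*} [NormedAddCommGroup E] [NormedSpace ℝ E]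
    {H : E → ℝ → ℝ} (hH : ContDiff ℝ ∞ (fun p : E × ℝ => H p.1 p.2)) :
    ContDiff ℝ ∞ (fun p : E × ℝ => deriv (H p.1) p.2) := by
  have h1 : (fun p : E × ℝ => deriv (H p.1) p.2)
      = fun p => fderiv ℝ (fun p : E × ℝ => H p.1 p.2) p (0, 1) := by
    funext p
    have h2 : HasFDerivAt (fun p : E × ℝ => H p.1 p.2) (fderiv ℝ (fun p : E × ℝ => H p.1 p.2) p)
        (p.1, p.2) := (hH.differentiable (by simp) _).hasFDerivAt
    have h3 := (h2.comp p.2 (hasFDerivAt_prodMk_right p.1 p.2)).hasDerivAt.deriv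
    simpa [Function.comp_def] using h3
  rw [h1]
  exact (hH.fderiv_right (m := ∞) (by simp)).clm_apply contDiff_const

theorem ContDiff.iteratedDeriv_param {E : Type*} [NormedAddCommGroup E] [NormedSpace ℝ E]
    {H : E → ℝ → ℝ} (hH : ContDiff ℝ ∞ (fun p : E × ℝ => H p.1 p.2)) (k : ℕ) :
    ContDiff ℝ ∞ (fun p : E × ℝ => iteratedDeriv k (H p.1) p.2) := by
  induction k with
  | zero => simpa using hH
  | succ k ih =>
    simp only [iteratedDeriv_succ]
    exact ContDiff.deriv_param (H := fun x => iteratedDeriv k (H x)) ih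

/-! ### Taylor coefficients at zero -/

/-- The `k`-th Taylor coefficient of `A` at `0`. -/
def taylorCoeff (k : ℕ) (A : ℝ → ℝ) : ℝ := iteratedDeriv k A 0 / (Nat.factorial k : ℝ)

theorem ContDiff.of_infty_nat {A : ℝ → ℝ} (hA : ContDiff ℝ ∞ A) (k : ℕ) : ContDiff ℝ k A :=
  contDiff_infty.1 hA k

theorem taylorCoeff_zero (A : ℝ → ℝ) : taylorCoeff 0 A = A 0 := by simp [taylorCoeff]

theorem taylorCoeff_add {A B : ℝ → ℝ} (hA : ContDiff ℝ ∞ A) (hB : ContDiff ℝ ∞ B) (k : ℕ) :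
    taylorCoeff k (fun e => A e + B e) = taylorCoeff k A + taylorCoeff k B := by
  have := iteratedDeriv_add (x := 0) (hA.of_infty_nat k).contDiffAt (hB.of_infty_nat k).contDiffAt
  simp only [taylorCoeff, ← add_div]
  rw [← this]; rfl

theorem taylorCoeff_sub {A B : ℝ → ℝ} (hA : ContDiff ℝ ∞ A) (hB : ContDiff ℝ ∞ B) (k : ℕ) :
    taylorCoeff k (fun e => A e - B e) = taylorCoeff k A - taylorCoeff k B := by
  have := iteratedDeriv_sub (x := 0) (hA.of_infty_nat k).contDiffAt (hB.of_infty_nat k).contDiffAt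
  simp only [taylorCoeff, ← sub_div]
  rw [← this]; rfl

theorem taylorCoeff_sum {ι : Type*} {s : Finset ι} {A : ι → ℝ → ℝ}
    (hA : ∀ i ∈ s, ContDiff ℝ ∞ (A i)) (k : ℕ) :
    taylorCoeff k (fun e => ∑ i ∈ s, A i e) = ∑ i ∈ s, taylorCoeff k (A i) := by
  have := iteratedDeriv_fun_sum (x := (0 : ℝ)) (n := k) (I := s) (f := A)
    fun i hi => ((hA i hi).of_infty_nat k).contDiffAt
  simp only [taylorCoeff, ← Finset.sum_div, this]

theorem taylorCoeff_const_mul {A : ℝ → ℝ} (c : ℝ) (k : ℕ) :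
    taylorCoeff k (fun e => c * A e) = c * taylorCoeff k A := by
  simp only [taylorCoeff, iteratedDeriv_const_mul_field, mul_div_assoc]

theorem taylorCoeff_pow_mul {A : ℝ → ℝ} (hA : ContDiff ℝ ∞ A) (j k : ℕ) :
    taylorCoeff k (fun e => e ^ j * A e) = if j ≤ k then taylorCoeff (k - j) A else 0 := by
  have h := iteratedDeriv_mul (x := (0 : ℝ)) (n := k) (f := fun e : ℝ => e ^ j) (g := A)
    (by fun_prop) (hA.of_infty_nat k).contDiffAt
  have h' : iteratedDeriv k (fun e => e ^ j * A e) 0 = ∑ i ∈ Finset.range (k + 1),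
      if i = j then (k.choose j : ℝ) * j.factorial * iteratedDeriv (k - j) A 0 else 0 := by
    have h0 : (fun e => e ^ j * A e) = (fun e : ℝ => e ^ j) * A := rfl
    rw [h0, h]
    refine Finset.sum_congr rfl fun i _ => ?_
    rw [iteratedDeriv_fun_pow_zero]
    split_ifs with hij
    · subst hij; rfl
    · simp
  simp only [taylorCoeff, h', Finset.sum_ite_eq', Finset.mem_range, Nat.lt_succ_iff]
  split_ifs with hjk
  · have h2 : ((k.choose j : ℝ)) * j.factorial * (k - j).factorial = k.factorial := by
      exact_mod_cast Nat.choose_mul_factorial_mul_factorial hjk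
    have h3 : ((k - j).factorial : ℝ) ≠ 0 := by positivity
    have h4 : (k.factorial : ℝ) ≠ 0 := by positivity
    rw [div_eq_div_iff h4 h3, ← h2]; ring
  · simp

theorem taylorCoeff_const (c : ℝ) (k : ℕ) :
    taylorCoeff k (fun _ => c) = if k = 0 then c else 0 := by
  simp only [taylorCoeff, iteratedDeriv_const]
  split_ifs with h
  · simp [h]
  · simp

theorem taylorCoeff_pow_mul_const (c : ℝ) (j k : ℕ) :
    taylorCoeff k (fun e => e ^ j * c) = if k = j then c else 0 := by
  rw [taylorCoeff_pow_mul contDiff_const, taylorCoeff_const]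
  split_ifs <;> first | rfl | omega

theorem taylorCoeff_comp_affine {h : ℝ → ℝ} (hh : ContDiff ℝ ∞ h) (a R : ℝ) (k : ℕ) :
    taylorCoeff k (fun e => h (a + e * R)) = iteratedDeriv k h a * R ^ k / (k.factorial : ℝ) := by
  have h1 : (fun e => h (a + e * R)) = fun e => (fun x => h (a + x)) (R * e) := by
    funext e; simp [mul_comm]
  have hs : ContDiff ℝ k (fun x => h (a + x)) := (hh.of_infty_nat k).comp (by fun_prop)
  rw [taylorCoeff, h1, iteratedDeriv_comp_const_mul hs, iteratedDeriv_comp_const_add]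
  simp [mul_comm]

theorem taylor_isBigO {A : ℝ → ℝ} (hA : ContDiff ℝ ∞ A) (k : ℕ) :
    (fun e => A e - ∑ i ∈ Finset.range k, taylorCoeff i A * e ^ i) =O[𝓝 0] fun e => e ^ k := by
  have h := (taylor_isLittleO_univ (x₀ := 0) (hA.of_infty_nat k)).isBigO
  simp only [taylor_within_apply, sub_zero, iteratedDerivWithin_univ, smul_eq_mul] at h
  have h2 : (fun e : ℝ => taylorCoeff k A * e ^ k) =O[𝓝 0] fun e => e ^ k :=
    isBigO_const_mul_self _ _ _
  refine (h.add h2).congr_left fun e => ?_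
  rw [Finset.sum_range_succ]
  simp only [taylorCoeff]
  have : ∀ i, ((i.factorial : ℝ)⁻¹ * e ^ i * iteratedDeriv i A 0)
      = iteratedDeriv i A 0 / i.factorial * e ^ i := fun i => by ring
  simp only [this]; ring

theorem isBigO_pow_of_le {i k : ℕ} (h : i ≤ k) :
    (fun e : ℝ => e ^ k) =O[𝓝 0] fun e => e ^ i := by
  refine IsBigO.of_bound 1 ?_
  filter_upwards [Metric.closedBall_mem_nhds (0 : ℝ) one_pos] with e he
  rw [Metric.mem_closedBall, dist_zero_right] at he
  rw [norm_pow, norm_pow, one_mul]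
  exact pow_le_pow_of_le_one (norm_nonneg _) he h

/-- Once the lower coefficients vanish, Taylor's formula leaves `c e^i = O(e^(i+1))`, which on the
punctured neighbourhood forces `c = 0`. -/
theorem taylorCoeff_eq_zero_of_isBigO {A : ℝ → ℝ} (hA : ContDiff ℝ ∞ A) {k : ℕ}
    (h : A =O[𝓝 0] fun e => e ^ k) (i : ℕ) (hi : i < k) : taylorCoeff i A = 0 := by
  induction i using Nat.strong_induction_on with
  | _ i ih =>
    by_contra hne
    have h1 := taylor_isBigO hA (i + 1)
    rw [show (fun e => A e - ∑ j ∈ Finset.range (i + 1), taylorCoeff j A * e ^ j)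
        = fun e => A e - taylorCoeff i A * e ^ i from by
      funext e
      rw [Finset.sum_range_succ, Finset.sum_eq_zero, zero_add]
      intro j hj
      have hj := Finset.mem_range.1 hj
      rw [ih j hj (by omega), zero_mul]] at h1
    have h2 : (fun e => taylorCoeff i A * e ^ i) =O[𝓝 0] fun e : ℝ => e ^ (i + 1) :=
      ((h.trans (isBigO_pow_of_le (show i + 1 ≤ k by omega))).sub h1).congr_left
        fun e => by ring
    have h3 : (fun e : ℝ => e ^ i) =O[𝓝[≠] 0] fun e : ℝ => e ^ (i + 1) :=
      ((isBigO_const_mul_left_iff hne).1 h2).mono nhdsWithin_le_nhds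
    have h4 : (fun e : ℝ => e ^ (i + 1)) =o[𝓝[≠] 0] fun e : ℝ => e ^ i :=
      (isLittleO_pow_pow (Nat.lt_succ_self i)).mono nhdsWithin_le_nhds
    refine isLittleO_irrefl ?_ (h3.trans_isLittleO h4)
    refine Eventually.frequently ?_
    filter_upwards [self_mem_nhdsWithin] with e he
    exact pow_ne_zero _ he

theorem isBigO_of_taylorCoeff_eq_zero {A : ℝ → ℝ} (hA : ContDiff ℝ ∞ A) {k : ℕ}
    (h : ∀ i < k, taylorCoeff i A = 0) : A =O[𝓝 0] fun e => e ^ k := by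
  refine (taylor_isBigO hA k).congr_left fun e => ?_
  rw [Finset.sum_eq_zero, sub_zero]
  intro i hi
  rw [h i (Finset.mem_range.1 hi), zero_mul]

theorem taylorCoeff_congr_of_isBigO {A B : ℝ → ℝ} (hA : ContDiff ℝ ∞ A) (hB : ContDiff ℝ ∞ B)
    {k : ℕ} (h : (fun e => A e - B e) =O[𝓝 0] fun e => e ^ k) (i : ℕ) (hi : i < k) :
    taylorCoeff i A = taylorCoeff i B := by
  have := taylorCoeff_eq_zero_of_isBigO (hA.sub hB) h i hi
  rwa [taylorCoeff_sub hA hB, sub_eq_zero] at this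

/-- If the Taylor coefficients of order at most `N` in the last variable vanish, the function is
`O(e^(N+1))` uniformly on compact sets of parameters. -/
theorem exists_bound_of_taylorCoeff_eq_zero {E : Type*} [NormedAddCommGroup E] [NormedSpace ℝ E]
    {B : E → ℝ → ℝ} (hB : ContDiff ℝ ∞ (fun p : E × ℝ => B p.1 p.2)) {K : Set E}
    (hK : IsCompact K) (N : ℕ) (h : ∀ x ∈ K, ∀ i ≤ N, taylorCoeff i (B x) = 0) :
    ∃ C : ℝ, 0 ≤ C ∧ ∀ x ∈ K, ∀ e ∈ Set.Icc (0 : ℝ) 1, |B x e| ≤ C * e ^ (N + 1) := by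
  obtain ⟨C, hC⟩ := (hK.prod (isCompact_Icc (a := (0 : ℝ)) (b := 1))).exists_bound_of_continuousOn
    (hB.iteratedDeriv_param (N + 1)).continuous.continuousOn
  refine ⟨max C 0, le_max_right _ _, fun x hx e he => ?_⟩
  have hBx : ContDiff ℝ ∞ (B x) := hB.comp (by fun_prop : ContDiff ℝ ∞ fun e : ℝ => (x, e))
  -- The Lagrange remainder needs a nondegenerate interval, so `e = 0` is read off from the zeroth
  -- coefficient.
  rcases he.1.eq_or_lt with h0 | h0
  · have := h x hx 0 (Nat.zero_le _)
    rw [taylorCoeff_zero] at this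
    rw [← h0, this]; simp
  obtain ⟨y, hy, hyeq⟩ := taylor_mean_remainder_lagrange_iteratedDeriv (f := B x) (x := e)
    (x₀ := 0) (n := N) h0.ne (hBx.of_infty_nat (N + 1)).contDiffOn
  rw [Set.uIoo_of_le h0.le] at hy
  have hT : taylorWithinEval (B x) N (Set.uIcc 0 e) 0 e = 0 := by
    rw [taylor_within_apply]
    refine Finset.sum_eq_zero fun i hi => ?_
    have hi' := h x hx i (Nat.lt_succ_iff.1 (Finset.mem_range.1 hi))
    have : iteratedDeriv i (B x) 0 = 0 := by
      rw [taylorCoeff, div_eq_zero_iff] at hi'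
      rcases hi' with h | h
      · exact h
      · exact absurd h (by positivity)
    rw [iteratedDerivWithin_eq_iteratedDeriv (by rw [Set.uIcc_of_le h0.le]; exact uniqueDiffOn_Icc h0)
      ((hBx.of_infty_nat i).contDiffAt) Set.left_mem_uIcc, this, smul_zero]
  rw [hT, sub_zero, sub_zero] at hyeq
  rw [hyeq, abs_div, abs_mul, abs_of_pos (pow_pos h0 (N + 1)),
    abs_of_pos (by positivity : (0 : ℝ) < ((N + 1).factorial : ℝ))]
  have h1 : |iteratedDeriv (N + 1) (B x) y| ≤ C :=
    hC (x, y) ⟨hx, ⟨hy.1.le, hy.2.le.trans he.2⟩⟩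
  have h2 : (1 : ℝ) ≤ ((N + 1).factorial : ℝ) := by exact_mod_cast Nat.factorial_pos _
  refine (div_le_self (by positivity) h2).trans ?_
  gcongr
  exact h1.trans (le_max_left _ _)

/-! ### Smooth functions of two and three real variables in curried form -/

def Smooth2 (h : ℝ → ℝ → ℝ) : Prop := ContDiff ℝ ∞ (fun p : ℝ × ℝ => h p.1 p.2)

def Smooth3 (h : ℝ → ℝ → ℝ → ℝ) : Prop := ContDiff ℝ ∞ (fun p : ℝ × ℝ × ℝ => h p.1 p.2.1 p.2.2)

section comp

variable {E : Type*} [NormedAddCommGroup E] [NormedSpace ℝ E]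

theorem Smooth2.comp {h : ℝ → ℝ → ℝ} (hh : Smooth2 h) {x y : E → ℝ} (hx : ContDiff ℝ ∞ x)
    (hy : ContDiff ℝ ∞ y) : ContDiff ℝ ∞ (fun p => h (x p) (y p)) :=
  ContDiff.comp₂ hh hx hy

theorem Smooth3.comp {h : ℝ → ℝ → ℝ → ℝ} (hh : Smooth3 h) {x y z : E → ℝ} (hx : ContDiff ℝ ∞ x)
    (hy : ContDiff ℝ ∞ y) (hz : ContDiff ℝ ∞ z) : ContDiff ℝ ∞ (fun p => h (x p) (y p) (z p)) :=
  ContDiff.comp₃ hh hx hy hz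

end comp

theorem Smooth3.deriv₁ {h : ℝ → ℝ → ℝ → ℝ} (hh : Smooth3 h) :
    Smooth3 (fun x y z => deriv (fun x => h x y z) x) := by
  have h1 := ContDiff.deriv_param (E := ℝ × ℝ) (H := fun p x => h x p.1 p.2)
    (hh.comp (by fun_prop) (by fun_prop) (by fun_prop))
  exact h1.comp (by fun_prop : ContDiff ℝ ∞ fun p : ℝ × ℝ × ℝ => ((p.2.1, p.2.2), p.1))

theorem Smooth3.deriv₂ {h : ℝ → ℝ → ℝ → ℝ} (hh : Smooth3 h) :
    Smooth3 (fun x y z => deriv (fun y => h x y z) y) := by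
  have h1 := ContDiff.deriv_param (E := ℝ × ℝ) (H := fun p y => h p.1 y p.2)
    (hh.comp (by fun_prop) (by fun_prop) (by fun_prop))
  exact h1.comp (by fun_prop : ContDiff ℝ ∞ fun p : ℝ × ℝ × ℝ => ((p.1, p.2.2), p.2.1))

theorem Smooth3.deriv₃ {h : ℝ → ℝ → ℝ → ℝ} (hh : Smooth3 h) :
    Smooth3 (fun x y z => deriv (fun z => h x y z) z) := by
  have h1 := ContDiff.deriv_param (E := ℝ × ℝ) (H := fun p z => h p.1 p.2 z)
    (hh.comp (by fun_prop) (by fun_prop) (by fun_prop))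
  exact h1.comp (by fun_prop : ContDiff ℝ ∞ fun p : ℝ × ℝ × ℝ => ((p.1, p.2.1), p.2.2))

theorem Smooth2.deriv₂ {h : ℝ → ℝ → ℝ} (hh : Smooth2 h) :
    Smooth2 (fun x y => deriv (fun y => h x y) y) :=
  ContDiff.deriv_param (E := ℝ) (H := fun x y => h x y) hh

/-! ### Smooth cut-offs of the coefficients -/

/-- Every point with `|p.1| < c` has a neighbourhood where `g` is smooth; every other point has one
where the bump vanishes. -/
theorem contDiff_bump_mul {E : Type*} [NormedAddCommGroup E] [NormedSpace ℝ E] {a c : ℝ}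
    (χ : ContDiffBump a) (hχ : |a| + χ.rOut < c) {g : ℝ × E → ℝ}
    (hg : ContDiffOn ℝ ∞ g {p | |p.1| ≤ c}) : ContDiff ℝ ∞ (fun p : ℝ × E => χ p.1 * g p) := by
  rw [contDiff_iff_contDiffAt]
  intro p
  by_cases hp : |p.1| < c
  · have hmem : {p : ℝ × E | |p.1| ≤ c} ∈ 𝓝 p := by
      have : IsOpen {p : ℝ × E | |p.1| < c} := isOpen_lt (by fun_prop) (by fun_prop)
      exact mem_of_superset (this.mem_nhds hp) fun q (hq : |q.1| < c) => hq.le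
    exact (χ.contDiff.contDiffAt.comp p contDiffAt_fst).mul (hg.contDiffAt hmem)
  · have hev : (fun p : ℝ × E => χ p.1 * g p) =ᶠ[𝓝 p] fun _ => 0 := by
      have hop : IsOpen {p : ℝ × E | |a| + χ.rOut < |p.1|} := isOpen_lt (by fun_prop) (by fun_prop)
      filter_upwards [hop.mem_nhds (hχ.trans_le (not_lt.1 hp))] with q hq
      have : χ q.1 = 0 := by
        refine χ.zero_of_le_dist ?_
        rw [Real.dist_eq]
        have := abs_sub_abs_le_abs_sub q.1 a
        have hq' : |a| + χ.rOut < |q.1| := hq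
        linarith
      rw [this, zero_mul]
    exact contDiffAt_const.congr_of_eventuallyEq hev

namespace OscSystem

/-- Globally smooth functions that agree with the coefficients of the system for `|r - a| ≤ b`. -/
structure IsSmoothModel (D : OscSystem) (b : ℝ) (F G : ℕ → ℝ → ℝ → ℝ → ℝ) (w : ℝ → ℝ) : Prop where
  b_pos : 0 < b
  b_lt : |D.a| + b < D.calR
  F_smooth : ∀ j, 1 ≤ j → Smooth3 (F j)
  G_smooth : ∀ j, 1 ≤ j → Smooth3 (G j)
  w_smooth : ContDiff ℝ ∞ w
  F_phi : ∀ j, 1 ≤ j → ∀ r φ S, F j r (φ + 2 * Real.pi) S = F j r φ S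
  G_phi : ∀ j, 1 ≤ j → ∀ r φ S, G j r (φ + 2 * Real.pi) S = G j r φ S
  F_S : ∀ j, 1 ≤ j → ∀ r φ S, F j r φ (S + 2 * Real.pi) = F j r φ S
  G_S : ∀ j, 1 ≤ j → ∀ r φ S, G j r φ (S + 2 * Real.pi) = G j r φ S
  F_eq : ∀ j r φ S, |r - D.a| ≤ b → F j r φ S = D.fc j r φ S
  G_eq : ∀ j r φ S, |r - D.a| ≤ b → G j r φ S = D.gc j r φ S
  w_eq : ∀ r, |r - D.a| ≤ b → w r = D.freq r

/-- The given functions are controlled only for `|r| ≤ calR`. Multiplying by a bump in `r` that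
equals one near `a` gives globally smooth functions with the same derivatives at `a`, and
periodicity in `φ`, `S` survives because the bump depends on `r` alone. -/
theorem Valid.exists_isSmoothModel {D : OscSystem} (hD : D.Valid) :
    ∃ b F G w, D.IsSmoothModel b F G w := by
  have hpos : 0 < D.calR - |D.a| := sub_pos.2 hD.a_lt
  -- A third of the gap: the bump with radii `b` and `2b` is still supported strictly inside `|r| <
  -- calR`.
  set b := (D.calR - |D.a|) / 3 with hb
  have hb0 : 0 < b := by positivity
  let χ : ContDiffBump D.a := ⟨b, 2 * b, hb0, by linarith⟩
  have hχ : |D.a| + χ.rOut < D.calR := by change |D.a| + 2 * b < _; linarith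
  have hχ0 : ∀ r, D.calR < |r| → χ r = 0 := fun r hr => by
    refine χ.zero_of_le_dist ?_
    rw [Real.dist_eq]
    have := abs_sub_abs_le_abs_sub r D.a
    linarith
  have hχ1 : ∀ r, |r - D.a| ≤ b → χ r = 1 := fun r hr =>
    χ.one_of_mem_closedBall (by rwa [Metric.mem_closedBall, Real.dist_eq])
  have hper : ∀ {x y : ℝ} (r : ℝ), (|r| ≤ D.calR → x = y) → χ r * x = χ r * y := fun r h => by
    by_cases hr : |r| ≤ D.calR
    · rw [h hr]
    · rw [hχ0 r (not_le.1 hr)]; simp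
  refine ⟨b, fun j r φ S => χ r * D.fc j r φ S, fun j r φ S => χ r * D.gc j r φ S,
    fun r => χ r * D.freq r, ⟨hb0, by linarith, ?_, ?_, ?_, ?_, ?_, ?_, ?_, ?_, ?_, ?_⟩⟩
  · exact fun j hj => contDiff_bump_mul χ hχ (hD.f_class.coeff_smooth j hj)
  · exact fun j hj => contDiff_bump_mul χ hχ (hD.g_class.coeff_smooth j hj)
  · have h1 : ContDiff ℝ ∞ (fun p : ℝ × ℝ => χ p.1 * D.freq p.1) :=
      contDiff_bump_mul χ hχ (g := fun p : ℝ × ℝ => D.freq p.1)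
        (hD.freq_smooth.comp contDiffOn_fst fun p hp => hp)
    exact h1.comp (by fun_prop : ContDiff ℝ ∞ fun r : ℝ => (r, (0 : ℝ)))
  · exact fun j hj r φ S => hper r (hD.f_class.coeff_periodic_phi j hj r φ S)
  · exact fun j hj r φ S => hper r (hD.g_class.coeff_periodic_phi j hj r φ S)
  · exact fun j hj r φ S => hper r (hD.f_class.coeff_periodic_S j hj r φ S)
  · exact fun j hj r φ S => hper r (hD.g_class.coeff_periodic_S j hj r φ S)
  · intro j r φ S hr; simp [hχ1 r hr]
  · intro j r φ S hr; simp [hχ1 r hr]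
  · intro r hr; simp [hχ1 r hr]

section model

variable {D : OscSystem} {b : ℝ} {F G : ℕ → ℝ → ℝ → ℝ → ℝ} {w : ℝ → ℝ}

theorem IsSmoothModel.eventually_near (h : D.IsSmoothModel b F G w) :
    ∀ᶠ r in 𝓝 D.a, |r - D.a| ≤ b := by
  filter_upwards [Metric.closedBall_mem_nhds D.a h.b_pos] with r hr
  rwa [Metric.mem_closedBall, Real.dist_eq] at hr

theorem IsSmoothModel.Fcoef_eq (h : D.IsSmoothModel b F G w) (k : ℕ) (R Ψ S : ℝ) :
    D.Fcoef k R Ψ S = (∑ p ∈ (Finset.range (k + 2) ×ˢ Finset.range (k + 2)).filter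
      (fun p => 1 ≤ p.2 ∧ p.1 + 2 * p.2 = k + 1),
    iteratedDeriv p.1 (fun r => F p.2 r ((D.kappa : ℝ) / D.varkappa * S + Ψ) S) D.a
        * R ^ p.1 / (Nat.factorial p.1 : ℝ))
      + (if k = 2 * D.q then R / (2 * D.q) else 0) := by
  unfold Fcoef
  congr 1
  refine Finset.sum_congr rfl fun p _ => ?_
  congr 2
  refine Filter.EventuallyEq.iteratedDeriv_eq _ ?_
  filter_upwards [h.eventually_near] with r hr
  exact (h.F_eq _ _ _ _ hr).symm

theorem IsSmoothModel.Gcoef_eq (h : D.IsSmoothModel b F G w) (k : ℕ) (R Ψ S : ℝ) :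
    D.Gcoef k R Ψ S = iteratedDeriv k w D.a * R ^ k / (Nat.factorial k : ℝ)
      - (D.kappa : ℝ) / D.varkappa * D.phaseCoeff k
      + ∑ p ∈ (Finset.range (k + 2) ×ˢ Finset.range (k + 2)).filter
      (fun p => 1 ≤ p.2 ∧ p.1 + 2 * p.2 = k),
    iteratedDeriv p.1 (fun r => G p.2 r ((D.kappa : ℝ) / D.varkappa * S + Ψ) S) D.a
        * R ^ p.1 / (Nat.factorial p.1 : ℝ) := by
  unfold Gcoef
  congr 1
  · congr 3
    refine Filter.EventuallyEq.iteratedDeriv_eq _ ?_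
    filter_upwards [h.eventually_near] with r hr
    exact (h.w_eq _ hr).symm
  · refine Finset.sum_congr rfl fun p _ => ?_
    congr 2
    refine Filter.EventuallyEq.iteratedDeriv_eq _ ?_
    filter_upwards [h.eventually_near] with r hr
    exact (h.G_eq _ _ _ _ hr).symm

theorem smooth3_iteratedDeriv_at {H : ℝ → ℝ → ℝ → ℝ} (hH : Smooth3 H) (c a : ℝ) (p : ℕ) :
    Smooth3 (fun _ Ψ S => iteratedDeriv p (fun r => H r (c * S + Ψ) S) a) := by
  have h1 := ContDiff.iteratedDeriv_param (E := ℝ × ℝ)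
    (H := fun z r => H r (c * z.2 + z.1) z.2)
    (hH.comp (by fun_prop) (by fun_prop) (by fun_prop)) p
  exact h1.comp (by fun_prop : ContDiff ℝ ∞ fun z : ℝ × ℝ × ℝ => ((z.2.1, z.2.2), a))

/-- Shifting `S` by `2πϰ` advances the resonant angle by `2πκ` and `S` itself by `ϰ` periods; this
is why averages are taken over `2πϰ`. -/
theorem periodic_resonant {H : ℝ → ℝ → ℝ → ℝ} (hD : D.Valid)
    (hφ : ∀ r φ S, H r (φ + 2 * Real.pi) S = H r φ S)
    (hS : ∀ r φ S, H r φ (S + 2 * Real.pi) = H r φ S) (r Ψ S : ℝ) :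
    H r ((D.kappa : ℝ) / D.varkappa * (S + 2 * Real.pi * D.varkappa) + Ψ)
      (S + 2 * Real.pi * D.varkappa) = H r ((D.kappa : ℝ) / D.varkappa * S + Ψ) S := by
  have hv : (D.varkappa : ℝ) ≠ 0 := by
    have := hD.varkappa_pos
    positivity
  have e1 : (D.kappa : ℝ) / D.varkappa * (S + 2 * Real.pi * D.varkappa) + Ψ
      = ((D.kappa : ℝ) / D.varkappa * S + Ψ) + D.kappa * (2 * Real.pi) := by
    field_simp; ring
  have e2 : S + 2 * Real.pi * D.varkappa = S + D.varkappa * (2 * Real.pi) := by ring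
  rw [e1, e2]
  have p1 : Function.Periodic (fun φ => H r φ (S + D.varkappa * (2 * Real.pi))) (2 * Real.pi) :=
    fun φ => hφ r φ _
  have p2 : ∀ φ, Function.Periodic (fun S => H r φ S) (2 * Real.pi) := fun φ S => hS r φ S
  exact (p1.nat_mul D.kappa _).trans (p2 _ |>.nat_mul D.varkappa S)

theorem IsSmoothModel.smooth_Fcoef (h : D.IsSmoothModel b F G w) (k : ℕ) :
    Smooth3 (D.Fcoef k) := by
  unfold Smooth3
  simp only [h.Fcoef_eq]
  refine ContDiff.add (ContDiff.sum fun p hp => ?_) ?_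
  · have hp := (Finset.mem_filter.1 hp).2.1
    exact ((smooth3_iteratedDeriv_at (h.F_smooth p.2 hp) _ _ _).mul (by fun_prop)).div_const _
  · split_ifs <;> fun_prop

theorem IsSmoothModel.smooth_Gcoef (h : D.IsSmoothModel b F G w) (k : ℕ) :
    Smooth3 (D.Gcoef k) := by
  unfold Smooth3
  simp only [h.Gcoef_eq]
  refine ContDiff.add (by fun_prop) (ContDiff.sum fun p hp => ?_)
  have hp := (Finset.mem_filter.1 hp).2.1
  exact ((smooth3_iteratedDeriv_at (h.G_smooth p.2 hp) _ _ _).mul (by fun_prop)).div_const _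

theorem IsSmoothModel.periodic_Fcoef (h : D.IsSmoothModel b F G w) (hD : D.Valid) (k : ℕ)
    (R Ψ S : ℝ) : D.Fcoef k R Ψ (S + 2 * Real.pi * D.varkappa) = D.Fcoef k R Ψ S := by
  rw [h.Fcoef_eq, h.Fcoef_eq]
  congr 1
  refine Finset.sum_congr rfl fun p hp => ?_
  have hp := (Finset.mem_filter.1 hp).2.1
  simp only [periodic_resonant hD (h.F_phi p.2 hp) (h.F_S p.2 hp)]

theorem IsSmoothModel.periodic_Gcoef (h : D.IsSmoothModel b F G w) (hD : D.Valid) (k : ℕ)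
    (R Ψ S : ℝ) : D.Gcoef k R Ψ (S + 2 * Real.pi * D.varkappa) = D.Gcoef k R Ψ S := by
  rw [h.Gcoef_eq, h.Gcoef_eq]
  congr 1
  refine Finset.sum_congr rfl fun p hp => ?_
  have hp := (Finset.mem_filter.1 hp).2.1
  simp only [periodic_resonant hD (h.G_phi p.2 hp) (h.G_S p.2 hp)]

end model

/-! ### Smoothness and periodicity of the averaging terms -/

theorem composeCoeff_congr {k : ℕ} {X X' : ℕ → ℝ → ℝ → ℝ} {prev prev' : ℕ → AvgTerm}
    (hX : ∀ i, 1 ≤ i → i < k → X i = X' i) (h : ∀ i, 1 ≤ i → i < k → prev i = prev' i)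
    (R Ψ S : ℝ) : composeCoeff k X prev R Ψ S = composeCoeff k X' prev' R Ψ S := by
  unfold composeCoeff
  congr 2
  funext e
  have h1 : ∑ i ∈ Finset.Ico 1 k, e ^ i * (prev i).u R Ψ S
      = ∑ i ∈ Finset.Ico 1 k, e ^ i * (prev' i).u R Ψ S :=
    Finset.sum_congr rfl fun i hi => by
      rw [h i (Finset.mem_Ico.1 hi).1 (Finset.mem_Ico.1 hi).2]
  have h2 : ∑ i ∈ Finset.Ico 1 k, e ^ i * (prev i).v R Ψ S
      = ∑ i ∈ Finset.Ico 1 k, e ^ i * (prev' i).v R Ψ S :=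
    Finset.sum_congr rfl fun i hi => by
      rw [h i (Finset.mem_Ico.1 hi).1 (Finset.mem_Ico.1 hi).2]
  rw [h1, h2]
  exact Finset.sum_congr rfl fun i hi => by
    rw [hX i (Finset.mem_Ico.1 hi).1 (Finset.mem_Ico.1 hi).2]

theorem transportCoeff_congr (D : OscSystem) {k : ℕ} {w w' : ℕ → ℝ → ℝ → ℝ → ℝ}
    (h : ∀ i, 1 ≤ i → i < k → w i = w' i) (R Ψ S : ℝ) :
    D.transportCoeff k w R Ψ S = D.transportCoeff k w' R Ψ S := by
  unfold transportCoeff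
  refine Finset.sum_congr rfl fun j hj => ?_
  have := Finset.mem_Ico.1 hj
  rw [h (k - j) (by omega) (by omega)]

theorem avgNext_congr (D : OscSystem) {k : ℕ} {prev prev' : ℕ → AvgTerm}
    (h : ∀ i, 1 ≤ i → i < k → prev i = prev' i) : D.avgNext k prev = D.avgNext k prev' := by
  unfold avgNext
  have h1 : ∀ R Ψ S, composeCoeff k (fun j => (prev j).Lam) prev R Ψ S
      = composeCoeff k (fun j => (prev' j).Lam) prev' R Ψ S :=
    composeCoeff_congr (fun i h1 h2 => by rw [h i h1 h2]) h
  have h2 : ∀ R Ψ S, composeCoeff k (fun j => (prev j).Om) prev R Ψ S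
      = composeCoeff k (fun j => (prev' j).Om) prev' R Ψ S :=
    composeCoeff_congr (fun i h1 h2 => by rw [h i h1 h2]) h
  have h3 : ∀ R Ψ S, D.transportCoeff k (fun j => (prev j).u) R Ψ S
      = D.transportCoeff k (fun j => (prev' j).u) R Ψ S :=
    D.transportCoeff_congr (fun i h1 h2 => by rw [h i h1 h2])
  have h4 : ∀ R Ψ S, D.transportCoeff k (fun j => (prev j).v) R Ψ S
      = D.transportCoeff k (fun j => (prev' j).v) R Ψ S :=
    D.transportCoeff_congr (fun i h1 h2 => by rw [h i h1 h2])
  simp only [h1, h2, h3, h4]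

/-- The guard `i < k` needed for the recursion is invisible, since `avgNext k` reads only the orders
`1, …, k-1`. -/
theorem avgTerm_eq (D : OscSystem) (k : ℕ) : D.avgTerm k = D.avgNext k D.avgTerm := by
  conv_lhs => rw [avgTerm]
  exact D.avgNext_congr fun i _ hi => by simp [hi]

theorem mean_smooth (D : OscSystem) {X : ℝ → ℝ → ℝ → ℝ} (hX : Smooth3 X) :
    Smooth2 (fun R Ψ => D.mean (X R Ψ)) := by
  unfold mean
  have h1 := ContDiff.primitive_param (E := ℝ × ℝ) (H := fun z => X z.1.1 z.1.2 z.2)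
    (hX.comp (by fun_prop) (by fun_prop) (by fun_prop))
  exact contDiff_const.mul (h1.comp
    (by fun_prop : ContDiff ℝ ∞ fun z : ℝ × ℝ => (z, 2 * Real.pi * (D.varkappa : ℝ))))

theorem primitive_smooth {X : ℝ → ℝ → ℝ → ℝ} (hX : Smooth3 X) :
    Smooth3 (fun R Ψ S => ∫ x in (0 : ℝ)..S, X R Ψ x) := by
  have h1 := ContDiff.primitive_param (E := ℝ × ℝ) (H := fun z => X z.1.1 z.1.2 z.2)
    (hX.comp (by fun_prop) (by fun_prop) (by fun_prop))
  exact h1.comp (by fun_prop : ContDiff ℝ ∞ fun z : ℝ × ℝ × ℝ => ((z.1, z.2.1), z.2.2))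

theorem zeroMeanPrimitive_smooth (D : OscSystem) {X : ℝ → ℝ → ℝ → ℝ} (hX : Smooth3 X) :
    Smooth3 (fun R Ψ S => D.zeroMeanPrimitive (X R Ψ) S) := by
  unfold zeroMeanPrimitive
  have h1 := primitive_smooth hX
  exact ContDiff.sub h1 ((D.mean_smooth h1).comp (by fun_prop) (by fun_prop))

theorem sub_mean_smooth (D : OscSystem) {X : ℝ → ℝ → ℝ → ℝ} (hX : Smooth3 X) :
    Smooth3 (fun R Ψ S => D.mean (X R Ψ) - X R Ψ S) :=
  ContDiff.sub ((D.mean_smooth hX).comp (by fun_prop) (by fun_prop)) hX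

theorem Valid.period_pos {D : OscSystem} (hD : D.Valid) : 0 < 2 * Real.pi * (D.varkappa : ℝ) := by
  have h1 := hD.varkappa_pos
  have h2 := Real.pi_pos
  positivity

/-- Subtracting the mean makes the integral over one period vanish, so the primitive does not drift.
This is the solvability condition that determines `Λ_k` and `Ω_k`. -/
theorem zeroMeanPrimitive_periodic {D : OscSystem} (hD : D.Valid) {X : ℝ → ℝ}
    (hX : Continuous X) (hper : ∀ S, X (S + 2 * Real.pi * D.varkappa) = X S) (S : ℝ) :
    D.zeroMeanPrimitive (fun x => D.mean X - X x) (S + 2 * Real.pi * D.varkappa)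
      = D.zeroMeanPrimitive (fun x => D.mean X - X x) S := by
  set T := 2 * Real.pi * (D.varkappa : ℝ) with hT
  have hT0 : T ≠ 0 := hD.period_pos.ne'
  set Y : ℝ → ℝ := fun x => D.mean X - X x with hY
  have hYc : Continuous Y := by fun_prop
  have hYp : Function.Periodic Y T := fun x => by simp only [hY, hper x]
  have h0 : ∫ x in (0 : ℝ)..T, Y x = 0 := by
    simp only [hY]
    rw [intervalIntegral.integral_sub intervalIntegrable_const (hX.intervalIntegrable _ _),
      intervalIntegral.integral_const, mean, ← hT]
    simp only [smul_eq_mul]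
    field_simp
    ring
  have h1 : ∫ x in (0 : ℝ)..(S + T), Y x = (∫ x in (0 : ℝ)..S, Y x) + ∫ x in S..(S + T), Y x :=
    (intervalIntegral.integral_add_adjacent_intervals (hYc.intervalIntegrable _ _)
      (hYc.intervalIntegrable _ _)).symm
  have h2 : ∫ x in S..(S + T), Y x = ∫ x in (0 : ℝ)..(0 + T), Y x :=
    hYp.intervalIntegral_add_eq S 0
  rw [zero_add, h0] at h2
  unfold zeroMeanPrimitive
  rw [h1, h2, add_zero]

theorem hasDerivAt_zeroMeanPrimitive (D : OscSystem) {X : ℝ → ℝ} (hX : Continuous X) (S : ℝ) :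
    HasDerivAt (D.zeroMeanPrimitive X) (X S) S := by
  unfold zeroMeanPrimitive
  exact (intervalIntegral.integral_hasDerivAt_right (hX.intervalIntegrable _ _)
    hX.stronglyMeasurable.stronglyMeasurableAtFilter hX.continuousAt).sub_const _

end OscSystem

/-- Regularity of one order of the averaging procedure, with period `T` in `S`. -/
structure AvgTerm.IsRegular (A : AvgTerm) (T : ℝ) : Prop where
  Lam : Smooth2 A.Lam
  Om : Smooth2 A.Om
  u : Smooth3 A.u
  v : Smooth3 A.v
  u_periodic : ∀ R Ψ S, A.u R Ψ (S + T) = A.u R Ψ S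
  v_periodic : ∀ R Ψ S, A.v R Ψ (S + T) = A.v R Ψ S

namespace OscSystem

theorem composeCoeff_smooth {k : ℕ} {X : ℕ → ℝ → ℝ → ℝ} {prev : ℕ → AvgTerm} {T : ℝ}
    (hX : ∀ i, 1 ≤ i → i < k → Smooth2 (X i))
    (h : ∀ i, 1 ≤ i → i < k → (prev i).IsRegular T) : Smooth3 (composeCoeff k X prev) := by
  unfold composeCoeff
  have key : ContDiff ℝ ∞ (fun z : (ℝ × ℝ × ℝ) × ℝ => ∑ j ∈ Finset.Ico 1 k, z.2 ^ j *
      X j (z.1.1 + ∑ i ∈ Finset.Ico 1 k, z.2 ^ i * (prev i).u z.1.1 z.1.2.1 z.1.2.2)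
        (z.1.2.1 + ∑ i ∈ Finset.Ico 1 k, z.2 ^ i * (prev i).v z.1.1 z.1.2.1 z.1.2.2)) := by
    refine ContDiff.sum fun j hj => ?_
    have hj := Finset.mem_Ico.1 hj
    refine ContDiff.mul (by fun_prop) ((hX j hj.1 hj.2).comp ?_ ?_)
    · refine ContDiff.add (by fun_prop) (ContDiff.sum fun i hi => ?_)
      have hi := Finset.mem_Ico.1 hi
      exact ContDiff.mul (by fun_prop) ((h i hi.1 hi.2).u.comp (by fun_prop) (by fun_prop)
        (by fun_prop))
    · refine ContDiff.add (by fun_prop) (ContDiff.sum fun i hi => ?_)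
      have hi := Finset.mem_Ico.1 hi
      exact ContDiff.mul (by fun_prop) ((h i hi.1 hi.2).v.comp (by fun_prop) (by fun_prop)
        (by fun_prop))
  have h1 := ContDiff.iteratedDeriv_param (E := ℝ × ℝ × ℝ) (H := fun p e =>
    ∑ j ∈ Finset.Ico 1 k, e ^ j *
      X j (p.1 + ∑ i ∈ Finset.Ico 1 k, e ^ i * (prev i).u p.1 p.2.1 p.2.2)
        (p.2.1 + ∑ i ∈ Finset.Ico 1 k, e ^ i * (prev i).v p.1 p.2.1 p.2.2)) key k
  exact (h1.comp (by fun_prop : ContDiff ℝ ∞ fun p : ℝ × ℝ × ℝ => (p, (0 : ℝ)))).div_const _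

theorem composeCoeff_periodic {k : ℕ} {X : ℕ → ℝ → ℝ → ℝ} {prev : ℕ → AvgTerm} {T : ℝ}
    (h : ∀ i, 1 ≤ i → i < k → (prev i).IsRegular T) (R Ψ S : ℝ) :
    composeCoeff k X prev R Ψ (S + T) = composeCoeff k X prev R Ψ S := by
  unfold composeCoeff
  have h1 : ∀ e : ℝ, ∑ i ∈ Finset.Ico 1 k, e ^ i * (prev i).u R Ψ (S + T)
      = ∑ i ∈ Finset.Ico 1 k, e ^ i * (prev i).u R Ψ S := fun e =>
    Finset.sum_congr rfl fun i hi => by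
      rw [(h i (Finset.mem_Ico.1 hi).1 (Finset.mem_Ico.1 hi).2).u_periodic]
  have h2 : ∀ e : ℝ, ∑ i ∈ Finset.Ico 1 k, e ^ i * (prev i).v R Ψ (S + T)
      = ∑ i ∈ Finset.Ico 1 k, e ^ i * (prev i).v R Ψ S := fun e =>
    Finset.sum_congr rfl fun i hi => by
      rw [(h i (Finset.mem_Ico.1 hi).1 (Finset.mem_Ico.1 hi).2).v_periodic]
  simp only [h1, h2]

theorem transportCoeff_smooth {D : OscSystem} (hF : ∀ k, Smooth3 (D.Fcoef k))
    (hG : ∀ k, Smooth3 (D.Gcoef k)) {k : ℕ} {w : ℕ → ℝ → ℝ → ℝ → ℝ}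
    (hw : ∀ i, 1 ≤ i → i < k → Smooth3 (w i)) : Smooth3 (D.transportCoeff k w) := by
  unfold transportCoeff
  refine ContDiff.sum fun j hj => ?_
  have hj := Finset.mem_Ico.1 hj
  have hw' := hw (k - j) (by omega) (by omega)
  exact ((((hF j).mul hw'.deriv₁).add ((hG j).mul hw'.deriv₂)).add
    (contDiff_const.mul hw'.deriv₃)).add (contDiff_const.mul hw')

theorem transportCoeff_periodic {D : OscSystem} {T : ℝ}
    (hF : ∀ k R Ψ S, D.Fcoef k R Ψ (S + T) = D.Fcoef k R Ψ S)
    (hG : ∀ k R Ψ S, D.Gcoef k R Ψ (S + T) = D.Gcoef k R Ψ S) {k : ℕ}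
    {w : ℕ → ℝ → ℝ → ℝ → ℝ} (hw : ∀ i, 1 ≤ i → i < k → ∀ R Ψ S, w i R Ψ (S + T) = w i R Ψ S)
    (R Ψ S : ℝ) : D.transportCoeff k w R Ψ (S + T) = D.transportCoeff k w R Ψ S := by
  unfold transportCoeff
  refine Finset.sum_congr rfl fun j hj => ?_
  have hj := Finset.mem_Ico.1 hj
  have hw' := hw (k - j) (by omega) (by omega)
  have h3 : deriv (fun x => w (k - j) R Ψ x) (S + T) = deriv (fun x => w (k - j) R Ψ x) S := by
    rw [← deriv_comp_add_const]
    simp only [hw']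
  simp only [hF, hG, hw', h3]

theorem Valid.avgNext_isRegular {D : OscSystem} (hD : D.Valid) {k : ℕ} {prev : ℕ → AvgTerm}
    (h : ∀ i, 1 ≤ i → i < k → (prev i).IsRegular (2 * Real.pi * D.varkappa)) :
    (D.avgNext k prev).IsRegular (2 * Real.pi * D.varkappa) := by
  obtain ⟨b, F, G, w, hm⟩ := hD.exists_isSmoothModel
  have hX : Smooth3 (fun R Ψ S =>
      D.Fcoef k R Ψ S - (composeCoeff k (fun j => (prev j).Lam) prev R Ψ S
      - D.transportCoeff k (fun j => (prev j).u) R Ψ S)) :=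
    (hm.smooth_Fcoef k).sub ((composeCoeff_smooth (fun i h1 h2 => (h i h1 h2).Lam) h).sub
      (transportCoeff_smooth hm.smooth_Fcoef hm.smooth_Gcoef fun i h1 h2 => (h i h1 h2).u))
  have hY : Smooth3 (fun R Ψ S =>
      D.Gcoef k R Ψ S - (composeCoeff k (fun j => (prev j).Om) prev R Ψ S
      - D.transportCoeff k (fun j => (prev j).v) R Ψ S)) :=
    (hm.smooth_Gcoef k).sub ((composeCoeff_smooth (fun i h1 h2 => (h i h1 h2).Om) h).sub
      (transportCoeff_smooth hm.smooth_Fcoef hm.smooth_Gcoef fun i h1 h2 => (h i h1 h2).v))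
  refine ⟨D.mean_smooth hX, D.mean_smooth hY, ?_, ?_, ?_, ?_⟩
  · exact (D.zeroMeanPrimitive_smooth (D.sub_mean_smooth hX)).div_const _
  · exact (D.zeroMeanPrimitive_smooth (D.sub_mean_smooth hY)).div_const _
  · intro R Ψ S
    refine congrArg (· / D.s 0) (zeroMeanPrimitive_periodic hD
      (hX.continuous.comp (by fun_prop : Continuous fun S : ℝ => (R, Ψ, S))) ?_ S)
    intro S
    simp only [hm.periodic_Fcoef hD, composeCoeff_periodic h,
      transportCoeff_periodic (hm.periodic_Fcoef hD) (hm.periodic_Gcoef hD)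
        (w := fun j => (prev j).u) fun i h1 h2 => (h i h1 h2).u_periodic, Function.comp_def]
  · intro R Ψ S
    refine congrArg (· / D.s 0) (zeroMeanPrimitive_periodic hD
      (hY.continuous.comp (by fun_prop : Continuous fun S : ℝ => (R, Ψ, S))) ?_ S)
    intro S
    simp only [hm.periodic_Gcoef hD, composeCoeff_periodic h,
      transportCoeff_periodic (hm.periodic_Fcoef hD) (hm.periodic_Gcoef hD)
        (w := fun j => (prev j).v) fun i h1 h2 => (h i h1 h2).v_periodic, Function.comp_def]

theorem Valid.avgTerm_isRegular {D : OscSystem} (hD : D.Valid) (k : ℕ) :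
    (D.avgTerm k).IsRegular (2 * Real.pi * D.varkappa) := by
  induction k using Nat.strong_induction_on with
  | _ k ih =>
    rw [avgTerm_eq]
    exact hD.avgNext_isRegular fun i _ hi => ih i hi

theorem Valid.smooth_Lam {D : OscSystem} (hD : D.Valid) (k : ℕ) : Smooth2 (D.Lam k) :=
  (hD.avgTerm_isRegular k).Lam

theorem Valid.smooth_Om {D : OscSystem} (hD : D.Valid) (k : ℕ) : Smooth2 (D.Om k) :=
  (hD.avgTerm_isRegular k).Om

theorem s_zero_mul_deriv {D : OscSystem} (h0 : D.s 0 ≠ 0) {X : ℝ → ℝ → ℝ → ℝ} (hX : Smooth3 X)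
    (c R Ψ S : ℝ) :
    D.s 0 * deriv (fun x => D.zeroMeanPrimitive (fun S => c - X R Ψ S) x / D.s 0) S
      = c - X R Ψ S := by
  have hc : Continuous fun S => c - X R Ψ S :=
    continuous_const.sub (hX.continuous.comp (by fun_prop : Continuous fun S : ℝ => (R, Ψ, S)))
  rw [((D.hasDerivAt_zeroMeanPrimitive hc S).div_const (D.s 0)).deriv]
  field_simp

/-- The homological equation for `u_k`. -/
theorem Valid.deriv_u {D : OscSystem} (hD : D.Valid) (k : ℕ) (R Ψ S : ℝ) :
    D.s 0 * deriv (fun x => (D.avgTerm k).u R Ψ x) S + D.Fcoef k R Ψ S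
      + D.transportCoeff k (fun j => (D.avgTerm j).u) R Ψ S
    = D.Lam k R Ψ + composeCoeff k D.Lam D.avgTerm R Ψ S := by
  obtain ⟨b, F, G, w, hm⟩ := hD.exists_isSmoothModel
  have h := fun i (_ : 1 ≤ i) (_ : i < k) => hD.avgTerm_isRegular i
  have hX : Smooth3 (fun R Ψ S =>
      D.Fcoef k R Ψ S - (composeCoeff k D.Lam D.avgTerm R Ψ S
      - D.transportCoeff k (fun j => (D.avgTerm j).u) R Ψ S)) :=
    (hm.smooth_Fcoef k).sub ((composeCoeff_smooth (fun i h1 h2 => (h i h1 h2).Lam) h).sub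
      (transportCoeff_smooth hm.smooth_Fcoef hm.smooth_Gcoef fun i h1 h2 => (h i h1 h2).u))
  have h1 := s_zero_mul_deriv hD.s_zero_pos.ne' hX (D.Lam k R Ψ) R Ψ S
  beta_reduce at h1
  have h2 : (fun x => (D.avgTerm k).u R Ψ x) = fun x => D.zeroMeanPrimitive (fun S =>
      D.Lam k R Ψ - (D.Fcoef k R Ψ S - (composeCoeff k D.Lam D.avgTerm R Ψ S
      - D.transportCoeff k (fun j => (D.avgTerm j).u) R Ψ S))) x / D.s 0 := by
    rw [Lam, avgTerm_eq]; rfl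
  rw [h2, h1]
  ring

/-- The homological equation for `v_k`. -/
theorem Valid.deriv_v {D : OscSystem} (hD : D.Valid) (k : ℕ) (R Ψ S : ℝ) :
    D.s 0 * deriv (fun x => (D.avgTerm k).v R Ψ x) S + D.Gcoef k R Ψ S
      + D.transportCoeff k (fun j => (D.avgTerm j).v) R Ψ S
    = D.Om k R Ψ + composeCoeff k D.Om D.avgTerm R Ψ S := by
  obtain ⟨b, F, G, w, hm⟩ := hD.exists_isSmoothModel
  have h := fun i (_ : 1 ≤ i) (_ : i < k) => hD.avgTerm_isRegular i
  have hX : Smooth3 (fun R Ψ S =>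
      D.Gcoef k R Ψ S - (composeCoeff k D.Om D.avgTerm R Ψ S
      - D.transportCoeff k (fun j => (D.avgTerm j).v) R Ψ S)) :=
    (hm.smooth_Gcoef k).sub ((composeCoeff_smooth (fun i h1 h2 => (h i h1 h2).Om) h).sub
      (transportCoeff_smooth hm.smooth_Fcoef hm.smooth_Gcoef fun i h1 h2 => (h i h1 h2).v))
  have h1 := s_zero_mul_deriv hD.s_zero_pos.ne' hX (D.Om k R Ψ) R Ψ S
  beta_reduce at h1
  have h2 : (fun x => (D.avgTerm k).v R Ψ x) = fun x => D.zeroMeanPrimitive (fun S =>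
      D.Om k R Ψ - (D.Gcoef k R Ψ S - (composeCoeff k D.Om D.avgTerm R Ψ S
      - D.transportCoeff k (fun j => (D.avgTerm j).v) R Ψ S))) x / D.s 0 := by
    rw [Om, avgTerm_eq]; rfl
  rw [h2, h1]
  ring

/-- At order one there are no earlier terms, `phaseCoeff 1 = 0` by parity and no `g_j` contributes,
so `G_1` is already free of `S`. -/
theorem Valid.Om_one {D : OscSystem} (hD : D.Valid) (R Ψ : ℝ) : D.Om 1 R Ψ = D.eta * R := by
  have hG : ∀ S, D.Gcoef 1 R Ψ S = D.eta * R := fun S => by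
    have h0 : ((Finset.range (1 + 2) ×ˢ Finset.range (1 + 2)).filter
        (fun p : ℕ × ℕ => 1 ≤ p.2 ∧ p.1 + 2 * p.2 = 1)) = ∅ := by decide
    rw [Gcoef, h0]
    simp [phaseCoeff, eta, iteratedDeriv_one]
  have h1 : D.Om 1 R Ψ = D.mean fun S => D.Gcoef 1 R Ψ S - (composeCoeff 1 D.Om D.avgTerm R Ψ S
      - D.transportCoeff 1 (fun j => (D.avgTerm j).v) R Ψ S) := by
    rw [Om, avgTerm_eq]; rfl
  rw [h1]
  have h2 : ∀ S, composeCoeff 1 D.Om D.avgTerm R Ψ S = 0 := fun S => by simp [composeCoeff]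
  have h3 : ∀ S, D.transportCoeff 1 (fun j => (D.avgTerm j).v) R Ψ S = 0 := fun S => by
    simp [transportCoeff]
  simp only [h2, h3, hG, mean]
  have h4 := hD.period_pos
  rw [intervalIntegral.integral_const]
  simp only [smul_eq_mul, sub_zero]
  rw [← mul_assoc, one_div, inv_mul_cancel₀ h4.ne', one_mul]

end OscSystem

/-! ### The truncated change of variables -/

/-- Reindexes the coefficient sums of `Fcoef` and `Gcoef` by the order `j` of the perturbation
alone, so that they match the termwise expansion of `slowF` and `slowG`. -/
theorem sum_pairs_eq {M : Type*} [AddCommMonoid M] (T : ℕ → ℕ → M) {K B m : ℕ} (hB : K < B)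
    (hm : K < 2 * m) :
    ∑ p ∈ (Finset.range B ×ˢ Finset.range B).filter (fun p => 1 ≤ p.2 ∧ p.1 + 2 * p.2 = K),
      T p.1 p.2 = ∑ j ∈ Finset.Ico 1 m, if 2 * j ≤ K then T (K - 2 * j) j else 0 := by
  rw [← Finset.sum_filter]
  refine Finset.sum_bij' (fun p _ => p.2) (fun j _ => (K - 2 * j, j)) ?_ ?_ ?_ ?_ ?_
  · intro p hp
    simp only [Finset.mem_filter, Finset.mem_product, Finset.mem_range, Finset.mem_Ico] at hp ⊢
    omega
  · intro j hj
    simp only [Finset.mem_filter, Finset.mem_product, Finset.mem_range, Finset.mem_Ico] at hj ⊢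
    omega
  · intro p hp
    simp only [Finset.mem_filter, Finset.mem_product, Finset.mem_range] at hp
    ext <;> simp; omega
  · intro j _; rfl
  · intro p hp
    simp only [Finset.mem_filter, Finset.mem_product, Finset.mem_range] at hp
    rw [show K - 2 * p.2 = p.1 by omega]

/-- A Cauchy product in which the contribution of the top coefficient `c k` is split off: in the
averaging recursion this is the only place where the unknown of order `k` enters. -/
theorem taylorCoeff_mul_sum {A : ℝ → ℝ} (hA : ContDiff ℝ ∞ A) (c : ℕ → ℝ) {k N : ℕ} (hk : k ≤ N) :
    taylorCoeff k (fun e => A e * ∑ i ∈ Finset.Icc 1 N, e ^ i * c i)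
      = (if k = 0 then 0 else A 0 * c k) + ∑ j ∈ Finset.Ico 1 k, taylorCoeff j A * c (k - j) := by
  have h1 : (fun e => A e * ∑ i ∈ Finset.Icc 1 N, e ^ i * c i)
      = fun e => ∑ i ∈ Finset.Icc 1 N, e ^ i * (c i * A e) := by
    funext e
    rw [Finset.mul_sum]
    exact Finset.sum_congr rfl fun i _ => by ring
  rw [h1, taylorCoeff_sum fun i _ => by fun_prop]
  have h2 : ∀ i ∈ Finset.Icc 1 N, taylorCoeff k (fun e => e ^ i * (c i * A e))
      = if i ≤ k then c i * taylorCoeff (k - i) A else 0 := fun i _ => by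
    rw [taylorCoeff_pow_mul (by fun_prop), taylorCoeff_const_mul]
  rw [Finset.sum_congr rfl h2, ← Finset.sum_filter]
  have h3 : (Finset.Icc 1 N).filter (fun i => i ≤ k) = Finset.Icc 1 k := by
    ext i; simp only [Finset.mem_filter, Finset.mem_Icc]; omega
  rw [h3]
  rcases Nat.eq_zero_or_pos k with rfl | hk0
  · simp
  rw [if_neg hk0.ne', ← Finset.Ico_insert_right hk0, Finset.sum_insert (by simp),
    Nat.sub_self, taylorCoeff_zero, mul_comm]
  congr 1
  refine Finset.sum_nbij' (fun i => k - i) (fun i => k - i) ?_ ?_ ?_ ?_ ?_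
  · intro i hi; simp only [Finset.mem_Ico] at hi ⊢; omega
  · intro i hi; simp only [Finset.mem_Ico] at hi ⊢; omega
  · intro i hi; simp only [Finset.mem_Ico] at hi; omega
  · intro i hi; simp only [Finset.mem_Ico] at hi; omega
  · intro i hi
    simp only [Finset.mem_Ico] at hi
    rw [show k - (k - i) = i by omega, mul_comm]

/-- The partial sum `∑_{i=1}^N e^i w_i(R, Ψ, S)`. -/
def seriesSum (N : ℕ) (w : ℕ → ℝ → ℝ → ℝ → ℝ) (p : ℝ × ℝ × ℝ) (e : ℝ) : ℝ :=
  ∑ i ∈ Finset.Icc 1 N, e ^ i * w i p.1 p.2.1 p.2.2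

theorem seriesSum_smooth {N : ℕ} {w : ℕ → ℝ → ℝ → ℝ → ℝ} (hw : ∀ i, Smooth3 (w i)) :
    ContDiff ℝ ∞ (fun z : (ℝ × ℝ × ℝ) × ℝ => seriesSum N w z.1 z.2) := by
  unfold seriesSum
  refine ContDiff.sum fun i _ => ContDiff.mul (by fun_prop) ((hw i).comp ?_ ?_ ?_) <;> fun_prop

theorem seriesSum_isBigO {N k : ℕ} (hk : k ≤ N) (w : ℕ → ℝ → ℝ → ℝ → ℝ) (p : ℝ × ℝ × ℝ) :
    (fun e => seriesSum N w p e - ∑ i ∈ Finset.Ico 1 k, e ^ i * w i p.1 p.2.1 p.2.2)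
      =O[𝓝 0] fun e : ℝ => e ^ k := by
  have h : (fun e => seriesSum N w p e - ∑ i ∈ Finset.Ico 1 k, e ^ i * w i p.1 p.2.1 p.2.2)
      = fun e => ∑ i ∈ (Finset.Icc 1 N).filter (fun i => k ≤ i), w i p.1 p.2.1 p.2.2 * e ^ i := by
    funext e
    have : (Finset.Icc 1 N).filter (fun i => ¬ k ≤ i) = Finset.Ico 1 k := by
      ext i; simp only [Finset.mem_filter, Finset.mem_Icc, Finset.mem_Ico]; omega
    rw [seriesSum, ← Finset.sum_filter_add_sum_filter_not (Finset.Icc 1 N) (fun i => k ≤ i), this,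
      add_sub_cancel_right]
    exact Finset.sum_congr rfl fun i _ => mul_comm _ _
  rw [h]
  refine IsBigO.fun_sum fun i hi => ?_
  exact (isBigO_pow_of_le (Finset.mem_filter.1 hi).2).const_mul_left _

/-- Strict differentiability at the common base point gives a local Lipschitz bound, which transfers
the order of the difference of the arguments to the values. -/
theorem isBigO_comp_sub {X : ℝ → ℝ → ℝ} (hX : Smooth2 X) {x x' y y' : ℝ → ℝ}
    (hx : Continuous x) (hx' : Continuous x') (hy : Continuous y) (hy' : Continuous y')
    (h0 : x 0 = x' 0) (h0' : y 0 = y' 0) {k : ℕ}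
    (h : (fun e => x e - x' e) =O[𝓝 0] fun e : ℝ => e ^ k)
    (h' : (fun e => y e - y' e) =O[𝓝 0] fun e : ℝ => e ^ k) :
    (fun e => X (x e) (y e) - X (x' e) (y' e)) =O[𝓝 0] fun e : ℝ => e ^ k := by
  have hX' : ContDiff ℝ ∞ (fun p : ℝ × ℝ => X p.1 p.2) := hX
  have hs := (hX'.contDiffAt (x := (x 0, y 0))).hasStrictFDerivAt (by simp)
  have ht : Tendsto (fun e => ((x e, y e), (x' e, y' e))) (𝓝 0) (𝓝 ((x 0, y 0), (x 0, y 0))) := by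
    have : Continuous fun e => ((x e, y e), (x' e, y' e)) := by fun_prop
    have h2 := this.tendsto 0
    rwa [← h0, ← h0'] at h2
  have h1 := hs.isBigO_sub.comp_tendsto ht
  refine h1.trans ?_
  exact h.prod_left h'

namespace OscSystem

/-- The polynomial in `e = t^(-1/(2q))` that gives `S'(t)`. -/
def phaseRate (D : OscSystem) (e : ℝ) : ℝ :=
  ∑ j ∈ Finset.range (D.q + 1), e ^ (2 * j) * D.phaseCoeff (2 * j)

theorem phaseRate_smooth (D : OscSystem) : ContDiff ℝ ∞ D.phaseRate := by
  unfold phaseRate; fun_prop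

theorem taylorCoeff_phaseRate (D : OscSystem) (k : ℕ) :
    taylorCoeff k D.phaseRate = D.phaseCoeff k := by
  unfold phaseRate
  rw [taylorCoeff_sum fun i _ => by fun_prop]
  simp only [taylorCoeff_pow_mul_const]
  by_cases hk : Even k ∧ k ≤ 2 * D.q
  · obtain ⟨⟨i, hi⟩, hk2⟩ := hk
    rw [Finset.sum_eq_single i]
    · rw [if_pos (by omega), show 2 * i = k by omega]
    · intro j _ hj
      rw [if_neg (by omega)]
    · intro h
      simp only [Finset.mem_range] at h
      omega
  · rw [Finset.sum_eq_zero, phaseCoeff, if_neg hk]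
    intro j hj
    rw [if_neg]
    intro h
    refine hk ⟨⟨j, by omega⟩, ?_⟩
    simp only [Finset.mem_range] at hj
    omega

theorem phaseRate_zero {D : OscSystem} (hD : D.Valid) : D.phaseRate 0 = D.s 0 := by
  have := D.taylorCoeff_phaseRate 0
  rw [taylorCoeff_zero] at this
  rw [this, phaseCoeff, if_pos (by simp)]
  have := hD.q_pos
  rw [if_neg (by omega)]
  simp

/-- The right-hand side for `R`, up to high order in `e`. -/
def slowF (D : OscSystem) (F : ℕ → ℝ → ℝ → ℝ → ℝ) (N : ℕ) (p : ℝ × ℝ × ℝ) (e : ℝ) : ℝ :=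
  ∑ j ∈ Finset.Ico 1 (N + 2), e ^ (2 * j - 1) *
      F j (D.a + e * p.1) ((D.kappa : ℝ) / D.varkappa * p.2.2 + p.2.1) p.2.2
    + e ^ (2 * D.q) * (p.1 / (2 * D.q))

/-- The right-hand side for `Ψ`, up to high order in `e`. -/
def slowG (D : OscSystem) (G : ℕ → ℝ → ℝ → ℝ → ℝ) (w : ℝ → ℝ) (N : ℕ) (p : ℝ × ℝ × ℝ) (e : ℝ) :
    ℝ :=
  (w (D.a + e * p.1) - (D.kappa : ℝ) / D.varkappa * D.phaseRate e)
    + ∑ j ∈ Finset.Ico 1 (N + 2), e ^ (2 * j) *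
      G j (D.a + e * p.1) ((D.kappa : ℝ) / D.varkappa * p.2.2 + p.2.1) p.2.2

section model

variable {D : OscSystem} {b : ℝ} {F G : ℕ → ℝ → ℝ → ℝ → ℝ} {w : ℝ → ℝ}

theorem IsSmoothModel.smooth_slowF (h : D.IsSmoothModel b F G w) (N : ℕ) :
    ContDiff ℝ ∞ (fun z : (ℝ × ℝ × ℝ) × ℝ => D.slowF F N z.1 z.2) := by
  unfold slowF
  refine ContDiff.add (ContDiff.sum fun j hj => ?_) (by fun_prop)
  refine ContDiff.mul (by fun_prop) ((h.F_smooth j (Finset.mem_Ico.1 hj).1).comp ?_ ?_ ?_) <;>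
    fun_prop

theorem IsSmoothModel.smooth_slowG (h : D.IsSmoothModel b F G w) (N : ℕ) :
    ContDiff ℝ ∞ (fun z : (ℝ × ℝ × ℝ) × ℝ => D.slowG G w N z.1 z.2) := by
  unfold slowG
  have h1 := h.w_smooth
  have h2 := D.phaseRate_smooth
  refine ContDiff.add (by fun_prop) (ContDiff.sum fun j hj => ?_)
  refine ContDiff.mul (by fun_prop) ((h.G_smooth j (Finset.mem_Ico.1 hj).1).comp ?_ ?_ ?_) <;>
    fun_prop

/-- The weight `e^(2j)` of the `j`-th coefficient becomes `e^(2j-1)` because `R = (r - a)/e`.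
Expanding at `a` in powers of `e R` then produces the exponent `i + 2j - 1 = k`. The range `j < N +
2` contains every pair needed for `k ≤ N`. -/
theorem IsSmoothModel.taylorCoeff_slowF (h : D.IsSmoothModel b F G w) {k N : ℕ} (hk : k ≤ N)
    (p : ℝ × ℝ × ℝ) : taylorCoeff k (D.slowF F N p) = D.Fcoef k p.1 p.2.1 p.2.2 := by
  have hs : ∀ j ∈ Finset.Ico 1 (N + 2), ContDiff ℝ ∞ (fun r =>
      F j r ((D.kappa : ℝ) / D.varkappa * p.2.2 + p.2.1) p.2.2) := fun j hj =>
    (h.F_smooth j (Finset.mem_Ico.1 hj).1).comp contDiff_id contDiff_const contDiff_const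
  have hs' : ∀ j ∈ Finset.Ico 1 (N + 2), ContDiff ℝ ∞ (fun e =>
      F j (D.a + e * p.1) ((D.kappa : ℝ) / D.varkappa * p.2.2 + p.2.1) p.2.2) := fun j hj =>
    (hs j hj).comp (by fun_prop)
  have hs'' : ∀ j ∈ Finset.Ico 1 (N + 2), ContDiff ℝ ∞ (fun e => e ^ (2 * j - 1) *
      F j (D.a + e * p.1) ((D.kappa : ℝ) / D.varkappa * p.2.2 + p.2.1) p.2.2) := fun j hj =>
    ContDiff.mul (by fun_prop) (hs' j hj)
  unfold slowF
  rw [taylorCoeff_add (ContDiff.sum hs'') (by fun_prop), taylorCoeff_sum hs'',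
    taylorCoeff_pow_mul_const, h.Fcoef_eq]
  congr 1
  rw [sum_pairs_eq (fun i j => iteratedDeriv i (fun r =>
    F j r ((D.kappa : ℝ) / D.varkappa * p.2.2 + p.2.1) p.2.2) D.a * p.1 ^ i / (i.factorial : ℝ))
    (K := k + 1) (m := N + 2) (by omega) (by omega)]
  refine Finset.sum_congr rfl fun j hj => ?_
  rw [taylorCoeff_pow_mul (hs' j hj), taylorCoeff_comp_affine (hs j hj)]
  have hj := Finset.mem_Ico.1 hj
  rw [show k - (2 * j - 1) = k + 1 - 2 * j by omega]
  by_cases h1 : 2 * j - 1 ≤ k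
  · rw [if_pos h1, if_pos (by omega)]
  · rw [if_neg h1, if_neg (by omega)]

theorem IsSmoothModel.taylorCoeff_slowG (h : D.IsSmoothModel b F G w) {k N : ℕ} (hk : k ≤ N)
    (p : ℝ × ℝ × ℝ) : taylorCoeff k (D.slowG G w N p) = D.Gcoef k p.1 p.2.1 p.2.2 := by
  have hs : ∀ j ∈ Finset.Ico 1 (N + 2), ContDiff ℝ ∞ (fun r =>
      G j r ((D.kappa : ℝ) / D.varkappa * p.2.2 + p.2.1) p.2.2) := fun j hj =>
    (h.G_smooth j (Finset.mem_Ico.1 hj).1).comp contDiff_id contDiff_const contDiff_const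
  have hs' : ∀ j ∈ Finset.Ico 1 (N + 2), ContDiff ℝ ∞ (fun e =>
      G j (D.a + e * p.1) ((D.kappa : ℝ) / D.varkappa * p.2.2 + p.2.1) p.2.2) := fun j hj =>
    (hs j hj).comp (by fun_prop)
  have hs'' : ∀ j ∈ Finset.Ico 1 (N + 2), ContDiff ℝ ∞ (fun e => e ^ (2 * j) *
      G j (D.a + e * p.1) ((D.kappa : ℝ) / D.varkappa * p.2.2 + p.2.1) p.2.2) := fun j hj =>
    ContDiff.mul (by fun_prop) (hs' j hj)
  have h1 := h.w_smooth
  have h2 := D.phaseRate_smooth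
  unfold slowG
  rw [taylorCoeff_add (by fun_prop) (ContDiff.sum hs''), taylorCoeff_sum hs'',
    taylorCoeff_sub (by fun_prop) (by fun_prop), taylorCoeff_comp_affine h1,
    taylorCoeff_const_mul, taylorCoeff_phaseRate, h.Gcoef_eq]
  congr 1
  rw [sum_pairs_eq (fun i j => iteratedDeriv i (fun r =>
    G j r ((D.kappa : ℝ) / D.varkappa * p.2.2 + p.2.1) p.2.2) D.a * p.1 ^ i / (i.factorial : ℝ))
    (K := k) (m := N + 2) (by omega) (by omega)]
  refine Finset.sum_congr rfl fun j hj => ?_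
  rw [taylorCoeff_pow_mul (hs' j hj), taylorCoeff_comp_affine (hs j hj)]

theorem IsSmoothModel.slowF_periodic (h : D.IsSmoothModel b F G w) (hD : D.Valid) (N : ℕ)
    (R Ψ S e : ℝ) : D.slowF F N (R, Ψ, S + 2 * Real.pi * D.varkappa) e
      = D.slowF F N (R, Ψ, S) e := by
  unfold slowF
  congr 1
  refine Finset.sum_congr rfl fun j hj => ?_
  have hj := (Finset.mem_Ico.1 hj).1
  simp only [periodic_resonant hD (h.F_phi j hj) (h.F_S j hj)]

theorem IsSmoothModel.slowG_periodic (h : D.IsSmoothModel b F G w) (hD : D.Valid) (N : ℕ)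
    (R Ψ S e : ℝ) : D.slowG G w N (R, Ψ, S + 2 * Real.pi * D.varkappa) e
      = D.slowG G w N (R, Ψ, S) e := by
  unfold slowG
  congr 1
  refine Finset.sum_congr rfl fun j hj => ?_
  have hj := (Finset.mem_Ico.1 hj).1
  simp only [periodic_resonant hD (h.G_phi j hj) (h.G_S j hj)]

end model

theorem Fcoef_zero {D : OscSystem} (hD : D.Valid) (R Ψ S : ℝ) : D.Fcoef 0 R Ψ S = 0 := by
  have h0 : ((Finset.range (0 + 2) ×ˢ Finset.range (0 + 2)).filter
      (fun p : ℕ × ℕ => 1 ≤ p.2 ∧ p.1 + 2 * p.2 = 0 + 1)) = ∅ := by decide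
  have := hD.q_pos
  rw [Fcoef, h0, if_neg (by omega)]
  simp

/-- This is the resonance condition `κ s₀ = ϰ ω(a)`: at leading order `Ψ` does not rotate. -/
theorem Gcoef_zero {D : OscSystem} (hD : D.Valid) (R Ψ S : ℝ) : D.Gcoef 0 R Ψ S = 0 := by
  have h0 : ((Finset.range (0 + 2) ×ˢ Finset.range (0 + 2)).filter
      (fun p : ℕ × ℕ => 1 ≤ p.2 ∧ p.1 + 2 * p.2 = 0)) = ∅ := by decide
  have h1 : D.phaseCoeff 0 = D.s 0 := by
    rw [← taylorCoeff_phaseRate, taylorCoeff_zero, phaseRate_zero hD]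
  have hv : (D.varkappa : ℝ) ≠ 0 := by
    have := hD.varkappa_pos
    positivity
  rw [Gcoef, h0, h1]
  have := hD.resonance
  simp only [iteratedDeriv_zero, pow_zero, Nat.factorial_zero, Nat.cast_one, Finset.sum_empty]
  field_simp
  linarith

/-- The derivative of `∑ e^i w_i(R, Ψ, S)` along `R' = A`, `Ψ' = B`, `S' = phaseRate e`,
`e' = -e^(2q+1)/(2q)`. -/
def transportSum (D : OscSystem) (N : ℕ) (A B : ℝ × ℝ × ℝ → ℝ → ℝ) (w : ℕ → ℝ → ℝ → ℝ → ℝ)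
    (p : ℝ × ℝ × ℝ) (e : ℝ) : ℝ :=
  A p e * seriesSum N (fun i x y z => deriv (fun x => w i x y z) x) p e
    + B p e * seriesSum N (fun i x y z => deriv (fun y => w i x y z) y) p e
    + D.phaseRate e * seriesSum N (fun i x y z => deriv (fun z => w i x y z) z) p e
    + e ^ (2 * D.q) * seriesSum N (fun i x y z => -((i : ℝ) / (2 * D.q)) * w i x y z) p e

section transport

variable {D : OscSystem} {N : ℕ} {A B : ℝ × ℝ × ℝ → ℝ → ℝ} {w : ℕ → ℝ → ℝ → ℝ → ℝ}

theorem transportSum_smooth (hA : ContDiff ℝ ∞ (fun z : (ℝ × ℝ × ℝ) × ℝ => A z.1 z.2))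
    (hB : ContDiff ℝ ∞ (fun z : (ℝ × ℝ × ℝ) × ℝ => B z.1 z.2)) (hw : ∀ i, Smooth3 (w i)) :
    ContDiff ℝ ∞ (fun z : (ℝ × ℝ × ℝ) × ℝ => D.transportSum N A B w z.1 z.2) := by
  unfold transportSum
  have h0 := D.phaseRate_smooth
  refine (((hA.mul (seriesSum_smooth fun i => (hw i).deriv₁)).add
    (hB.mul (seriesSum_smooth fun i => (hw i).deriv₂))).add
    (ContDiff.mul (by fun_prop) (seriesSum_smooth fun i => (hw i).deriv₃))).add
    (ContDiff.mul (by fun_prop) (seriesSum_smooth fun i => contDiff_const.mul (hw i)))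

/-- Since `A` and `B` vanish at `e = 0`, the order-`k` term `w k` enters only through `∂_S`, with
factor `phaseRate 0 = s₀`. The powers `e^i` are differentiated in time through `e' =
-e^(2q+1)/(2q)`, which gives the factor `-(k-j)/(2q)` at `j = 2q`, that is, `(2q-k)/(2q)`. -/
theorem taylorCoeff_transportSum (hD : D.Valid)
    (hA : ContDiff ℝ ∞ (fun z : (ℝ × ℝ × ℝ) × ℝ => A z.1 z.2))
    (hB : ContDiff ℝ ∞ (fun z : (ℝ × ℝ × ℝ) × ℝ => B z.1 z.2))
    (hA' : ∀ p, ∀ k ≤ N, taylorCoeff k (A p) = D.Fcoef k p.1 p.2.1 p.2.2)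
    (hB' : ∀ p, ∀ k ≤ N, taylorCoeff k (B p) = D.Gcoef k p.1 p.2.1 p.2.2)
    {k : ℕ} (hk : k ≤ N) (p : ℝ × ℝ × ℝ) :
    taylorCoeff k (D.transportSum N A B w p) = (if k = 0 then 0 else
      D.s 0 * deriv (fun x => w k p.1 p.2.1 x) p.2.2)
      + D.transportCoeff k w p.1 p.2.1 p.2.2 := by
  have hAp : ContDiff ℝ ∞ (A p) := hA.comp (by fun_prop : ContDiff ℝ ∞ fun e : ℝ => (p, e))
  have hBp : ContDiff ℝ ∞ (B p) := hB.comp (by fun_prop : ContDiff ℝ ∞ fun e : ℝ => (p, e))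
  have h0 := D.phaseRate_smooth
  have hq := hD.q_pos
  have hA0 : A p 0 = 0 := by
    rw [← taylorCoeff_zero (A p), hA' p 0 (Nat.zero_le _), Fcoef_zero hD]
  have hB0 : B p 0 = 0 := by
    rw [← taylorCoeff_zero (B p), hB' p 0 (Nat.zero_le _), Gcoef_zero hD]
  have h4 : taylorCoeff k (fun e : ℝ => e ^ (2 * D.q) * ∑ i ∈ Finset.Icc 1 N, e ^ i *
      (-((i : ℝ) / (2 * D.q)) * w i p.1 p.2.1 p.2.2)) = _ :=
    taylorCoeff_mul_sum (by fun_prop) _ hk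
  have h5 : ∀ j, taylorCoeff j (fun e : ℝ => e ^ (2 * D.q)) = if j = 2 * D.q then 1 else 0 :=
    fun j => by simpa using taylorCoeff_pow_mul_const 1 (2 * D.q) j
  unfold transportSum seriesSum
  rw [taylorCoeff_add (by fun_prop) (by fun_prop), taylorCoeff_add (by fun_prop) (by fun_prop),
    taylorCoeff_add (by fun_prop) (by fun_prop), h4,
    taylorCoeff_mul_sum hAp (fun i => deriv (fun x => w i x p.2.1 p.2.2) p.1) hk,
    taylorCoeff_mul_sum hBp (fun i => deriv (fun y => w i p.1 y p.2.2) p.2.1) hk,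
    taylorCoeff_mul_sum h0 (fun i => deriv (fun z => w i p.1 p.2.1 z) p.2.2) hk, hA0, hB0,
    phaseRate_zero hD, zero_pow (by omega)]
  simp only [zero_mul, ite_self, zero_add]
  have key : ∀ a b c d x y : ℝ, a + b + c + d = y → a + b + (x + c) + d = x + y := by
    intro a b c d x y h; rw [← h]; ring
  apply key
  rw [transportCoeff, ← Finset.sum_add_distrib, ← Finset.sum_add_distrib,
    ← Finset.sum_add_distrib]
  refine Finset.sum_congr rfl fun j hj => ?_
  have hj := Finset.mem_Ico.1 hj
  rw [hA' p j (by omega), hB' p j (by omega), taylorCoeff_phaseRate, h5]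
  congr 1
  by_cases hjq : j = 2 * D.q
  · rw [if_pos hjq, if_pos hjq, Nat.cast_sub hj.2.le, hjq]
    push_cast
    ring
  · rw [if_neg hjq, if_neg hjq]; ring

end transport

/-- The new amplitude `R + ∑_{i=1}^N e^i u_i`. -/
def avgR (D : OscSystem) (N : ℕ) (p : ℝ × ℝ × ℝ) (e : ℝ) : ℝ :=
  p.1 + seriesSum N (fun i => (D.avgTerm i).u) p e

/-- The new phase `Ψ + ∑_{i=1}^N e^i v_i`. -/
def avgP (D : OscSystem) (N : ℕ) (p : ℝ × ℝ × ℝ) (e : ℝ) : ℝ :=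
  p.2.1 + seriesSum N (fun i => (D.avgTerm i).v) p e

theorem Valid.avgR_smooth {D : OscSystem} (hD : D.Valid) (N : ℕ) :
    ContDiff ℝ ∞ (fun z : (ℝ × ℝ × ℝ) × ℝ => D.avgR N z.1 z.2) :=
  ContDiff.add (by fun_prop) (seriesSum_smooth fun i => (hD.avgTerm_isRegular i).u)

theorem Valid.avgP_smooth {D : OscSystem} (hD : D.Valid) (N : ℕ) :
    ContDiff ℝ ∞ (fun z : (ℝ × ℝ × ℝ) × ℝ => D.avgP N z.1 z.2) :=
  ContDiff.add (by fun_prop) (seriesSum_smooth fun i => (hD.avgTerm_isRegular i).v)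

/-- `composeCoeff` truncates the change of variables below order `k`, whereas `avgR` and `avgP` go
up to `N`. The difference is `O(e^k)`, which the factor `e^j` with `j ≥ 1` pushes beyond order `k`;
the summand `j = k` contributes `X k` at the base point. -/
theorem Valid.taylorCoeff_compose {D : OscSystem} (hD : D.Valid) {X : ℕ → ℝ → ℝ → ℝ}
    (hX : ∀ j, Smooth2 (X j)) {k N : ℕ} (hk : k ≤ N) (hk0 : 1 ≤ k) (p : ℝ × ℝ × ℝ) :
    taylorCoeff k (fun e => ∑ j ∈ Finset.Icc 1 N, e ^ j * X j (D.avgR N p e) (D.avgP N p e))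
      = X k p.1 p.2.1 + composeCoeff k X D.avgTerm p.1 p.2.1 p.2.2 := by
  have hR : ContDiff ℝ ∞ (D.avgR N p) :=
    (hD.avgR_smooth N).comp (by fun_prop : ContDiff ℝ ∞ fun e : ℝ => (p, e))
  have hP : ContDiff ℝ ∞ (D.avgP N p) :=
    (hD.avgP_smooth N).comp (by fun_prop : ContDiff ℝ ∞ fun e : ℝ => (p, e))
  set R' : ℝ → ℝ := fun e => p.1 + ∑ i ∈ Finset.Ico 1 k, e ^ i * (D.avgTerm i).u p.1 p.2.1 p.2.2
    with hR'
  set P' : ℝ → ℝ := fun e =>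
    p.2.1 + ∑ i ∈ Finset.Ico 1 k, e ^ i * (D.avgTerm i).v p.1 p.2.1 p.2.2 with hP'
  have hR's : ContDiff ℝ ∞ R' := by fun_prop
  have hP's : ContDiff ℝ ∞ P' := by fun_prop
  have zero_sum : ∀ (s : Finset ℕ) (c : ℕ → ℝ), (∀ i ∈ s, 1 ≤ i) →
      ∑ i ∈ s, (0 : ℝ) ^ i * c i = 0 := fun s c hs => Finset.sum_eq_zero fun i hi => by
    rw [zero_pow (by have := hs i hi; omega), zero_mul]
  have hR0 : D.avgR N p 0 = p.1 := by
    rw [avgR, seriesSum, zero_sum _ _ fun i hi => (Finset.mem_Icc.1 hi).1, add_zero]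
  have hP0 : D.avgP N p 0 = p.2.1 := by
    rw [avgP, seriesSum, zero_sum _ _ fun i hi => (Finset.mem_Icc.1 hi).1, add_zero]
  have hR'0 : R' 0 = p.1 := by
    simp only [hR']
    rw [zero_sum _ _ fun i hi => (Finset.mem_Ico.1 hi).1, add_zero]
  have hP'0 : P' 0 = p.2.1 := by
    simp only [hP']
    rw [zero_sum _ _ fun i hi => (Finset.mem_Ico.1 hi).1, add_zero]
  have hRO : (fun e => D.avgR N p e - R' e) =O[𝓝 0] fun e : ℝ => e ^ k :=
    (seriesSum_isBigO hk (fun i => (D.avgTerm i).u) p).congr_left fun e => by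
      simp only [avgR, hR']; ring
  have hPO : (fun e => D.avgP N p e - P' e) =O[𝓝 0] fun e : ℝ => e ^ k :=
    (seriesSum_isBigO hk (fun i => (D.avgTerm i).v) p).congr_left fun e => by
      simp only [avgP, hP']; ring
  have hc : ∀ j, ContDiff ℝ ∞ fun e => X j (D.avgR N p e) (D.avgP N p e) :=
    fun j => (hX j).comp hR hP
  have hc' : ∀ j, ContDiff ℝ ∞ fun e => X j (R' e) (P' e) := fun j => (hX j).comp hR's hP's
  have hpow : ∀ j : ℕ, ContDiff ℝ ∞ fun e : ℝ => e ^ j := fun j => by fun_prop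
  have e1 : composeCoeff k X D.avgTerm p.1 p.2.1 p.2.2
      = taylorCoeff k (fun e => ∑ j ∈ Finset.Ico 1 k, e ^ j * X j (R' e) (P' e)) := rfl
  rw [e1, taylorCoeff_sum fun j _ => (hpow j).mul (hc j),
    taylorCoeff_sum fun j _ => (hpow j).mul (hc' j)]
  have e2 : ∀ j ∈ Finset.Icc 1 N, taylorCoeff k
      (fun e => e ^ j * X j (D.avgR N p e) (D.avgP N p e))
      = if j ≤ k then taylorCoeff (k - j) (fun e => X j (D.avgR N p e) (D.avgP N p e)) else 0 :=
    fun j _ => taylorCoeff_pow_mul (hc j) j k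
  rw [Finset.sum_congr rfl e2, ← Finset.sum_filter]
  have h3 : (Finset.Icc 1 N).filter (fun i => i ≤ k) = Finset.Icc 1 k := by
    ext i; simp only [Finset.mem_filter, Finset.mem_Icc]; omega
  rw [h3, ← Finset.Ico_insert_right hk0, Finset.sum_insert (by simp), Nat.sub_self,
    taylorCoeff_zero, hR0, hP0]
  congr 1
  refine Finset.sum_congr rfl fun j hj => ?_
  have hj := Finset.mem_Ico.1 hj
  rw [taylorCoeff_pow_mul (hc' j), if_pos hj.2.le]
  exact taylorCoeff_congr_of_isBigO (hc j) (hc' j) (isBigO_comp_sub (hX j) hR.continuous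
    hR's.continuous hP.continuous hP's.continuous (by rw [hR0, hR'0]) (by rw [hP0, hP'0]) hRO hPO)
    _ (by omega)

/-- The residual of the averaged equation, as a function of `(R, Ψ, S)` and `e`. -/
def avgResidual (D : OscSystem) (N : ℕ) (A : ℝ × ℝ × ℝ → ℝ → ℝ) (W : ℝ × ℝ × ℝ → ℝ → ℝ)
    (X : ℕ → ℝ → ℝ → ℝ) (p : ℝ × ℝ × ℝ) (e : ℝ) : ℝ :=
  A p e + W p e - ∑ j ∈ Finset.Icc 1 N, e ^ j * X j (D.avgR N p e) (D.avgP N p e)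

theorem Valid.avgResidual_smooth {D : OscSystem} (hD : D.Valid) {N : ℕ} {A W : ℝ × ℝ × ℝ → ℝ → ℝ}
    {X : ℕ → ℝ → ℝ → ℝ} (hA : ContDiff ℝ ∞ (fun z : (ℝ × ℝ × ℝ) × ℝ => A z.1 z.2))
    (hW : ContDiff ℝ ∞ (fun z : (ℝ × ℝ × ℝ) × ℝ => W z.1 z.2)) (hX : ∀ j, Smooth2 (X j)) :
    ContDiff ℝ ∞ (fun z : (ℝ × ℝ × ℝ) × ℝ => D.avgResidual N A W X z.1 z.2) := by
  unfold avgResidual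
  refine (hA.add hW).sub (ContDiff.sum fun j _ => ContDiff.mul (by fun_prop) ?_)
  exact (hX j).comp (hD.avgR_smooth N) (hD.avgP_smooth N)

theorem Valid.taylorCoeff_avgResidual {D : OscSystem} (hD : D.Valid) {N : ℕ}
    {A W : ℝ × ℝ × ℝ → ℝ → ℝ} {X : ℕ → ℝ → ℝ → ℝ} {c d : ℕ → ℝ}
    (hA : ContDiff ℝ ∞ (fun z : (ℝ × ℝ × ℝ) × ℝ => A z.1 z.2))
    (hW : ContDiff ℝ ∞ (fun z : (ℝ × ℝ × ℝ) × ℝ => W z.1 z.2)) (hX : ∀ j, Smooth2 (X j))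
    (p : ℝ × ℝ × ℝ) (hAc : ∀ k ≤ N, taylorCoeff k (A p) = c k)
    (hWd : ∀ k ≤ N, taylorCoeff k (W p) = d k) (h0 : c 0 + d 0 = 0)
    (h : ∀ k, 1 ≤ k → c k + d k = X k p.1 p.2.1 + composeCoeff k X D.avgTerm p.1 p.2.1 p.2.2)
    {k : ℕ} (hk : k ≤ N) : taylorCoeff k (D.avgResidual N A W X p) = 0 := by
  have hp : ContDiff ℝ ∞ fun e : ℝ => (p, e) := by fun_prop
  have hAp : ContDiff ℝ ∞ (A p) := hA.comp hp
  have hWp : ContDiff ℝ ∞ (W p) := hW.comp hp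
  have hS : ContDiff ℝ ∞ fun e => ∑ j ∈ Finset.Icc 1 N, e ^ j *
      X j (D.avgR N p e) (D.avgP N p e) :=
    ContDiff.sum fun j _ => ContDiff.mul (by fun_prop)
      ((hX j).comp ((hD.avgR_smooth N).comp hp) ((hD.avgP_smooth N).comp hp))
  unfold avgResidual
  rw [taylorCoeff_sub (by fun_prop) hS, taylorCoeff_add hAp hWp, hAc k hk, hWd k hk]
  rcases Nat.eq_zero_or_pos k with rfl | hk0
  · rw [h0, taylorCoeff_zero, Finset.sum_eq_zero, sub_zero]
    intro j hj
    rw [zero_pow (by have := (Finset.mem_Icc.1 hj).1; omega), zero_mul]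
  · rw [hD.taylorCoeff_compose hX hk hk0, h k hk0, sub_self]

section residual

variable {D : OscSystem} {b : ℝ} {F G : ℕ → ℝ → ℝ → ℝ → ℝ} {w : ℝ → ℝ}

/-- The coefficient of order `k ≥ 1` is the difference of the two sides of the homological equation
`deriv_u`; order zero vanishes because `Fcoef 0 = 0`. -/
theorem IsSmoothModel.taylorCoeff_residual_R (h : D.IsSmoothModel b F G w) (hD : D.Valid)
    {k N : ℕ} (hk : k ≤ N) (p : ℝ × ℝ × ℝ) :
    taylorCoeff k (D.avgResidual N (D.slowF F N) (D.transportSum N (D.slowF F N) (D.slowG G w N)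
      fun i => (D.avgTerm i).u) D.Lam p) = 0 := by
  have hs := fun i => (hD.avgTerm_isRegular i).u
  refine hD.taylorCoeff_avgResidual (h.smooth_slowF N)
    (transportSum_smooth (h.smooth_slowF N) (h.smooth_slowG N) hs) hD.smooth_Lam p
    (fun k hk => h.taylorCoeff_slowF hk p)
    (fun k hk => taylorCoeff_transportSum hD (h.smooth_slowF N) (h.smooth_slowG N)
      (fun p k hk => h.taylorCoeff_slowF hk p) (fun p k hk => h.taylorCoeff_slowG hk p) hk p)
    ?_ ?_ hk
  · simp [Fcoef_zero hD, transportCoeff]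
  · intro k hk0
    rw [if_neg (by omega), ← hD.deriv_u]; ring

theorem IsSmoothModel.taylorCoeff_residual_P (h : D.IsSmoothModel b F G w) (hD : D.Valid)
    {k N : ℕ} (hk : k ≤ N) (p : ℝ × ℝ × ℝ) :
    taylorCoeff k (D.avgResidual N (D.slowG G w N) (D.transportSum N (D.slowF F N)
      (D.slowG G w N) fun i => (D.avgTerm i).v) D.Om p) = 0 := by
  have hs := fun i => (hD.avgTerm_isRegular i).v
  refine hD.taylorCoeff_avgResidual (h.smooth_slowG N)
    (transportSum_smooth (h.smooth_slowF N) (h.smooth_slowG N) hs) hD.smooth_Om p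
    (fun k hk => h.taylorCoeff_slowG hk p)
    (fun k hk => taylorCoeff_transportSum hD (h.smooth_slowF N) (h.smooth_slowG N)
      (fun p k hk => h.taylorCoeff_slowF hk p) (fun p k hk => h.taylorCoeff_slowG hk p) hk p)
    ?_ ?_ hk
  · simp [Gcoef_zero hD, transportCoeff]
  · intro k hk0
    rw [if_neg (by omega), ← hD.deriv_v]; ring

end residual

end OscSystem

/-! ### Periodic families -/

/-- Periodicity in the third variable. -/
def PeriodicS (T : ℝ) (H : ℝ × ℝ × ℝ → ℝ → ℝ) : Prop :=
  ∀ R Ψ S e, H (R, Ψ, S + T) e = H (R, Ψ, S) e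

theorem PeriodicS.exists_mem {T : ℝ} (hT : 0 < T) {H : ℝ × ℝ × ℝ → ℝ → ℝ} (hH : PeriodicS T H)
    (R Ψ S e : ℝ) : ∃ S' ∈ Set.Icc 0 T, H (R, Ψ, S) e = H (R, Ψ, S') e := by
  have : Function.Periodic (fun S => H (R, Ψ, S) e) T := fun S => hH R Ψ S e
  obtain ⟨y, hy, h⟩ := this.exists_mem_Ico₀ hT S
  exact ⟨y, Set.Ico_subset_Icc_self hy, h⟩

/-- The phase `S(t)` is unbounded along solutions; periodicity brings it back to `[0, T]`, so that
compactness applies. -/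
theorem PeriodicS.exists_bound_pow {T : ℝ} (hT : 0 < T) {H : ℝ × ℝ × ℝ → ℝ → ℝ}
    (hH : PeriodicS T H) (hc : ContDiff ℝ ∞ fun z : (ℝ × ℝ × ℝ) × ℝ => H z.1 z.2) (ψ₀ : ℝ) (N : ℕ)
    (h0 : ∀ p, ∀ i ≤ N, taylorCoeff i (H p) = 0) :
    ∃ C : ℝ, 0 ≤ C ∧ ∀ R Ψ S e, |R| ≤ 1 → |Ψ - ψ₀| ≤ 1 → e ∈ Set.Icc (0 : ℝ) 1 →
      |H (R, Ψ, S) e| ≤ C * e ^ (N + 1) := by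
  have hK : IsCompact (Set.Icc (-1 : ℝ) 1 ×ˢ (Set.Icc (ψ₀ - 1) (ψ₀ + 1) ×ˢ Set.Icc 0 T)) :=
    isCompact_Icc.prod (isCompact_Icc.prod isCompact_Icc)
  obtain ⟨C, hC0, hC⟩ := exists_bound_of_taylorCoeff_eq_zero hc hK N fun p _ => h0 p
  refine ⟨C, hC0, fun R Ψ S e hR hΨ he => ?_⟩
  obtain ⟨S', hS', h⟩ := hH.exists_mem hT R Ψ S e
  rw [h]
  have := abs_le.1 hΨ
  exact hC (R, Ψ, S') ⟨abs_le.1 hR, ⟨by linarith, by linarith⟩, hS'⟩ e he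

section seriesSum

variable {N : ℕ} {T : ℝ} {w : ℕ → ℝ → ℝ → ℝ → ℝ}

theorem seriesSum_periodic (hw : ∀ i R Ψ S, w i R Ψ (S + T) = w i R Ψ S) :
    PeriodicS T (seriesSum N w) := fun R Ψ S e => by simp only [seriesSum, hw]

theorem seriesSum_deriv₁_periodic (hw : ∀ i R Ψ S, w i R Ψ (S + T) = w i R Ψ S) :
    PeriodicS T (seriesSum N fun i x y z => deriv (fun x => w i x y z) x) :=
  seriesSum_periodic fun i R Ψ S => by simp only [hw]

theorem seriesSum_deriv₂_periodic (hw : ∀ i R Ψ S, w i R Ψ (S + T) = w i R Ψ S) :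
    PeriodicS T (seriesSum N fun i x y z => deriv (fun y => w i x y z) y) :=
  seriesSum_periodic fun i R Ψ S => by simp only [hw]

theorem seriesSum_deriv₃_periodic (hw : ∀ i R Ψ S, w i R Ψ (S + T) = w i R Ψ S) :
    PeriodicS T (seriesSum N fun i x y z => deriv (fun z => w i x y z) z) :=
  seriesSum_periodic fun i R Ψ S => by
    rw [← deriv_comp_add_const]
    simp only [hw]

theorem Smooth3.hasDerivWithinAt {h : ℝ → ℝ → ℝ → ℝ} (hh : Smooth3 h) {x y z : ℝ → ℝ}
    {x' y' z' t : ℝ} {s : Set ℝ} (hx : HasDerivWithinAt x x' s t) (hy : HasDerivWithinAt y y' s t)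
    (hz : HasDerivWithinAt z z' s t) :
    HasDerivWithinAt (fun t => h (x t) (y t) (z t))
      (x' * deriv (fun x => h x (y t) (z t)) (x t) + y' * deriv (fun y => h (x t) y (z t)) (y t)
        + z' * deriv (fun z => h (x t) (y t) z) (z t)) s t := by
  have hh' : ContDiff ℝ ∞ (fun p : ℝ × ℝ × ℝ => h p.1 p.2.1 p.2.2) := hh
  set L := fderiv ℝ (fun p : ℝ × ℝ × ℝ => h p.1 p.2.1 p.2.2) (x t, y t, z t) with hL
  have hd : HasFDerivAt (fun p : ℝ × ℝ × ℝ => h p.1 p.2.1 p.2.2) L (x t, y t, z t) :=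
    (hh'.differentiable (by simp) _).hasFDerivAt
  have h1 : deriv (fun x => h x (y t) (z t)) (x t) = L (1, 0, 0) :=
    (hd.comp_hasDerivAt (f := fun s => (s, y t, z t)) (x t) ((hasDerivAt_id' (x t)).prodMk
      ((hasDerivAt_const (x t) (y t)).prodMk (hasDerivAt_const (x t) (z t))))).deriv
  have h2 : deriv (fun y => h (x t) y (z t)) (y t) = L (0, 1, 0) :=
    (hd.comp_hasDerivAt (f := fun s => (x t, s, z t)) (y t) ((hasDerivAt_const (y t) (x t)).prodMk
      ((hasDerivAt_id' (y t)).prodMk (hasDerivAt_const (y t) (z t))))).deriv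
  have h3 : deriv (fun z => h (x t) (y t) z) (z t) = L (0, 0, 1) :=
    (hd.comp_hasDerivAt (f := fun s => (x t, y t, s)) (z t) ((hasDerivAt_const (z t) (x t)).prodMk
      ((hasDerivAt_const (z t) (y t)).prodMk (hasDerivAt_id' (z t))))).deriv
  have h4 := hd.comp_hasDerivWithinAt t (hx.prodMk (hy.prodMk hz))
  have h5 : L (x', y', z') = x' * L (1, 0, 0) + y' * L (0, 1, 0) + z' * L (0, 0, 1) := by
    have : ((x', y', z') : ℝ × ℝ × ℝ) = x' • ((1, 0, 0) : ℝ × ℝ × ℝ) + y' • ((0, 1, 0) : ℝ × ℝ × ℝ)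
      + z' • ((0, 0, 1) : ℝ × ℝ × ℝ) := by simp
    rw [this, map_add, map_add, map_smul, map_smul, map_smul]
    rfl
  rw [h1, h2, h3, ← h5]
  exact h4

theorem seriesSum_hasDerivWithinAt (hw : ∀ i, Smooth3 (w i)) {x y z ε : ℝ → ℝ}
    {x' y' z' ε' t : ℝ} {s : Set ℝ} (hx : HasDerivWithinAt x x' s t)
    (hy : HasDerivWithinAt y y' s t) (hz : HasDerivWithinAt z z' s t)
    (hε : HasDerivWithinAt ε ε' s t) :
    HasDerivWithinAt (fun t => seriesSum N w (x t, y t, z t) (ε t))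
      (x' * seriesSum N (fun i x y z => deriv (fun x => w i x y z) x) (x t, y t, z t) (ε t)
        + y' * seriesSum N (fun i x y z => deriv (fun y => w i x y z) y) (x t, y t, z t) (ε t)
        + z' * seriesSum N (fun i x y z => deriv (fun z => w i x y z) z) (x t, y t, z t) (ε t)
        + ∑ i ∈ Finset.Icc 1 N, (i : ℝ) * ε t ^ (i - 1) * ε' * w i (x t) (y t) (z t)) s t := by
  unfold seriesSum
  have h := HasDerivWithinAt.fun_sum (u := Finset.Icc 1 N) fun i _ =>
    (hε.fun_pow i).fun_mul ((hw i).hasDerivWithinAt hx hy hz)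
  refine h.congr_deriv ?_
  rw [Finset.mul_sum, Finset.mul_sum, Finset.mul_sum, ← Finset.sum_add_distrib,
    ← Finset.sum_add_distrib, ← Finset.sum_add_distrib]
  refine Finset.sum_congr rfl fun i _ => ?_
  ring

end seriesSum

namespace OscSystem

/-! ### The small parameter -/

/-- The small parameter `t^(-1/(2q))`. -/
def eps (D : OscSystem) (t : ℝ) : ℝ := t ^ (-1 / (2 * (D.q : ℝ)))

theorem eps_pos (D : OscSystem) {t : ℝ} (ht : 0 < t) : 0 < D.eps t := Real.rpow_pos_of_pos ht _

theorem eps_pow (D : OscSystem) {t : ℝ} (ht : 0 < t) (k : ℕ) :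
    D.eps t ^ k = t ^ (-(k : ℝ) / (2 * D.q)) := by
  rw [eps, ← Real.rpow_natCast, ← Real.rpow_mul ht.le]
  congr 1; ring

theorem Valid.q_cast_pos {D : OscSystem} (hD : D.Valid) : (0 : ℝ) < D.q := by
  exact_mod_cast hD.q_pos

theorem eps_pow_two_q {D : OscSystem} (hD : D.Valid) {t : ℝ} (ht : 0 < t) :
    D.eps t ^ (2 * D.q) = t⁻¹ := by
  have := hD.q_cast_pos
  rw [D.eps_pow ht, ← Real.rpow_neg_one]
  congr 1; push_cast; field_simp

theorem eps_le_one (D : OscSystem) {t : ℝ} (ht : 1 ≤ t) : D.eps t ≤ 1 := by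
  refine Real.rpow_le_one_of_one_le_of_nonpos ht ?_
  rw [neg_div]
  exact neg_nonpos.2 (by positivity)

theorem eps_anti (D : OscSystem) {s t : ℝ} (hs : 0 < s) (hst : s ≤ t) : D.eps t ≤ D.eps s := by
  refine Real.rpow_le_rpow_of_nonpos hs hst ?_
  rw [neg_div]
  exact neg_nonpos.2 (by positivity)

theorem eps_tendsto {D : OscSystem} (hD : D.Valid) : Tendsto D.eps atTop (𝓝 0) := by
  have := hD.q_cast_pos
  have h := tendsto_rpow_neg_atTop (y := 1 / (2 * (D.q : ℝ))) (by positivity)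
  refine h.congr fun t => ?_
  rw [eps, neg_div]

theorem eps_hasDerivAt {D : OscSystem} (hD : D.Valid) {t : ℝ} (ht : 0 < t) :
    HasDerivAt D.eps (-(D.eps t ^ (2 * D.q + 1)) / (2 * D.q)) t := by
  have hq := hD.q_cast_pos
  have h := Real.hasDerivAt_rpow_const (x := t) (p := -1 / (2 * (D.q : ℝ))) (Or.inl ht.ne')
  refine h.congr_deriv ?_
  rw [pow_succ, eps_pow_two_q hD ht, eps, Real.rpow_sub_one ht.ne']
  ring

theorem eps_pow_two_mul (D : OscSystem) {t : ℝ} (ht : 0 < t) (j : ℕ) :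
    D.eps t ^ (2 * j) = t ^ (-(j : ℝ) / D.q) := by
  rw [D.eps_pow ht]
  congr 1; push_cast; rw [← mul_neg, mul_div_mul_left _ _ two_ne_zero]

theorem phase_hasDerivAt {D : OscSystem} (hD : D.Valid) {t : ℝ} (ht : 0 < t) :
    HasDerivAt D.phase (D.phaseRate (D.eps t)) t := by
  have hq := hD.q_cast_pos
  have hq1 := hD.q_pos
  unfold phase
  have h1 : HasDerivAt (fun t => D.s 0 * t) (D.s 0) t := by
    simpa using (hasDerivAt_id' t).const_mul (D.s 0)
  have h2 : HasDerivAt (fun t => ∑ j ∈ Finset.Ico 1 D.q, D.s j * t ^ (1 - (j : ℝ) / D.q))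
      (∑ j ∈ Finset.Ico 1 D.q, D.s j * ((1 - (j : ℝ) / D.q) * t ^ ((1 - (j : ℝ) / D.q) - 1))) t :=
    HasDerivAt.fun_sum fun j _ =>
      (Real.hasDerivAt_rpow_const (Or.inl ht.ne')).const_mul _
  have h3 : HasDerivAt (fun t => D.s D.q * Real.log t) (D.s D.q * t⁻¹) t :=
    (Real.hasDerivAt_log ht.ne').const_mul _
  refine ((h1.fun_add h2).fun_add h3).congr_deriv ?_
  rw [phaseRate, Finset.sum_range_succ, Finset.range_eq_Ico,
    Finset.sum_eq_sum_Ico_succ_bot (a := 0) (b := D.q) (by omega)]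
  have e0 : D.phaseCoeff (2 * 0) = D.s 0 := by
    rw [phaseCoeff, if_pos ⟨by simp, by omega⟩, if_neg (by omega)]; simp
  -- At order `2q` the factor `1 - k/(2q)` vanishes and the indicator in `phaseCoeff` accounts for
  -- the logarithm.
  have eq : D.phaseCoeff (2 * D.q) = D.s D.q := by
    rw [phaseCoeff, if_pos ⟨by simp, by omega⟩, if_pos rfl]
    rw [Nat.mul_div_cancel_left _ two_pos]
    push_cast
    field_simp
    ring
  rw [e0, eq, eps_pow_two_q hD ht]
  congr 1
  · congr 1
    · simp
    · refine Finset.sum_congr rfl fun j hj => ?_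
      have hj := Finset.mem_Ico.1 hj
      rw [D.eps_pow_two_mul ht, phaseCoeff, if_pos ⟨by simp, by omega⟩, if_neg (by omega),
        Nat.mul_div_cancel_left _ two_pos]
      have : (1 - (j : ℝ) / D.q) - 1 = -(j : ℝ) / D.q := by ring
      rw [this]
      push_cast
      field_simp
      ring
  · ring

/-! ### The averaged equations along solutions -/

section residual

variable {D : OscSystem} {b : ℝ} {F G : ℕ → ℝ → ℝ → ℝ → ℝ} {w : ℝ → ℝ}

theorem IsSmoothModel.transportSum_periodic (h : D.IsSmoothModel b F G w) (hD : D.Valid) {N : ℕ}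
    {v : ℕ → ℝ → ℝ → ℝ → ℝ}
    (hv : ∀ i R Ψ S, v i R Ψ (S + 2 * Real.pi * D.varkappa) = v i R Ψ S) :
    PeriodicS (2 * Real.pi * D.varkappa)
      (D.transportSum N (D.slowF F N) (D.slowG G w N) v) := fun R Ψ S e => by
  unfold transportSum
  rw [h.slowF_periodic hD, h.slowG_periodic hD, seriesSum_deriv₁_periodic hv,
    seriesSum_deriv₂_periodic hv, seriesSum_deriv₃_periodic hv,
    seriesSum_periodic (fun i R Ψ S => by rw [hv])]

theorem Valid.avgR_periodic (hD : D.Valid) (N : ℕ) :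
    PeriodicS (2 * Real.pi * D.varkappa) (D.avgR N) := fun R Ψ S e => by
  unfold avgR
  rw [seriesSum_periodic (fun i => (hD.avgTerm_isRegular i).u_periodic)]

theorem Valid.avgP_periodic (hD : D.Valid) (N : ℕ) :
    PeriodicS (2 * Real.pi * D.varkappa) (D.avgP N) := fun R Ψ S e => by
  unfold avgP
  rw [seriesSum_periodic (fun i => (hD.avgTerm_isRegular i).v_periodic)]

theorem Valid.avgResidual_periodic (hD : D.Valid) {N : ℕ} {A W : ℝ × ℝ × ℝ → ℝ → ℝ}
    {X : ℕ → ℝ → ℝ → ℝ} (hA : PeriodicS (2 * Real.pi * D.varkappa) A)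
    (hW : PeriodicS (2 * Real.pi * D.varkappa) W) :
    PeriodicS (2 * Real.pi * D.varkappa) (D.avgResidual N A W X) := fun R Ψ S e => by
  unfold avgResidual
  rw [hA, hW, hD.avgR_periodic, hD.avgP_periodic]

theorem seriesSum_abs_le {N : ℕ} {v : ℕ → ℝ → ℝ → ℝ → ℝ} {T : ℝ} (hT : 0 < T)
    (hv : ∀ i, Smooth3 (v i)) (hper : ∀ i R Ψ S, v i R Ψ (S + T) = v i R Ψ S) (ψ₀ : ℝ) :
    ∃ C : ℝ, 0 ≤ C ∧ ∀ R Ψ S e, |R| ≤ 1 → |Ψ - ψ₀| ≤ 1 → e ∈ Set.Icc (0 : ℝ) 1 →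
      |seriesSum N v (R, Ψ, S) e| ≤ C * e := by
  obtain ⟨C, h0, h⟩ := (seriesSum_periodic (N := N) hper).exists_bound_pow hT (seriesSum_smooth hv)
    ψ₀ 0 fun p i hi => by
      rw [Nat.le_zero.1 hi, taylorCoeff_zero, seriesSum, Finset.sum_eq_zero]
      intro j hj
      rw [zero_pow (by have := (Finset.mem_Icc.1 hj).1; omega), zero_mul]
  exact ⟨C, h0, by simpa using h⟩

/-- Along a solution near the resonance, `R` and `Ψ` obey the equations with right-hand sides
`slowF`, `slowG` up to a small error. -/
theorem IsSmoothModel.slow_equations (h : D.IsSmoothModel b F G w) (hD : D.Valid) (N : ℕ) :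
    ∃ C T : ℝ, 0 ≤ C ∧ 1 ≤ T ∧ ∀ t₁ t₂ : ℝ, ∀ r φ : ℝ → ℝ, T ≤ t₁ → D.IsSolutionOn t₁ t₂ r φ →
      (∀ t ∈ Set.Icc t₁ t₂, |r t - D.a| ≤ b) → ∀ t ∈ Set.Icc t₁ t₂, ∃ x y : ℝ,
      HasDerivWithinAt (fun t => (r t - D.a) / D.eps t) x (Set.Icc t₁ t₂) t ∧
      HasDerivWithinAt (fun t => φ t - (D.kappa : ℝ) / D.varkappa * D.phase t) y
        (Set.Icc t₁ t₂) t ∧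
      |x - D.slowF F N ((r t - D.a) / D.eps t, φ t - (D.kappa : ℝ) / D.varkappa * D.phase t,
        D.phase t) (D.eps t)| ≤ C * D.eps t ^ (N + 1) ∧
      |y - D.slowG G w N ((r t - D.a) / D.eps t, φ t - (D.kappa : ℝ) / D.varkappa * D.phase t,
        D.phase t) (D.eps t)| ≤ C * D.eps t ^ (N + 1) := by
  -- The remainder is of order `e^(2(N+2))`, small enough to survive the division by `e` in the
  -- equation for `R`.
  obtain ⟨C₁, T₁, hT₁, h₁⟩ := hD.f_class.expansion (N + 2) (by omega)
  obtain ⟨C₂, T₂, hT₂, h₂⟩ := hD.g_class.expansion (N + 2) (by omega)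
  refine ⟨max C₁ 0 + max C₂ 0, max 1 (max T₁ T₂), by positivity, le_max_left _ _, ?_⟩
  intro t₁ t₂ r φ hT hsol hb t ht
  have ht1 : (max 1 (max T₁ T₂)) ≤ t := hT.trans ht.1
  have ht1' : 1 ≤ t := (le_max_left _ _).trans ht1
  have htT₁ : T₁ ≤ t := ((le_max_left _ _).trans (le_max_right _ _)).trans ht1
  have htT₂ : T₂ ≤ t := ((le_max_right _ _).trans (le_max_right _ _)).trans ht1
  have ht0 : 0 < t := by linarith
  obtain ⟨hr, hdr, hdφ⟩ := hsol t ht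
  have he := D.eps_pos ht0
  have he1 := D.eps_le_one ht1'
  have hq := hD.q_cast_pos
  set e := D.eps t with hedef
  set S := D.phase t
  set R := (r t - D.a) / e with hR
  set Ψ := φ t - (D.kappa : ℝ) / D.varkappa * S with hΨ
  have hreq : D.a + e * R = r t := by rw [hR]; field_simp; ring
  have hφeq : (D.kappa : ℝ) / D.varkappa * S + Ψ = φ t := by rw [hΨ]; ring
  have hpow : t ^ (-((N + 2 : ℕ) : ℝ) / D.q) = e ^ (2 * (N + 2)) := (D.eps_pow_two_mul ht0 _).symm
  have h₁' := h₁ t htT₁ (r t) (φ t) S hr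
  have h₂' := h₂ t htT₂ (r t) (φ t) S hr
  rw [hpow] at h₁' h₂'
  have hpe : ∀ {k : ℕ}, N + 1 ≤ k → e ^ k ≤ e ^ (N + 1) :=
    fun hk => pow_le_pow_of_le_one he.le he1 hk
  have heps := (eps_hasDerivAt hD ht0).hasDerivWithinAt (s := Set.Icc t₁ t₂)
  have hph := (phase_hasDerivAt hD ht0).hasDerivWithinAt (s := Set.Icc t₁ t₂)
  refine ⟨_, _, (hdr.sub_const D.a).div heps he.ne', hdφ.sub (hph.const_mul _), ?_, ?_⟩
  · rw [← hedef]
    unfold slowF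
    simp only [hreq, hφeq]
    have e1 : ∑ j ∈ Finset.Ico 1 (N + 2), e ^ (2 * j - 1) * F j (r t) (φ t) S
        = (∑ j ∈ Finset.Ico 1 (N + 2), t ^ (-(j : ℝ) / D.q) * D.fc j (r t) (φ t) S) / e := by
      rw [Finset.sum_div]
      refine Finset.sum_congr rfl fun j hj => ?_
      have hj := (Finset.mem_Ico.1 hj).1
      rw [h.F_eq j _ _ _ (hb t ht), ← D.eps_pow_two_mul ht0, ← hedef,
        show 2 * j = (2 * j - 1) + 1 by omega, pow_succ, Nat.add_sub_cancel]
      field_simp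
    -- The derivative of `1/e` in the quotient rule is exactly the term `e^(2q) R/(2q)` of `slowF`;
    -- only the expansion error of `f`, divided by `e`, remains.
    have e2 : (D.f (r t) (φ t) S t * e - (r t - D.a) * (-(e ^ (2 * D.q + 1)) / (2 * D.q))) / e ^ 2
        - (∑ j ∈ Finset.Ico 1 (N + 2), e ^ (2 * j - 1) * F j (r t) (φ t) S
          + e ^ (2 * D.q) * (R / (2 * D.q)))
        = (D.f (r t) (φ t) S t
          - ∑ j ∈ Finset.Ico 1 (N + 2), t ^ (-(j : ℝ) / D.q) * D.fc j (r t) (φ t) S) / e := by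
      rw [e1, hR, pow_succ]; field_simp; ring
    rw [e2, abs_div, abs_of_pos he, div_le_iff₀ he]
    refine h₁'.trans ?_
    calc C₁ * e ^ (2 * (N + 2)) ≤ (max C₁ 0 + max C₂ 0) * e ^ (N + 1 + 1) := by
          refine mul_le_mul ?_ (pow_le_pow_of_le_one he.le he1 (by omega)) (by positivity)
            (by positivity)
          have := le_max_left C₁ 0
          have := le_max_right C₂ 0
          linarith
      _ = _ := by rw [pow_succ]; ring
  · unfold slowG
    simp only [hreq, hφeq]
    have e1 : ∑ j ∈ Finset.Ico 1 (N + 2), e ^ (2 * j) * G j (r t) (φ t) S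
        = ∑ j ∈ Finset.Ico 1 (N + 2), t ^ (-(j : ℝ) / D.q) * D.gc j (r t) (φ t) S := by
      refine Finset.sum_congr rfl fun j _ => ?_
      rw [h.G_eq j _ _ _ (hb t ht), ← D.eps_pow_two_mul ht0]
    have e2 : ∀ a g P s : ℝ, a + g - P - (a - P + s) = g - s := fun a g P s => by ring
    rw [e1, h.w_eq _ (hb t ht), e2]
    refine h₂'.trans (mul_le_mul ?_ (hpe (by omega)) (by positivity) (by positivity))
    have := le_max_left C₂ 0
    have := le_max_right C₁ 0
    linarith

/-- The chain rule along an inexact trajectory: the model velocities `A`, `B` give `transportSum`,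
and the defects `x' - A`, `y' - B` multiply the first derivatives. -/
theorem transportSum_along (hD : D.Valid) {N : ℕ} {A B : ℝ × ℝ × ℝ → ℝ → ℝ}
    {v : ℕ → ℝ → ℝ → ℝ → ℝ} (hv : ∀ i, Smooth3 (v i)) {x y : ℝ → ℝ} {x' y' t : ℝ} {s : Set ℝ}
    (ht : 0 < t) (hx : HasDerivWithinAt x x' s t) (hy : HasDerivWithinAt y y' s t) :
    HasDerivWithinAt (fun t => seriesSum N v (x t, y t, D.phase t) (D.eps t))
      (D.transportSum N A B v (x t, y t, D.phase t) (D.eps t)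
        + ((x' - A (x t, y t, D.phase t) (D.eps t)) *
            seriesSum N (fun i x y z => deriv (fun x => v i x y z) x) (x t, y t, D.phase t)
              (D.eps t)
          + (y' - B (x t, y t, D.phase t) (D.eps t)) *
            seriesSum N (fun i x y z => deriv (fun y => v i x y z) y) (x t, y t, D.phase t)
              (D.eps t))) s t := by
  have h := seriesSum_hasDerivWithinAt (N := N) hv hx hy
    (phase_hasDerivAt hD ht).hasDerivWithinAt (eps_hasDerivAt hD ht).hasDerivWithinAt
  refine h.congr_deriv ?_
  have e1 : ∑ i ∈ Finset.Icc 1 N, (i : ℝ) * D.eps t ^ (i - 1) *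
      (-(D.eps t ^ (2 * D.q + 1)) / (2 * D.q)) * v i (x t) (y t) (D.phase t)
      = D.eps t ^ (2 * D.q) * seriesSum N (fun i x y z => -((i : ℝ) / (2 * D.q)) * v i x y z)
        (x t, y t, D.phase t) (D.eps t) := by
    rw [seriesSum, Finset.mul_sum]
    refine Finset.sum_congr rfl fun i hi => ?_
    have hi := (Finset.mem_Icc.1 hi).1
    obtain ⟨j, rfl⟩ : ∃ j, i = j + 1 := ⟨i - 1, by omega⟩
    rw [Nat.add_sub_cancel, pow_succ (D.eps t) (2 * D.q), pow_succ (D.eps t) j]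
    ring
  rw [e1, transportSum]
  ring

/-- Averaging: near the resonance, solutions are close to approximate solutions of the truncated
averaged system. -/
theorem Valid.averaging (hD : D.Valid) (ψ₀ : ℝ) (N : ℕ) :
    ∃ C T : ℝ, 0 ≤ C ∧ 1 ≤ T ∧ ∀ t₁ t₂ : ℝ, ∀ r φ : ℝ → ℝ, T ≤ t₁ → D.IsSolutionOn t₁ t₂ r φ →
      (∀ t ∈ Set.Icc t₁ t₂, |r t - D.a| ≤ D.eps t ∧
        |φ t - (D.kappa : ℝ) / D.varkappa * D.phase t - ψ₀| ≤ 1) →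
      ∃ ρ ψ : ℝ → ℝ, ∀ t ∈ Set.Icc t₁ t₂,
        (∃ x, HasDerivWithinAt ρ x (Set.Icc t₁ t₂) t ∧
          |x - D.LamHat N (ρ t) (ψ t) t| ≤ C * D.eps t ^ (N + 1)) ∧
        (∃ y, HasDerivWithinAt ψ y (Set.Icc t₁ t₂) t ∧
          |y - D.OmHat N (ρ t) (ψ t) t| ≤ C * D.eps t ^ (N + 1)) ∧
        |ρ t - (r t - D.a) / D.eps t| ≤ C * D.eps t ∧
        |ψ t - (φ t - (D.kappa : ℝ) / D.varkappa * D.phase t)| ≤ C * D.eps t := by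
  obtain ⟨b, F, G, w, h⟩ := hD.exists_isSmoothModel
  have hT := hD.period_pos
  have hu := fun i => (hD.avgTerm_isRegular i).u
  have hv := fun i => (hD.avgTerm_isRegular i).v
  have hup := fun i => (hD.avgTerm_isRegular i).u_periodic
  have hvp := fun i => (hD.avgTerm_isRegular i).v_periodic
  obtain ⟨C₀, T₀, hC₀, hT₀, h₀⟩ := h.slow_equations hD N
  obtain ⟨C₁, hC₁, h₁⟩ := (hD.avgResidual_periodic (N := N) (X := D.Lam)
    (fun R Ψ S e => h.slowF_periodic hD N R Ψ S e)
    (h.transportSum_periodic hD (N := N) hup)).exists_bound_pow hT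
    (hD.avgResidual_smooth (h.smooth_slowF N) (transportSum_smooth (h.smooth_slowF N)
      (h.smooth_slowG N) hu) hD.smooth_Lam) ψ₀ N
    fun p i hi => h.taylorCoeff_residual_R hD hi p
  obtain ⟨C₂, hC₂, h₂⟩ := (hD.avgResidual_periodic (N := N) (X := D.Om)
    (fun R Ψ S e => h.slowG_periodic hD N R Ψ S e)
    (h.transportSum_periodic hD (N := N) hvp)).exists_bound_pow hT
    (hD.avgResidual_smooth (h.smooth_slowG N) (transportSum_smooth (h.smooth_slowF N)
      (h.smooth_slowG N) hv) hD.smooth_Om) ψ₀ N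
    fun p i hi => h.taylorCoeff_residual_P hD hi p
  obtain ⟨A₁, hA₁, a₁⟩ := seriesSum_abs_le (N := N) hT (fun i => (hu i).deriv₁)
    (fun i R Ψ S => by simp only [hup]) ψ₀
  obtain ⟨A₂, hA₂, a₂⟩ := seriesSum_abs_le (N := N) hT (fun i => (hu i).deriv₂)
    (fun i R Ψ S => by simp only [hup]) ψ₀
  obtain ⟨A₃, hA₃, a₃⟩ := seriesSum_abs_le (N := N) hT (fun i => (hv i).deriv₁)
    (fun i R Ψ S => by simp only [hvp]) ψ₀
  obtain ⟨A₄, hA₄, a₄⟩ := seriesSum_abs_le (N := N) hT (fun i => (hv i).deriv₂)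
    (fun i R Ψ S => by simp only [hvp]) ψ₀
  obtain ⟨A₅, hA₅, a₅⟩ := seriesSum_abs_le (N := N) hT hu hup ψ₀
  obtain ⟨A₆, hA₆, a₆⟩ := seriesSum_abs_le (N := N) hT hv hvp ψ₀
  -- From this time on the zone `|r - a| ≤ e` lies where the smooth model agrees with the system.
  obtain ⟨T₁, hT₁⟩ := eventually_atTop.1 ((eps_tendsto hD).eventually (ge_mem_nhds h.b_pos))
  refine ⟨C₁ + C₂ + C₀ * (1 + A₁ + A₂ + A₃ + A₄) + A₅ + A₆, max T₀ T₁, by positivity,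
    hT₀.trans (le_max_left _ _), ?_⟩
  intro t₁ t₂ r φ ht₁ hsol hnear
  set R : ℝ → ℝ := fun t => (r t - D.a) / D.eps t with hRdef
  set Ψ : ℝ → ℝ := fun t => φ t - (D.kappa : ℝ) / D.varkappa * D.phase t with hΨdef
  refine ⟨fun t => D.avgR N (R t, Ψ t, D.phase t) (D.eps t),
    fun t => D.avgP N (R t, Ψ t, D.phase t) (D.eps t), fun t ht => ?_⟩
  have hge : 1 ≤ t₁ := hT₀.trans ((le_max_left _ _).trans ht₁)
  have htge : 1 ≤ t := hge.trans ht.1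
  have ht0 : 0 < t := by linarith
  have he := D.eps_pos ht0
  have he1 := D.eps_le_one htge
  have hemem : D.eps t ∈ Set.Icc (0 : ℝ) 1 := ⟨he.le, he1⟩
  have hb : ∀ t ∈ Set.Icc t₁ t₂, |r t - D.a| ≤ b := fun t ht =>
    (hnear t ht).1.trans (hT₁ t (((le_max_right _ _).trans ht₁).trans ht.1))
  obtain ⟨x, y, hx, hy, hxe, hye⟩ := h₀ t₁ t₂ r φ ((le_max_left _ _).trans ht₁) hsol hb t ht
  have hR1 : |R t| ≤ 1 := by
    rw [hRdef, abs_div, abs_of_pos he, div_le_one he]; exact (hnear t ht).1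
  have hΨ1 : |Ψ t - ψ₀| ≤ 1 := (hnear t ht).2
  set p : ℝ × ℝ × ℝ := (R t, Ψ t, D.phase t) with hp
  set e := D.eps t with hedef
  have hpn : 0 ≤ e ^ (N + 1) := by positivity
  have ub : ∀ {A B : ℝ}, 0 ≤ A → |B| ≤ A * e → |B| ≤ A := fun hA hB =>
    hB.trans (mul_le_of_le_one_right hA he1)
  have b₁ := ub hA₁ (a₁ _ _ (D.phase t) e hR1 hΨ1 hemem)
  have b₂ := ub hA₂ (a₂ _ _ (D.phase t) e hR1 hΨ1 hemem)
  have b₃ := ub hA₃ (a₃ _ _ (D.phase t) e hR1 hΨ1 hemem)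
  have b₄ := ub hA₄ (a₄ _ _ (D.phase t) e hR1 hΨ1 hemem)
  have prod_le : ∀ {X Y A : ℝ}, |X| ≤ C₀ * e ^ (N + 1) → |Y| ≤ A → |X * Y| ≤ C₀ * e ^ (N + 1) * A :=
    fun hX hY => by
      rw [abs_mul]
      exact mul_le_mul hX hY (abs_nonneg _) (by positivity)
  have hhat : ∀ X : ℕ → ℝ → ℝ → ℝ, ∑ k ∈ Finset.Icc 1 N, t ^ (-(k : ℝ) / (2 * D.q)) *
      X k (D.avgR N p e) (D.avgP N p e)
      = ∑ k ∈ Finset.Icc 1 N, e ^ k * X k (D.avgR N p e) (D.avgP N p e) := fun X =>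
    Finset.sum_congr rfl fun k _ => by rw [hedef, D.eps_pow ht0]
  refine ⟨⟨_, hx.add (transportSum_along hD (A := D.slowF F N) (B := D.slowG G w N) hu ht0 hx hy),
    ?_⟩, ⟨_, hy.add (transportSum_along hD (A := D.slowF F N) (B := D.slowG G w N) hv ht0 hx hy),
    ?_⟩, ?_, ?_⟩
  -- The defect equals `avgResidual + (x - slowF)(1 + ∂_R u) + (y - slowG) ∂_Ψ u`, with `u` the
  -- truncated series; each summand is `O(e^(N+1))`. The nonnegativity facts `z₁`–`z₅` allow a
  -- single constant for all the estimates.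
  · have r₁ := h₁ (R t) (Ψ t) (D.phase t) e hR1 hΨ1 hemem
    rw [avgResidual] at r₁
    rw [LamHat, hhat]
    have q₁ := prod_le hxe b₁
    have q₂ := prod_le hye b₂
    have z₁ : 0 ≤ C₂ * e ^ (N + 1) := by positivity
    have z₂ : 0 ≤ C₀ * e ^ (N + 1) * A₃ := by positivity
    have z₃ : 0 ≤ C₀ * e ^ (N + 1) * A₄ := by positivity
    have z₄ : 0 ≤ A₅ * e ^ (N + 1) := by positivity
    have z₅ : 0 ≤ A₆ * e ^ (N + 1) := by positivity
    rw [abs_le] at r₁ q₁ q₂ hxe ⊢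
    constructor <;> linarith [r₁.1, r₁.2, q₁.1, q₁.2, q₂.1, q₂.2, hxe.1, hxe.2]
  · have r₁ := h₂ (R t) (Ψ t) (D.phase t) e hR1 hΨ1 hemem
    rw [avgResidual] at r₁
    rw [OmHat, hhat]
    have q₁ := prod_le hxe b₃
    have q₂ := prod_le hye b₄
    have z₁ : 0 ≤ C₁ * e ^ (N + 1) := by positivity
    have z₂ : 0 ≤ C₀ * e ^ (N + 1) * A₁ := by positivity
    have z₃ : 0 ≤ C₀ * e ^ (N + 1) * A₂ := by positivity
    have z₄ : 0 ≤ A₅ * e ^ (N + 1) := by positivity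
    have z₅ : 0 ≤ A₆ * e ^ (N + 1) := by positivity
    rw [abs_le] at r₁ q₁ q₂ hye ⊢
    constructor <;> linarith [r₁.1, r₁.2, q₁.1, q₁.2, q₂.1, q₂.2, hye.1, hye.2]
  · have := a₅ _ _ (D.phase t) e hR1 hΨ1 hemem
    change |R t + seriesSum N (fun i => (D.avgTerm i).u) p e - R t| ≤ _
    rw [add_sub_cancel_left]
    refine this.trans (mul_le_mul_of_nonneg_right ?_ he.le)
    have : 0 ≤ C₀ * (1 + A₁ + A₂ + A₃ + A₄) := by positivity
    linarith
  · have := a₆ _ _ (D.phase t) e hR1 hΨ1 hemem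
    change |Ψ t + seriesSum N (fun i => (D.avgTerm i).v) p e - Ψ t| ≤ _
    rw [add_sub_cancel_left]
    refine this.trans (mul_le_mul_of_nonneg_right ?_ he.le)
    have : 0 ≤ C₀ * (1 + A₁ + A₂ + A₃ + A₄) := by positivity
    linarith

end residual

end OscSystem

/-! ### A Lyapunov inequality -/

/-- The pointwise inequality behind the Lyapunov function `z²/2 + X V - c B z p`, to be read with `X
= e^(n-1)`, `B = e^β`, `L = e^ℓ`, `Q = e^(2q)`, `p = ψ - ψ₀`. The friction term yields `d L z²`, and
the cross term converts the restoring force into `c b B e X p²`. The conditions on `c` and on the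
powers let these two absorb the indefinite terms; time derivatives of the powers of `e` cost only
`O(B e · X e)`. -/
theorem lyapunov_deriv_lower_bound {e X B L Q d b c C k₁ k₂ k₃ z p P V Ve z' y' : ℝ} (he : 0 < e)
    (he1 : e ≤ 1) (hX : 0 < X) (hX1 : X ≤ 1) (hB : 0 < B) (hB1 : B ≤ 1) (hQ : 0 ≤ Q)
    (hBL : B * e ≤ L) (hLX : B * L ≤ X * e) (hQB : Q ≤ B * e * e) (hQX : Q ≤ X * e * e)
    (hd : 0 < d) (hc : 0 < c) (hcd : c ≤ d / 8) (hcb : 6 * d * c ≤ b) (hC : 0 ≤ C)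
    (hk₁ : 0 ≤ k₁) (hk₂ : 0 ≤ k₂) (hk₃ : 0 ≤ k₃) (hz : |z| ≤ C) (hp : |p| ≤ 1) (hP : |P| ≤ C)
    (hV : |V| ≤ C) (hVe : |Ve| ≤ C)
    (hz' : |z' - X * e * P - L * d * z| ≤ d / 8 * L * |z| + C * (B * e * (X * e)))
    (hy' : |y' - e * z| ≤ C * (B * e * (X * e))) (hPp : b * p ^ 2 - C * e ≤ -(P * p)) :
    d / 2 * (B * e) * z ^ 2 + c * b / 2 * (B * e) * X * p ^ 2
        - (2 * C ^ 2 + k₃ * C + k₁ * C + c * k₂ * C + 2 * c * C + c * C ^ 2) * (B * e * (X * e))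
      ≤ z * z' - X * (P * y') - X * (Ve * (k₃ * (Q * e))) - k₁ * X * Q * V + c * (k₂ * (B * Q)) * (z * p)
        - c * B * (z' * p) - c * B * (z * y') := by
  set M := B * e * (X * e) with hM
  have hM0 : 0 < M := by positivity
  have hL : 0 < L := lt_of_lt_of_le (by positivity) hBL
  set x := z' - X * e * P - L * d * z with hx
  set y := y' - e * z with hy
  have hz2 : |z| * |z| = z ^ 2 := by rw [← sq, sq_abs]
  -- z * x
  have t1 : -(d / 8 * L * z ^ 2 + C ^ 2 * M) ≤ z * x := by
    have h1 : |z * x| ≤ |z| * (d / 8 * L * |z| + C * M) := by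
      rw [abs_mul]; exact mul_le_mul_of_nonneg_left hz' (abs_nonneg _)
    have h2 : |z| * (C * M) ≤ C * (C * M) := mul_le_mul_of_nonneg_right hz (by positivity)
    have h3 := (abs_le.1 h1).1
    have h4 : |z| * (d / 8 * L * |z| + C * M) = d / 8 * L * z ^ 2 + |z| * (C * M) := by
      rw [← hz2]; ring
    linarith
  have absmul : ∀ {u v a b' : ℝ}, |u| ≤ a → |v| ≤ b' → |u * v| ≤ a * b' := fun hu hv => by
    rw [abs_mul]
    exact mul_le_mul hu hv (abs_nonneg _) ((abs_nonneg _).trans hu)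
  have t2 : X * (P * y) ≤ C ^ 2 * M := by
    have h1 := (abs_le.1 (absmul hP hy')).2
    have h2 : X * (P * y) ≤ X * (C * (C * M)) := mul_le_mul_of_nonneg_left h1 hX.le
    have h3 : X * (C * (C * M)) ≤ 1 * (C * (C * M)) := mul_le_mul_of_nonneg_right hX1 (by positivity)
    linarith
  have t3 : X * (Ve * (k₃ * (Q * e))) ≤ k₃ * C * M := by
    have h0 : Q * e ≤ B * e * e := by
      calc Q * e ≤ Q * 1 := mul_le_mul_of_nonneg_left he1 hQ
        _ ≤ _ := by linarith
    have h1 : Ve * (k₃ * (Q * e)) ≤ C * (k₃ * (Q * e)) :=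
      mul_le_mul_of_nonneg_right ((le_abs_self _).trans hVe) (by positivity)
    have h2 : C * (k₃ * (Q * e)) ≤ C * (k₃ * (B * e * e)) := by gcongr
    have h3 : X * (Ve * (k₃ * (Q * e))) ≤ X * (C * (k₃ * (B * e * e))) :=
      mul_le_mul_of_nonneg_left (h1.trans h2) hX.le
    rw [hM]; linarith
  have t4 : k₁ * X * Q * V ≤ k₁ * C * M := by
    have h1 : k₁ * X * Q * V ≤ k₁ * X * Q * C :=
      mul_le_mul_of_nonneg_left ((le_abs_self _).trans hV) (by positivity)
    have h2 : k₁ * X * Q * C ≤ k₁ * X * (B * e * e) * C := by gcongr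
    rw [hM]; linarith
  have t5 : -(c * k₂ * C * M) ≤ c * (k₂ * (B * Q)) * (z * p) := by
    have h1 := (abs_le.1 (absmul hz hp)).1
    have h2 : c * (k₂ * (B * Q)) * (-(C * 1)) ≤ c * (k₂ * (B * Q)) * (z * p) :=
      mul_le_mul_of_nonneg_left h1 (by positivity)
    have h3 : c * (k₂ * (B * Q)) * C ≤ c * (k₂ * (B * (X * e * e))) * C := by gcongr
    have h4 : c * (k₂ * (B * (X * e * e))) * C ≤ c * k₂ * C * M := by
      rw [hM]; apply le_of_eq; ring
    linarith
  have t6 : c * B * (z' * p) ≤ c * B * L * (9 * d / 8) * (|z| * |p|) + c * C * M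
      + c * (B * X * e) * (P * p) := by
    have h1 := (abs_le.1 (show |x * p| ≤ (d / 8 * L * |z| + C * M) * |p| by
      rw [abs_mul]; exact mul_le_mul_of_nonneg_right hz' (abs_nonneg _))).2
    have h2 : C * M * |p| ≤ C * M * 1 := mul_le_mul_of_nonneg_left hp (by positivity)
    have h3 : z * p ≤ |z| * |p| := by rw [← abs_mul]; exact le_abs_self _
    have h4 : L * d * (z * p) ≤ L * d * (|z| * |p|) := mul_le_mul_of_nonneg_left h3 (by positivity)
    have h5 : z' * p = x * p + X * e * (P * p) + L * d * (z * p) := by rw [hx]; ring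
    have h6 : z' * p ≤ L * (9 * d / 8) * (|z| * |p|) + C * M + X * e * (P * p) := by
      rw [h5]; linarith
    have h7 := mul_le_mul_of_nonneg_left h6 (by positivity : 0 ≤ c * B)
    have h8 : c * B * (C * M) ≤ c * 1 * (C * M) := by gcongr
    linarith
  have t7 : c * (B * X * e) * (P * p) ≤ -(c * b * (B * e) * X * p ^ 2) + c * C * M := by
    have h1 : P * p ≤ -(b * p ^ 2) + C * e := by linarith
    have h2 := mul_le_mul_of_nonneg_left h1 (by positivity : 0 ≤ c * (B * X * e))
    rw [hM]; linarith
  -- Young's inequality for the mixed term: `B L ≤ X e` and `6 d c ≤ b` make the `p²` part at most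
  -- half of the gain `c b B e X p²`.
  have t8 : c * B * L * (9 * d / 8) * (|z| * |p|)
      ≤ d / 8 * L * z ^ 2 + c * b / 2 * (B * e) * X * p ^ 2 := by
    have h1 : c * B * (9 * d / 8) * (|z| * |p|) ≤ d / 8 * z ^ 2 + 3 * d * c ^ 2 * B ^ 2 * p ^ 2 := by
      have hp2 : |p| ^ 2 = p ^ 2 := sq_abs p
      have hz3 : |z| ^ 2 = z ^ 2 := sq_abs z
      have h0 : 0 ≤ d * (c ^ 2 * B ^ 2 * p ^ 2) := by positivity
      have h13 : 0 ≤ d * (|z| - c * B * (9 / 2) * |p|) ^ 2 := by positivity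
      have h14 : d * (|z| - c * B * (9 / 2) * |p|) ^ 2
          = d * z ^ 2 + d * (c ^ 2 * B ^ 2 * p ^ 2) * (81 / 4)
            - 8 * (c * B * (9 * d / 8) * (|z| * |p|)) := by
        rw [← hp2, ← hz3]; ring
      rw [h14] at h13
      linarith
    have h2 := mul_le_mul_of_nonneg_left h1 hL.le
    have h3 : L * (3 * d * c ^ 2 * B ^ 2 * p ^ 2) ≤ c * b / 2 * (B * e) * X * p ^ 2 := by
      have h4 : (3 * d * c ^ 2 * B * p ^ 2) * (B * L) ≤ (3 * d * c ^ 2 * B * p ^ 2) * (X * e) :=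
        mul_le_mul_of_nonneg_left hLX (by positivity)
      have h5 : (c / 2 * B * p ^ 2 * X * e) * (6 * d * c) ≤ (c / 2 * B * p ^ 2 * X * e) * b :=
        mul_le_mul_of_nonneg_left hcb (by positivity)
      linarith
    linarith
  have t9 : c * B * (z * y') ≤ c * L * z ^ 2 + c * C ^ 2 * M := by
    have h1 := (abs_le.1 (absmul hz hy')).2
    have h2 : z * y' = e * z ^ 2 + z * y := by rw [hy]; ring
    have h3 : c * B * (z * y) ≤ c * B * (C * (C * M)) :=
      mul_le_mul_of_nonneg_left h1 (by positivity)
    have h4 : c * B * (C * (C * M)) ≤ c * 1 * (C * (C * M)) := by gcongr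
    have h5 : c * z ^ 2 * (B * e) ≤ c * z ^ 2 * L := mul_le_mul_of_nonneg_left hBL (by positivity)
    rw [h2]; linarith
  have t10 : c * L * z ^ 2 ≤ d / 8 * L * z ^ 2 := by
    have := mul_le_mul_of_nonneg_right hcd (by positivity : 0 ≤ L * z ^ 2)
    linarith
  have t11 : d / 2 * (B * e) * z ^ 2 ≤ d / 2 * L * z ^ 2 := by gcongr
  have t12 : 0 ≤ d * L * z ^ 2 := by positivity
  -- Conservation of energy: the force term `X e P z` in `z z'` cancels against `X P · e z`.
  have e1 : z * z' - X * (P * y') = z * x + d * L * z ^ 2 - X * (P * y) := by rw [hx, hy]; ring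
  linarith

/-- A function with `W' ≥ γ G' (W - w/2)`, `W(t₁) ≥ w > 0` grows at least linearly in `G`. -/
theorem growth_of_deriv_ge {W W' G G' : ℝ → ℝ} {t₁ t₂ γ w : ℝ} (ht : t₁ ≤ t₂)
    (hW : ∀ t ∈ Set.Icc t₁ t₂, HasDerivWithinAt W (W' t) (Set.Icc t₁ t₂) t)
    (hG : ∀ t ∈ Set.Icc t₁ t₂, HasDerivWithinAt G (G' t) (Set.Icc t₁ t₂) t)
    (h : ∀ t ∈ Set.Icc t₁ t₂, γ * G' t * (W t - w / 2) ≤ W' t) (hw : 0 < w) (h₁ : w ≤ W t₁) :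
    w / 2 * (1 + γ * (G t₂ - G t₁)) ≤ W t₂ := by
  -- Integrating factor: the hypothesis makes `E` monotone, and `1 + x ≤ exp x` turns the
  -- exponential growth into the linear bound.
  set E : ℝ → ℝ := fun t => (W t - w / 2) * Real.exp (-(γ * G t)) with hE
  have hd : ∀ t ∈ Set.Icc t₁ t₂, HasDerivWithinAt E (W' t * Real.exp (-(γ * G t))
      + (W t - w / 2) * (Real.exp (-(γ * G t)) * -(γ * G' t))) (Set.Icc t₁ t₂) t := fun t ht =>
    ((hW t ht).sub_const (w / 2)).mul ((((hG t ht).const_mul γ).neg).exp)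
  have hmono : MonotoneOn E (Set.Icc t₁ t₂) := by
    refine monotoneOn_of_hasDerivWithinAt_nonneg (convex_Icc t₁ t₂)
      (fun t ht => (hd t ht).continuousWithinAt)
      (fun t ht => (hd t (interior_subset ht)).mono interior_subset) fun t ht => ?_
    have h1 := h t (interior_subset ht)
    have h2 : 0 < Real.exp (-(γ * G t)) := Real.exp_pos _
    have h3 : 0 ≤ (W' t - γ * G' t * (W t - w / 2)) * Real.exp (-(γ * G t)) :=
      mul_nonneg (by linarith) h2.le
    linarith
  have h1 := hmono (Set.left_mem_Icc.2 ht) (Set.right_mem_Icc.2 ht) ht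
  simp only [hE] at h1
  have h2 : (W t₁ - w / 2) * Real.exp (-(γ * G t₁)) * Real.exp (γ * G t₂) ≤ W t₂ - w / 2 := by
    have := mul_le_mul_of_nonneg_right h1 (Real.exp_pos (γ * G t₂)).le
    rwa [mul_assoc (W t₂ - w / 2), ← Real.exp_add, neg_add_cancel, Real.exp_zero, mul_one] at this
  rw [mul_assoc, ← Real.exp_add] at h2
  have h3 : 1 + γ * (G t₂ - G t₁) ≤ Real.exp (-(γ * G t₁) + γ * G t₂) := by
    have := Real.add_one_le_exp (-(γ * G t₁) + γ * G t₂)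
    linarith
  have h4 := mul_le_mul_of_nonneg_left h3 (half_pos hw).le
  have h5 := mul_le_mul_of_nonneg_right (by linarith : w / 2 ≤ W t₁ - w / 2)
    (Real.exp_pos (-(γ * G t₁) + γ * G t₂)).le
  linarith

/-! ### Local estimates near the equilibrium -/

/-- Strict differentiability at `(0, ψ₀, 0)`, applied to increments in `ρ` alone; hence one
derivative serves all nearby `ψ` and `e`. -/
theorem Smooth3.exists_strict_estimate {H : ℝ → ℝ → ℝ → ℝ} (hH : Smooth3 H) (ψ₀ : ℝ) {κ : ℝ}
    (hκ : 0 < κ) : ∃ r : ℝ, 0 < r ∧ ∀ ρ ρ' ψ e, |ρ| ≤ r → |ρ'| ≤ r → |ψ - ψ₀| ≤ r → |e| ≤ r →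
      |H ρ ψ e - H ρ' ψ e - deriv (fun x => H x ψ₀ 0) 0 * (ρ - ρ')| ≤ κ * |ρ - ρ'| := by
  have hH' : ContDiff ℝ ∞ (fun p : ℝ × ℝ × ℝ => H p.1 p.2.1 p.2.2) := hH
  set q₀ : ℝ × ℝ × ℝ := (0, ψ₀, 0) with hq₀
  set L := fderiv ℝ (fun p : ℝ × ℝ × ℝ => H p.1 p.2.1 p.2.2) q₀ with hL
  have hs : HasStrictFDerivAt (fun p : ℝ × ℝ × ℝ => H p.1 p.2.1 p.2.2) L q₀ :=
    (hH'.contDiffAt (x := q₀)).hasStrictFDerivAt (by simp)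
  have hd : deriv (fun x => H x ψ₀ 0) 0 = L (1, 0, 0) :=
    (hs.hasFDerivAt.comp_hasDerivAt (f := fun s => (s, ψ₀, 0)) (0 : ℝ) ((hasDerivAt_id' (0 : ℝ)).prodMk
      ((hasDerivAt_const (0 : ℝ) ψ₀).prodMk (hasDerivAt_const (0 : ℝ) (0 : ℝ))))).deriv
  obtain ⟨r, hr, h⟩ := Metric.eventually_nhds_iff_ball.1 (hs.isLittleO.def hκ)
  refine ⟨r / 2, half_pos hr, fun ρ ρ' ψ e h1 h2 h3 h4 => ?_⟩
  have hmem : ∀ x, |x| ≤ r / 2 → dist ((x, ψ, e) : ℝ × ℝ × ℝ) q₀ < r := fun x hx => by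
    rw [hq₀, Prod.dist_eq, Prod.dist_eq, max_lt_iff, max_lt_iff]
    simp only [Real.dist_eq, sub_zero]
    exact ⟨by linarith, by linarith, by linarith⟩
  have := h ((ρ, ψ, e), (ρ', ψ, e)) (by
    rw [Metric.mem_ball, Prod.dist_eq, max_lt_iff]; exact ⟨hmem ρ h1, hmem ρ' h2⟩)
  have e1 : ((ρ, ψ, e) : ℝ × ℝ × ℝ) - (ρ', ψ, e) = (ρ - ρ') • ((1, 0, 0) : ℝ × ℝ × ℝ) := by
    simp; rfl
  simp only [e1, map_smul, norm_smul, smul_eq_mul, Real.norm_eq_abs] at this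
  have e2 : ‖((1, 0, 0) : ℝ × ℝ × ℝ)‖ = 1 := by simp [Prod.norm_def]
  rw [e2, mul_one, mul_comm (ρ - ρ')] at this
  rwa [hd]

/-- Approximate solutions `ρ` of `η ρ + e Y(ρ, ψ, e) = 0`, by iteration. -/
def approxRoot (η : ℝ) (Y : ℝ → ℝ → ℝ → ℝ) : ℕ → ℝ → ℝ → ℝ
  | 0 => fun _ _ => 0
  | j + 1 => fun ψ e => -(e / η) * Y (approxRoot η Y j ψ e) ψ e

section approxRoot

variable {η : ℝ} {Y : ℝ → ℝ → ℝ → ℝ}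

theorem approxRoot_smooth (hY : Smooth3 Y) (j : ℕ) : Smooth2 (approxRoot η Y j) := by
  induction j with
  | zero => exact contDiff_const
  | succ j ih => exact ContDiff.mul (by fun_prop) (hY.comp ih contDiff_fst contDiff_snd)

theorem approxRoot_zero_right (j : ℕ) (ψ : ℝ) : approxRoot η Y j ψ 0 = 0 := by
  cases j <;> simp [approxRoot]

/-- Each iteration multiplies the previous increment by `e/η` times a Lipschitz factor, so it gains
one order in `e`. -/
theorem approxRoot_isBigO (hY : Smooth3 Y) (j : ℕ) (ψ : ℝ) :
    (fun e => approxRoot η Y (j + 1) ψ e - approxRoot η Y j ψ e) =O[𝓝 0]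
      fun e : ℝ => e ^ (j + 1) := by
  have hs : ∀ i, ContDiff ℝ ∞ (approxRoot η Y i ψ) := fun i =>
    (approxRoot_smooth hY i).comp contDiff_const contDiff_id
  induction j with
  | zero =>
    refine isBigO_of_taylorCoeff_eq_zero ((hs _).sub (hs _)) fun i hi => ?_
    rw [show i = 0 by omega, taylorCoeff_zero, approxRoot_zero_right, approxRoot_zero_right, sub_zero]
  | succ j ih =>
    have h1 := isBigO_comp_sub (X := fun ρ e => Y ρ ψ e) (y := fun e => e) (y' := fun e => e)
      (hY.comp contDiff_fst contDiff_const contDiff_snd) (hs (j + 1)).continuous (hs j).continuous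
      continuous_id continuous_id (by rw [approxRoot_zero_right, approxRoot_zero_right]) rfl ih
      (by simpa using isBigO_zero _ _)
    have h2 : (fun e : ℝ => -(e / η)) =O[𝓝 0] fun e : ℝ => e := by
      refine (isBigO_const_mul_self (-(1 / η)) (fun e : ℝ => e) (𝓝 0)).congr_left fun e => by ring
    refine ((h2.mul h1).congr_left fun e => ?_).congr_right fun e => ?_
    · simp only [approxRoot]; ring
    · ring

theorem exists_bound_approxRoot_sub (hY : Smooth3 Y) (j : ℕ) (ψ₀ : ℝ) :
    ∃ C : ℝ, 0 ≤ C ∧ ∀ ψ e, |ψ - ψ₀| ≤ 1 → e ∈ Set.Icc (0 : ℝ) 1 →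
      |approxRoot η Y (j + 1) ψ e - approxRoot η Y j ψ e| ≤ C * e ^ (j + 1) := by
  obtain ⟨C, h0, h⟩ := exists_bound_of_taylorCoeff_eq_zero
    (B := fun ψ e => approxRoot η Y (j + 1) ψ e - approxRoot η Y j ψ e)
    (ContDiff.sub (approxRoot_smooth hY (j + 1)) (approxRoot_smooth hY j))
    (isCompact_closedBall ψ₀ 1) j fun ψ _ i hi =>
      taylorCoeff_eq_zero_of_isBigO
        (ContDiff.sub ((approxRoot_smooth hY _).comp contDiff_const contDiff_id)
          ((approxRoot_smooth hY _).comp contDiff_const contDiff_id))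
        (approxRoot_isBigO hY j ψ) i (by omega)
  exact ⟨C, h0, fun ψ e hψ he => h ψ (by rwa [Metric.mem_closedBall, Real.dist_eq]) e he⟩

theorem Smooth2.exists_bound_of_zero {X : ℝ → ℝ → ℝ} (hX : Smooth2 X) (h0 : ∀ ψ, X ψ 0 = 0)
    (ψ₀ : ℝ) : ∃ C : ℝ, 0 ≤ C ∧ ∀ ψ e, |ψ - ψ₀| ≤ 1 → e ∈ Set.Icc (0 : ℝ) 1 →
      |X ψ e| ≤ C * e := by
  obtain ⟨C, hC, h⟩ := exists_bound_of_taylorCoeff_eq_zero (B := X) hX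
    (isCompact_closedBall ψ₀ 1) 0 fun ψ _ i hi => by
      rw [Nat.le_zero.1 hi, taylorCoeff_zero, h0]
  refine ⟨C, hC, fun ψ e hψ he => ?_⟩
  simpa using h ψ (by rwa [Metric.mem_closedBall, Real.dist_eq]) e he

/-- With `z = η ρ + e Y`, the displacement of `ρ` from the nullcline `z = 0` is about `z/η`, and
`∂_ρ g ≈ η lam`. So `g` equals its value on the nullcline plus `lam z`; replacing the nullcline by
its `J`-th iterate costs `O(e^(J+1))`. -/
theorem exists_linear_estimate (hη : η ≠ 0) (hY : Smooth3 Y) {g : ℝ → ℝ → ℝ → ℝ} (hg : Smooth3 g)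
    (J : ℕ) (ψ₀ : ℝ) {lam κ : ℝ} (hlam : deriv (fun ρ => g ρ ψ₀ 0) 0 = η * lam) (hκ : 0 < κ) :
    ∃ r C : ℝ, 0 < r ∧ 0 ≤ C ∧ ∀ ρ ψ e, |ρ| ≤ r → |ψ - ψ₀| ≤ r → 0 < e → e ≤ r →
      |g ρ ψ e - g (approxRoot η Y J ψ e) ψ e - lam * (η * ρ + e * Y ρ ψ e)|
        ≤ κ * |η * ρ + e * Y ρ ψ e| + C * e ^ (J + 1) := by
  have hη' : 0 < |η| := abs_pos.2 hη
  set κ₁ := κ * |η| / 4 with hκ₁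
  -- The first bound lets the variation of `e Y` be absorbed when `|ρ - ρ'|` is estimated by `|z|`;
  -- the second keeps its contribution to the final error below its share of `κ`.
  set κ₂ := min (|η| / 2) (κ * |η| / (4 * (|lam| + 1))) with hκ₂
  have hκ₁0 : 0 < κ₁ := by positivity
  have hκ₂0 : 0 < κ₂ := lt_min (by positivity) (by positivity)
  have hκ₂a : κ₂ ≤ |η| / 2 := min_le_left _ _
  have hκ₂b : |lam| * κ₂ ≤ κ * |η| / 4 := by
    have h1 : κ₂ ≤ κ * |η| / (4 * (|lam| + 1)) := min_le_right _ _
    rw [le_div_iff₀ (by positivity)] at h1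
    linarith
  have hZ : Smooth3 (fun ρ ψ e => e * Y ρ ψ e) := ContDiff.mul (by fun_prop) hY
  have hZ0 : deriv (fun x => (0 : ℝ) * Y x ψ₀ 0) 0 = 0 := by simp
  obtain ⟨r₁, hr₁, h₁⟩ := hg.exists_strict_estimate ψ₀ hκ₁0
  obtain ⟨r₂, hr₂, h₂⟩ := hZ.exists_strict_estimate ψ₀ hκ₂0
  rw [hlam] at h₁
  rw [hZ0] at h₂
  obtain ⟨C₁, hC₁, b₁⟩ := (approxRoot_smooth (η := η) hY J).exists_bound_of_zero
    (approxRoot_zero_right J) ψ₀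
  obtain ⟨C₂, hC₂, b₂⟩ := exists_bound_approxRoot_sub (η := η) hY J ψ₀
  set r₀ := min 1 (min r₁ r₂) with hr₀
  have hr₀0 : 0 < r₀ := lt_min one_pos (lt_min hr₁ hr₂)
  -- For `e ≤ r` the approximate root, of size at most `C₁ e`, stays within `r₀`.
  set r := r₀ / (C₁ + 1) with hr
  have hr0 : 0 < r := by positivity
  have hrr : r ≤ r₀ := div_le_self hr₀0.le (by linarith)
  have hCr : C₁ * r ≤ r₀ := by
    rw [hr, mul_div_assoc', div_le_iff₀ (by positivity)]; nlinarith
  have hr₀1 : r₀ ≤ 1 := min_le_left _ _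
  have hr₀r₁ : r₀ ≤ r₁ := (min_le_right _ _).trans (min_le_left _ _)
  have hr₀r₂ : r₀ ≤ r₂ := (min_le_right _ _).trans (min_le_right _ _)
  refine ⟨r, (κ + |lam|) * (|η| * C₂), hr0, by positivity, fun ρ ψ e hρ hψ he her => ?_⟩
  set ρ' := approxRoot η Y J ψ e with hρ'
  have hemem : e ∈ Set.Icc (0 : ℝ) 1 := ⟨he.le, her.trans (hrr.trans hr₀1)⟩
  have hψ1 : |ψ - ψ₀| ≤ 1 := hψ.trans (hrr.trans hr₀1)
  have hρ'r : |ρ'| ≤ r₀ := (b₁ ψ e hψ1 hemem).trans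
    ((mul_le_mul_of_nonneg_left her hC₁).trans hCr)
  have heabs : |e| ≤ r₀ := by rw [abs_of_pos he]; exact her.trans hrr
  have k₁ := h₁ ρ ρ' ψ e ((hρ.trans hrr).trans hr₀r₁) (hρ'r.trans hr₀r₁)
    ((hψ.trans hrr).trans hr₀r₁) (heabs.trans hr₀r₁)
  have k₂ := h₂ ρ ρ' ψ e ((hρ.trans hrr).trans hr₀r₂) (hρ'r.trans hr₀r₂)
    ((hψ.trans hrr).trans hr₀r₂) (heabs.trans hr₀r₂)
  rw [zero_mul, sub_zero] at k₂
  -- The residual of the `J`-th iterate is `-η` times the next increment.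
  have k₃ : |η * ρ' + e * Y ρ' ψ e| ≤ |η| * C₂ * e ^ (J + 1) := by
    have h3 : η * ρ' + e * Y ρ' ψ e = -(η * (approxRoot η Y (J + 1) ψ e - ρ')) := by
      simp only [approxRoot, hρ']; field_simp; ring
    rw [h3, abs_neg, abs_mul, mul_assoc]
    exact mul_le_mul_of_nonneg_left (b₂ ψ e hψ1 hemem) hη'.le
  set z := η * ρ + e * Y ρ ψ e with hz
  set E₀ := η * ρ' + e * Y ρ' ψ e with hE₀
  set E₁ := e * Y ρ ψ e - e * Y ρ' ψ e with hE₁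
  set Δ := ρ - ρ' with hΔ
  have hzeq : z = η * Δ + E₁ + E₀ := by rw [hz, hE₀, hE₁, hΔ]; ring
  have hΔle : |η| * |Δ| ≤ 2 * (|z| + |E₀|) := by
    have h4 : η * Δ = z - E₁ - E₀ := by rw [hzeq]; ring
    have h5 : |η| * |Δ| ≤ |z| + |E₁| + |E₀| := by
      rw [← abs_mul, h4]
      exact (abs_sub _ _).trans (by linarith [abs_sub z E₁])
    have h6 : κ₂ * |Δ| ≤ |η| / 2 * |Δ| := mul_le_mul_of_nonneg_right hκ₂a (abs_nonneg _)
    linarith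
  have h7 : g ρ ψ e - g ρ' ψ e - lam * z
      = (g ρ ψ e - g ρ' ψ e - η * lam * Δ) - lam * E₁ - lam * E₀ := by rw [hzeq]; ring
  have h8 : |g ρ ψ e - g ρ' ψ e - lam * z| ≤ κ₁ * |Δ| + |lam| * (κ₂ * |Δ|) + |lam| * |E₀| := by
    rw [h7]
    refine (abs_sub _ _).trans (add_le_add ((abs_sub _ _).trans (add_le_add k₁ ?_)) ?_)
    · rw [abs_mul]; exact mul_le_mul_of_nonneg_left k₂ (abs_nonneg _)
    · rw [abs_mul]
  have h9 : κ₁ * |Δ| + |lam| * (κ₂ * |Δ|) ≤ κ * (|z| + |E₀|) := by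
    have := mul_le_mul_of_nonneg_right hκ₂b (abs_nonneg Δ)
    have := mul_le_mul_of_nonneg_left hΔle hκ.le
    rw [hκ₁]; linarith
  have h10 := mul_le_mul_of_nonneg_left k₃ (by positivity : 0 ≤ κ + |lam|)
  linarith

end approxRoot

/-- The potential `-∫_{ψ₀}^ψ P(s, e) ds`. -/
def potential (P : ℝ → ℝ → ℝ) (ψ₀ ψ e : ℝ) : ℝ := -∫ s in (0 : ℝ)..(ψ - ψ₀), P (ψ₀ + s) e

section potential

variable {P : ℝ → ℝ → ℝ} {ψ₀ : ℝ}

theorem potential_smooth (hP : Smooth2 P) : Smooth2 (potential P ψ₀) := by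
  have h1 := ContDiff.primitive_param (E := ℝ) (H := fun z : ℝ × ℝ => P (ψ₀ + z.2) z.1)
    (hP.comp (by fun_prop) (by fun_prop))
  exact (h1.comp (by fun_prop : ContDiff ℝ ∞ fun p : ℝ × ℝ => (p.2, p.1 - ψ₀))).neg

theorem potential_hasDerivAt (hP : Smooth2 P) (ψ e : ℝ) :
    HasDerivAt (fun ψ => potential P ψ₀ ψ e) (-P ψ e) ψ := by
  have hc : Continuous fun s => P (ψ₀ + s) e :=
    hP.continuous.comp (by fun_prop : Continuous fun s : ℝ => (ψ₀ + s, e))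
  have h1 : HasDerivAt (fun u => ∫ s in (0 : ℝ)..u, P (ψ₀ + s) e) (P (ψ₀ + (ψ - ψ₀)) e) (ψ - ψ₀) :=
    intervalIntegral.integral_hasDerivAt_right (hc.intervalIntegrable _ _)
      hc.stronglyMeasurable.stronglyMeasurableAtFilter hc.continuousAt
  have h2 := (h1.comp ψ ((hasDerivAt_id' ψ).sub_const ψ₀)).fun_neg
  simpa [potential, Function.comp_def] using h2

theorem potential_eq (P : ℝ → ℝ → ℝ) (ψ₀ ψ e : ℝ) :
    potential P ψ₀ ψ e
      = ∫ s in (0 : ℝ)..1, -((ψ - ψ₀) * P (ψ₀ + (ψ - ψ₀) * s) e) := by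
  have := intervalIntegral.mul_integral_comp_mul_left (a := 0) (b := 1)
    (f := fun s => P (ψ₀ + s) e) (ψ - ψ₀)
  rw [mul_zero, mul_one] at this
  rw [potential, ← this, intervalIntegral.integral_neg, intervalIntegral.integral_const_mul]

/-- Near `(ψ₀, 0)` one has `P = -b (ψ - ψ₀)` up to a small multiple of `|ψ - ψ₀|` and `O(e)`.
Integrating this shows that the potential has a quadratic well, the minimum being displaced by
effects of size `e` only. -/
theorem exists_potential_estimate (hP : Smooth2 P) {b : ℝ} (hb : 0 < b) (h0 : P ψ₀ 0 = 0)
    (hd : deriv (fun ψ => P ψ 0) ψ₀ = -b) :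
    ∃ r C : ℝ, 0 < r ∧ r ≤ 1 ∧ 0 ≤ C ∧ ∀ ψ e, |ψ - ψ₀| ≤ r → e ∈ Set.Icc (0 : ℝ) 1 →
      b / 2 * (ψ - ψ₀) ^ 2 - C * e ≤ -(P ψ e * (ψ - ψ₀)) ∧
      b / 4 * (ψ - ψ₀) ^ 2 - C * e ≤ potential P ψ₀ ψ e ∧
      potential P ψ₀ ψ e ≤ C * ((ψ - ψ₀) ^ 2 + e) ∧ |P ψ e| ≤ C ∧ |potential P ψ₀ ψ e| ≤ C ∧
      |deriv (fun e => potential P ψ₀ ψ e) e| ≤ C := by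
  obtain ⟨C₁, hC₁, b₁⟩ := Smooth2.exists_bound_of_zero (X := fun ψ e => P ψ e - P ψ 0)
    (ContDiff.sub hP (hP.comp contDiff_fst contDiff_const)) (fun ψ => sub_self _) ψ₀
  have hK : IsCompact (Metric.closedBall ψ₀ 1 ×ˢ Set.Icc (0 : ℝ) 1) :=
    (isCompact_closedBall ψ₀ 1).prod isCompact_Icc
  obtain ⟨C₂, b₂⟩ := hK.exists_bound_of_continuousOn hP.continuous.continuousOn
  obtain ⟨C₃, b₃⟩ := hK.exists_bound_of_continuousOn
    (potential_smooth (ψ₀ := ψ₀) hP).continuous.continuousOn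
  obtain ⟨C₄, b₄⟩ := hK.exists_bound_of_continuousOn
    (potential_smooth (ψ₀ := ψ₀) hP).deriv₂.continuous.continuousOn
  have hPd : HasDerivAt (fun ψ => P ψ 0) (-b) ψ₀ := by
    rw [← hd]
    have h1 : ContDiff ℝ ∞ fun ψ => P ψ 0 := hP.comp contDiff_id contDiff_const
    exact (h1.differentiable (by simp) ψ₀).hasDerivAt
  obtain ⟨r, hr, hrb⟩ := Metric.eventually_nhds_iff_ball.1
    ((hasDerivAt_iff_isLittleO.1 hPd).def (half_pos hb))
  set C := C₁ + |C₂| + |C₃| + |C₄| + 3 * b / 2 with hC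
  have n₂ := abs_nonneg C₂
  have n₃ := abs_nonneg C₃
  have n₄ := abs_nonneg C₄
  have hlin : ∀ ψ e, |ψ - ψ₀| ≤ min 1 (r / 2) → e ∈ Set.Icc (0 : ℝ) 1 →
      |P ψ e + b * (ψ - ψ₀)| ≤ b / 2 * |ψ - ψ₀| + C₁ * e := fun ψ e hψ he => by
    have h1 := hrb ψ (by
      rw [Metric.mem_ball, Real.dist_eq]
      exact (hψ.trans (min_le_right _ _)).trans_lt (half_lt_self hr))
    rw [h0, sub_zero, smul_eq_mul, Real.norm_eq_abs, Real.norm_eq_abs] at h1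
    have h2 := b₁ ψ e (hψ.trans (min_le_left _ _)) he
    have h3 : P ψ e + b * (ψ - ψ₀) = (P ψ 0 - (ψ - ψ₀) * -b) + (P ψ e - P ψ 0) := by ring
    rw [h3]
    exact (abs_add_le _ _).trans (add_le_add h1 h2)
  -- Bounds for the integrand of `potential_eq` on the segment from `ψ₀` to `ψ`. The factor `s`
  -- integrates to `1/2`, which gives `b/4`; the value `s = 1` gives the bound on the force itself.
  have hmain : ∀ ψ e s, |ψ - ψ₀| ≤ min 1 (r / 2) → e ∈ Set.Icc (0 : ℝ) 1 → s ∈ Set.Icc (0 : ℝ) 1 →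
      b / 2 * (ψ - ψ₀) ^ 2 * s - C₁ * e ≤ -((ψ - ψ₀) * P (ψ₀ + (ψ - ψ₀) * s) e) ∧
      -((ψ - ψ₀) * P (ψ₀ + (ψ - ψ₀) * s) e) ≤ 3 * b / 2 * (ψ - ψ₀) ^ 2 + C₁ * e := by
    intro ψ e s hψ he hs
    set p := ψ - ψ₀ with hp
    have hp1 : |p| ≤ 1 := hψ.trans (min_le_left _ _)
    have hps : |ψ₀ + p * s - ψ₀| ≤ min 1 (r / 2) := by
      rw [add_sub_cancel_left, abs_mul, abs_of_nonneg hs.1]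
      exact (mul_le_of_le_one_right (abs_nonneg _) hs.2).trans hψ
    have h1 := hlin (ψ₀ + p * s) e hps he
    rw [add_sub_cancel_left, abs_mul p s, abs_of_nonneg hs.1] at h1
    set A := P (ψ₀ + p * s) e
    have h2 : |p * (A + b * (p * s))| ≤ b / 2 * (p ^ 2 * s) + C₁ * e := by
      rw [abs_mul]
      have h3 := mul_le_mul_of_nonneg_left h1 (abs_nonneg p)
      have h4 : |p| * (C₁ * e) ≤ 1 * (C₁ * e) :=
        mul_le_mul_of_nonneg_right hp1 (mul_nonneg hC₁ he.1)
      have h5 : |p| * |p| = p ^ 2 := by rw [← sq, sq_abs]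
      have h6 : |p| * (b / 2 * (|p| * s) + C₁ * e) = b / 2 * ((|p| * |p|) * s) + |p| * (C₁ * e) := by
        ring
      rw [h6, h5] at h3
      linarith
    have h3 := abs_le.1 h2
    have h4 : p ^ 2 * s ≤ p ^ 2 := mul_le_of_le_one_right (sq_nonneg p) hs.2
    have h5 := mul_le_mul_of_nonneg_left h4 hb.le
    constructor <;> linarith [h3.1, h3.2]
  refine ⟨min 1 (r / 2), C, lt_min one_pos (half_pos hr), min_le_left _ _, by positivity,
    fun ψ e hψ he => ?_⟩
  have hψ1 : ψ ∈ Metric.closedBall ψ₀ 1 := by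
    rw [Metric.mem_closedBall, Real.dist_eq]; exact hψ.trans (min_le_left _ _)
  have hCe : C₁ * e ≤ C * e := mul_le_mul_of_nonneg_right (by rw [hC]; linarith) he.1
  have hc : Continuous fun s => -((ψ - ψ₀) * P (ψ₀ + (ψ - ψ₀) * s) e) :=
    (continuous_const.mul (hP.continuous.comp
      (by fun_prop : Continuous fun s : ℝ => (ψ₀ + (ψ - ψ₀) * s, e)))).neg
  refine ⟨?_, ?_, ?_, ?_, ?_, ?_⟩
  · have := (hmain ψ e 1 hψ he ⟨zero_le_one, le_rfl⟩).1
    rw [mul_one, mul_one, add_sub_cancel, mul_comm (ψ - ψ₀) (P _ _)] at this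
    linarith
  · rw [potential_eq]
    have h1 : ∫ s in (0 : ℝ)..1, (b / 2 * (ψ - ψ₀) ^ 2 * s - C₁ * e)
        = b / 4 * (ψ - ψ₀) ^ 2 - C₁ * e := by
      rw [intervalIntegral.integral_sub ((by fun_prop : Continuous _).intervalIntegrable _ _)
          intervalIntegrable_const,
        intervalIntegral.integral_const_mul, integral_id, intervalIntegral.integral_const]
      simp only [smul_eq_mul]; ring
    have h2 := intervalIntegral.integral_mono_on (μ := MeasureTheory.volume) zero_le_one
      ((by fun_prop : Continuous fun s : ℝ => b / 2 * (ψ - ψ₀) ^ 2 * s - C₁ * e).intervalIntegrable 0 1)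
      (hc.intervalIntegrable 0 1) fun s hs => (hmain ψ e s hψ he hs).1
    rw [h1] at h2
    linarith
  · rw [potential_eq]
    have h2 := intervalIntegral.integral_mono_on (μ := MeasureTheory.volume) zero_le_one
      (hc.intervalIntegrable 0 1)
      (intervalIntegrable_const (c := 3 * b / 2 * (ψ - ψ₀) ^ 2 + C₁ * e))
      fun s hs => (hmain ψ e s hψ he hs).2
    rw [intervalIntegral.integral_const, smul_eq_mul, sub_zero, one_mul] at h2
    have h3 : 3 * b / 2 * (ψ - ψ₀) ^ 2 ≤ C * (ψ - ψ₀) ^ 2 :=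
      mul_le_mul_of_nonneg_right (by rw [hC]; linarith) (sq_nonneg _)
    linarith
  · exact (b₂ (ψ, e) ⟨hψ1, he⟩).trans (by rw [hC]; linarith [le_abs_self C₂])
  · exact (b₃ (ψ, e) ⟨hψ1, he⟩).trans (by rw [hC]; linarith [le_abs_self C₃])
  · exact (b₄ (ψ, e) ⟨hψ1, he⟩).trans (by rw [hC]; linarith [le_abs_self C₄])

end potential

/-! ### The rescaled phase velocity and its drift -/

/-- The rescaled phase velocity `η ρ + e^(m-1) H(ρ, ψ, e)`. -/
def phaseVel (η : ℝ) (m : ℕ) (H : ℝ → ℝ → ℝ → ℝ) (ρ ψ e : ℝ) : ℝ :=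
  η * ρ + e * (e ^ (m - 2) * H ρ ψ e)

/-- The leading part of the drift of the phase velocity, divided by `e^n`. -/
def phaseDrift (η : ℝ) (m j : ℕ) (k : ℝ) (A H : ℝ → ℝ → ℝ → ℝ) (ρ ψ e : ℝ) : ℝ :=
  deriv (fun ρ => phaseVel η m H ρ ψ e) ρ * A ρ ψ e
    - k * e ^ (j + 1) * deriv (fun e => phaseVel η m H ρ ψ e) e

section phaseVel

variable {η : ℝ} {m : ℕ} {A H : ℝ → ℝ → ℝ → ℝ}

theorem phaseVel_smooth (hH : Smooth3 H) : Smooth3 (phaseVel η m H) :=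
  ContDiff.add (by fun_prop) (ContDiff.mul (by fun_prop) (ContDiff.mul (by fun_prop) hH))

theorem phaseVel_deriv₂ (ρ ψ e : ℝ) (hm : 2 ≤ m) :
    e * deriv (fun ψ => phaseVel η m H ρ ψ e) ψ = e ^ m * deriv (fun ψ => H ρ ψ e) ψ := by
  obtain ⟨i, rfl⟩ := Nat.exists_eq_add_of_le' hm
  simp only [phaseVel, deriv_const_add', deriv_const_mul_field', Nat.add_sub_cancel]
  ring

theorem phaseDrift_smooth (hA : Smooth3 A) (hH : Smooth3 H) (j : ℕ) (k : ℝ) :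
    Smooth3 (phaseDrift η m j k A H) :=
  ContDiff.sub (ContDiff.mul (phaseVel_smooth hH).deriv₁ hA)
    (ContDiff.mul (by fun_prop) (phaseVel_smooth hH).deriv₃)

theorem phaseDrift_zero (j : ℕ) (k ρ ψ : ℝ) : phaseDrift η m j k A H ρ ψ 0 = η * A ρ ψ 0 := by
  simp [phaseDrift, phaseVel]

/-- `P` is the drift restricted to the approximate nullcline, hence a function of `(ψ, e)` alone,
equal to `η A(0, ψ, 0)` at `e = 0`. Leaving the nullcline adds `e^n lam z`, and the `ψ`-dependence
of the velocity adds `e^m om z`; together these are `e^ℓ d z` to leading order. The tolerance `d/8`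
is split into three parts `d/24`. -/
theorem exists_drift_estimate (hη : η ≠ 0) (hA : Smooth3 A) (hH : Smooth3 H) (j J : ℕ)
    {n ℓ : ℕ} (hℓn : ℓ ≤ n) (hℓm : ℓ ≤ m) (k : ℝ) {ψ₀ lam om nu d : ℝ} (hA0 : A 0 ψ₀ 0 = 0)
    (hlam : deriv (fun ρ => A ρ ψ₀ 0) 0 = lam) (hnu : deriv (fun ψ => A 0 ψ 0) ψ₀ = nu)
    (hom : deriv (fun ψ => H 0 ψ 0) ψ₀ = om) (hd : 0 < d)
    (hlead : ∀ κ : ℝ, 0 < κ → ∃ r : ℝ, 0 < r ∧ ∀ e, 0 < e → e ≤ r →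
      |e ^ n * lam + e ^ m * om - e ^ ℓ * d| ≤ κ * e ^ ℓ) :
    ∃ P : ℝ → ℝ → ℝ, Smooth2 P ∧ P ψ₀ 0 = 0 ∧ deriv (fun ψ => P ψ 0) ψ₀ = η * nu ∧
      ∃ r C : ℝ, 0 < r ∧ 0 ≤ C ∧ ∀ ρ ψ e, |ρ| ≤ r → |ψ - ψ₀| ≤ r → 0 < e → e ≤ r →
        |e ^ n * phaseDrift η m j k A H ρ ψ e
            + e ^ m * deriv (fun ψ => H ρ ψ e) ψ * phaseVel η m H ρ ψ e
            - e ^ n * P ψ e - e ^ ℓ * d * phaseVel η m H ρ ψ e|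
          ≤ d / 8 * e ^ ℓ * |phaseVel η m H ρ ψ e| + C * e ^ (n + (J + 1)) := by
  have hκ : 0 < d / 24 := by positivity
  set Y : ℝ → ℝ → ℝ → ℝ := fun ρ ψ e => e ^ (m - 2) * H ρ ψ e with hYdef
  have hY : Smooth3 Y := ContDiff.mul (by fun_prop) hH
  have hg := phaseDrift_smooth (η := η) (m := m) hA hH j k
  have hP0 : ∀ ψ, phaseDrift η m j k A H (approxRoot η Y J ψ 0) ψ 0 = η * A 0 ψ 0 := fun ψ => by
    rw [phaseDrift_zero, approxRoot_zero_right]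
  refine ⟨fun ψ e => phaseDrift η m j k A H (approxRoot η Y J ψ e) ψ e,
    hg.comp (approxRoot_smooth hY J) contDiff_fst contDiff_snd, ?_, ?_, ?_⟩
  · exact (hP0 ψ₀).trans (by rw [hA0, mul_zero])
  · simp only [hP0, deriv_const_mul_field', hnu]
  obtain ⟨r₁, C₁, hr₁, hC₁, h₁⟩ := exists_linear_estimate hη hY hg J ψ₀ (lam := lam) (by
    simp only [phaseDrift_zero, deriv_const_mul_field', hlam]) hκ
  obtain ⟨r₂, hr₂, h₂⟩ := hlead _ hκ
  have hc : Continuous fun p : ℝ × ℝ × ℝ => deriv (fun ψ => H p.1 ψ p.2.2) p.2.1 :=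
    hH.deriv₂.continuous
  obtain ⟨r₃, hr₃, h₃⟩ := Metric.continuous_iff.1 hc (0, ψ₀, 0) _ hκ
  refine ⟨min (min r₁ r₂) (min (r₃ / 2) 1), C₁,
    lt_min (lt_min hr₁ hr₂) (lt_min (half_pos hr₃) one_pos), hC₁, fun ρ ψ e hρ hψ he her => ?_⟩
  have i₁ : min (min r₁ r₂) (min (r₃ / 2) 1) ≤ r₁ := (min_le_left _ _).trans (min_le_left _ _)
  have i₂ : min (min r₁ r₂) (min (r₃ / 2) 1) ≤ r₂ := (min_le_left _ _).trans (min_le_right _ _)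
  have i₃ : min (min r₁ r₂) (min (r₃ / 2) 1) ≤ r₃ / 2 :=
    (min_le_right _ _).trans (min_le_left _ _)
  have i₄ : min (min r₁ r₂) (min (r₃ / 2) 1) ≤ 1 := (min_le_right _ _).trans (min_le_right _ _)
  have k₁ := h₁ ρ ψ e (hρ.trans i₁) (hψ.trans i₁) he (her.trans i₁)
  have k₂ := h₂ e he (her.trans i₂)
  have k₃ := h₃ (ρ, ψ, e) (by
    rw [Prod.dist_eq, Prod.dist_eq, max_lt_iff, max_lt_iff]
    simp only [Real.dist_eq, sub_zero, abs_of_pos he]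
    exact ⟨by linarith, by linarith, by linarith⟩)
  rw [Real.dist_eq] at k₃
  simp only [hom] at k₃
  change |phaseDrift η m j k A H ρ ψ e - phaseDrift η m j k A H (approxRoot η Y J ψ e) ψ e
    - lam * phaseVel η m H ρ ψ e| ≤ d / 24 * |phaseVel η m H ρ ψ e| + C₁ * e ^ (J + 1) at k₁
  set z := phaseVel η m H ρ ψ e
  set g := phaseDrift η m j k A H ρ ψ e
  set P := phaseDrift η m j k A H (approxRoot η Y J ψ e) ψ e
  set h := deriv (fun ψ => H ρ ψ e) ψ
  have hpn : e ^ n ≤ e ^ ℓ := pow_le_pow_of_le_one he.le (her.trans i₄) hℓn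
  have hpm : e ^ m ≤ e ^ ℓ := pow_le_pow_of_le_one he.le (her.trans i₄) hℓm
  have split : e ^ n * g + e ^ m * h * z - e ^ n * P - e ^ ℓ * d * z
      = e ^ n * (g - P - lam * z) + e ^ m * ((h - om) * z)
        + (e ^ n * lam + e ^ m * om - e ^ ℓ * d) * z := by ring
  rw [split]
  have s₁ : |e ^ n * (g - P - lam * z)| ≤ e ^ ℓ * (d / 24 * |z|) + C₁ * e ^ (n + (J + 1)) := by
    rw [abs_mul, abs_of_pos (pow_pos he n)]
    have h1 := mul_le_mul_of_nonneg_left k₁ (pow_pos he n).le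
    have h2 := mul_le_mul_of_nonneg_right hpn (by positivity : 0 ≤ d / 24 * |z|)
    rw [pow_add]
    linarith
  have s₂ : |e ^ m * ((h - om) * z)| ≤ e ^ ℓ * (d / 24 * |z|) := by
    rw [abs_mul, abs_of_pos (pow_pos he m), abs_mul]
    exact mul_le_mul hpm (mul_le_mul_of_nonneg_right k₃.le (abs_nonneg _)) (by positivity)
      (by positivity)
  have s₃ : |(e ^ n * lam + e ^ m * om - e ^ ℓ * d) * z| ≤ d / 24 * e ^ ℓ * |z| := by
    rw [abs_mul]; exact mul_le_mul_of_nonneg_right k₂ (abs_nonneg _)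
  refine (abs_add_le _ _).trans ((add_le_add ((abs_add_le _ _).trans (add_le_add s₁ s₂)) s₃).trans
    (le_of_eq ?_))
  ring

end phaseVel

theorem exists_pow_mul_le {e₀ κ : ℝ} (c : ℝ) (hκ : 0 < κ) (he₀ : 0 < e₀) :
    ∃ r : ℝ, 0 < r ∧ r ≤ e₀ ∧ ∀ e, 0 < e → e ≤ r → |e * c| ≤ κ := by
  refine ⟨min e₀ (κ / (|c| + 1)), lt_min he₀ (by positivity), min_le_left _ _, fun e he her => ?_⟩
  have h1 := her.trans (min_le_right _ _)
  rw [le_div_iff₀ (by positivity)] at h1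
  rw [abs_mul, abs_of_pos he]
  linarith

namespace OscSystem

/-- Of the two powers the higher one is negligible as `e → 0`; for `n = m` the identity is exact. -/
theorem exists_leading_bound (D : OscSystem) (n m : ℕ) (ψ₀ : ℝ) {κ : ℝ} (hκ : 0 < κ) :
    ∃ r : ℝ, 0 < r ∧ ∀ e, 0 < e → e ≤ r →
      |e ^ n * D.lam n ψ₀ + e ^ m * D.om m ψ₀ - e ^ min m n * D.dnm n m ψ₀|
        ≤ κ * e ^ min m n := by
  have main : ∀ {i j : ℕ} (c : ℝ), i < j → ∃ r : ℝ, 0 < r ∧ ∀ e, 0 < e → e ≤ r →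
      |e ^ j * c| ≤ κ * e ^ i := fun {i j} c hij => by
    obtain ⟨r, hr, hr1, h⟩ := exists_pow_mul_le c hκ one_pos
    refine ⟨r, hr, fun e he her => ?_⟩
    obtain ⟨l, rfl⟩ : ∃ l, j = i + l + 1 := ⟨j - i - 1, by omega⟩
    have h1 := h e he her
    have h2 : e ^ l ≤ 1 := pow_le_one₀ he.le (her.trans hr1)
    have h3 : e ^ (i + l + 1) * c = e ^ i * (e ^ l * (e * c)) := by ring
    rw [h3, abs_mul, abs_mul, abs_of_pos (pow_pos he i), abs_of_pos (pow_pos he l), mul_comm κ]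
    refine mul_le_mul_of_nonneg_left ?_ (pow_pos he i).le
    calc e ^ l * |e * c| ≤ 1 * κ := mul_le_mul h2 h1 (abs_nonneg _) zero_le_one
      _ = κ := one_mul κ
  rcases lt_trichotomy n m with h | h | h
  · obtain ⟨r, hr, hb⟩ := main (D.om m ψ₀) h
    refine ⟨r, hr, fun e he her => ?_⟩
    rw [dnm, if_pos h, min_eq_right h.le, add_sub_cancel_left]
    exact hb e he her
  · refine ⟨1, one_pos, fun e he her => ?_⟩
    rw [dnm, if_neg h.not_lt, if_pos h, h, min_self]
    rw [show e ^ m * D.lam m ψ₀ + e ^ m * D.om m ψ₀ - e ^ m * (D.lam m ψ₀ + D.om m ψ₀) = 0 by ring,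
      abs_zero]
    positivity
  · obtain ⟨r, hr, hb⟩ := main (D.lam n ψ₀) h
    refine ⟨r, hr, fun e he her => ?_⟩
    rw [dnm, if_neg h.not_gt, if_neg h.ne', min_eq_left h.le, add_sub_cancel_right]
    exact hb e he her

end OscSystem

/-! ### Instability of the averaged system -/

/-- The cross term is dominated by the energy: `B² ≤ X` and `c² ≤ b/4` leave half of the potential
well after completing the square. -/
theorem lyapunov_bounds {X B e z p V b c C : ℝ} (hX : 0 ≤ X) (hBX : B ^ 2 ≤ X)
    (hcb : c ^ 2 ≤ b / 4) (hC : 0 ≤ C) (hV₁ : b / 2 * p ^ 2 - C * e ≤ V)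
    (hV₂ : V ≤ C * (p ^ 2 + e)) :
    b / 4 * X * p ^ 2 - C * (X * e) ≤ z ^ 2 / 2 + X * V - c * B * (z * p) ∧
      z ^ 2 / 2 + X * V - c * B * (z * p) ≤ (C + 1 + c ^ 2) * (z ^ 2 + X * p ^ 2) + C * (X * e) := by
  have h1 := mul_le_mul_of_nonneg_left hV₁ hX
  have h2 := mul_le_mul_of_nonneg_left hV₂ hX
  have h3 : c ^ 2 * p ^ 2 * B ^ 2 ≤ c ^ 2 * p ^ 2 * X := mul_le_mul_of_nonneg_left hBX (by positivity)
  have h4 : c ^ 2 * (p ^ 2 * X) ≤ b / 4 * (p ^ 2 * X) :=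
    mul_le_mul_of_nonneg_right hcb (by positivity)
  have h5 := sq_nonneg (z / 2 - c * B * p)
  have h6 := sq_nonneg (z / 2 + c * B * p)
  have h7 : 0 ≤ (C + c ^ 2) * z ^ 2 := by positivity
  have h8 : 0 ≤ X * p ^ 2 := by positivity
  have h9 := sq_nonneg z
  have h10 : (z / 2 - c * B * p) ^ 2 = z ^ 2 / 4 - c * B * (z * p) + c ^ 2 * p ^ 2 * B ^ 2 := by ring
  have h11 : (z / 2 + c * B * p) ^ 2 = z ^ 2 / 4 + c * B * (z * p) + c ^ 2 * p ^ 2 * B ^ 2 := by ring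
  constructor <;> linarith

/-- `∑_{k=n}^N e^(k-n) X_k(ρ, ψ)`. -/
def seriesFrom (n N : ℕ) (X : ℕ → ℝ → ℝ → ℝ) (ρ ψ e : ℝ) : ℝ :=
  ∑ k ∈ Finset.Icc n N, e ^ (k - n) * X k ρ ψ

section seriesFrom

variable {n N : ℕ} {X : ℕ → ℝ → ℝ → ℝ}

theorem seriesFrom_smooth (hX : ∀ k, Smooth2 (X k)) : Smooth3 (seriesFrom n N X) :=
  ContDiff.sum fun k _ => ContDiff.mul (by fun_prop) ((hX k).comp contDiff_fst (by fun_prop))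

theorem seriesFrom_zero (hN : n ≤ N) (ρ ψ : ℝ) : seriesFrom n N X ρ ψ 0 = X n ρ ψ := by
  rw [seriesFrom, Finset.sum_eq_single n]
  · simp
  · intro k hk hkn
    rw [zero_pow (by have := (Finset.mem_Icc.1 hk).1; omega), zero_mul]
  · intro h
    exact absurd (Finset.mem_Icc.2 ⟨le_rfl, hN⟩) h

theorem pow_mul_seriesFrom (ρ ψ e : ℝ) :
    e ^ n * seriesFrom n N X ρ ψ e = ∑ k ∈ Finset.Icc n N, e ^ k * X k ρ ψ := by
  rw [seriesFrom, Finset.mul_sum]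
  refine Finset.sum_congr rfl fun k hk => ?_
  rw [← mul_assoc, ← pow_add, Nat.add_sub_cancel' (Finset.mem_Icc.1 hk).1]

end seriesFrom

/-! ### The truncated averaged system in powers of the small parameter -/

namespace OscSystem

variable {D : OscSystem} {n m : ℕ}

theorem LeadingOrders.sum_Lam (h : D.LeadingOrders n m) (N : ℕ) (ρ ψ e : ℝ) :
    ∑ k ∈ Finset.Icc 1 N, e ^ k * D.Lam k ρ ψ = e ^ n * seriesFrom n N D.Lam ρ ψ e := by
  rw [pow_mul_seriesFrom]
  refine (Finset.sum_subset (Finset.Icc_subset_Icc_left h.n_mem.1) fun k hk hk' => ?_).symm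
  have h1 := Finset.mem_Icc.1 hk
  rw [h.Lam_zero k h1.1 (by by_contra hlt; exact hk' (Finset.mem_Icc.2 ⟨by omega, h1.2⟩)), mul_zero]

theorem LeadingOrders.sum_Om (h : D.LeadingOrders n m) (hD : D.Valid) {N : ℕ} (hN : 1 ≤ N)
    (ρ ψ e : ℝ) : ∑ k ∈ Finset.Icc 1 N, e ^ k * D.Om k ρ ψ
      = e * phaseVel D.eta m (seriesFrom m N D.Om) ρ ψ e := by
  have hm := h.m_mem.1
  have h0 : e ^ m * seriesFrom m N D.Om ρ ψ e = ∑ k ∈ Finset.Icc 2 N, e ^ k * D.Om k ρ ψ := by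
    rw [pow_mul_seriesFrom]
    refine Finset.sum_subset (Finset.Icc_subset_Icc_left hm) fun k hk hk' => ?_
    have h1 := Finset.mem_Icc.1 hk
    rw [h.Om_zero k (by omega) (by by_contra hlt; exact hk' (Finset.mem_Icc.2 ⟨by omega, h1.2⟩)),
      mul_zero]
  rw [← Finset.add_sum_Ioc_eq_sum_Icc hN, ← Finset.Icc_add_one_left_eq_Ioc,
    show 1 + 1 = 2 from rfl, ← h0, hD.Om_one, phaseVel]
  obtain ⟨i, rfl⟩ := Nat.exists_eq_add_of_le' hm
  rw [Nat.add_sub_cancel]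
  ring

theorem LeadingOrders.LamHat_eq (h : D.LeadingOrders n m) (N : ℕ) (ρ ψ : ℝ) {t : ℝ} (ht : 0 < t) :
    D.LamHat N ρ ψ t = D.eps t ^ n * seriesFrom n N D.Lam ρ ψ (D.eps t) := by
  rw [← h.sum_Lam, LamHat]
  exact Finset.sum_congr rfl fun k _ => by rw [D.eps_pow ht]

theorem LeadingOrders.OmHat_eq (h : D.LeadingOrders n m) (hD : D.Valid) {N : ℕ} (hN : 1 ≤ N)
    (ρ ψ : ℝ) {t : ℝ} (ht : 0 < t) :
    D.OmHat N ρ ψ t = D.eps t * phaseVel D.eta m (seriesFrom m N D.Om) ρ ψ (D.eps t) := by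
  rw [← h.sum_Om hD hN, OmHat]
  exact Finset.sum_congr rfl fun k _ => by rw [D.eps_pow ht]

theorem eps_pow_hasDerivAt (hD : D.Valid) {t : ℝ} (ht : 0 < t) (k : ℕ) :
    HasDerivAt (fun t => D.eps t ^ k)
      (-((k : ℝ) / (2 * D.q) * (D.eps t ^ k * D.eps t ^ (2 * D.q)))) t := by
  refine ((eps_hasDerivAt hD ht).fun_pow k).congr_deriv ?_
  cases k with
  | zero => simp
  | succ k => rw [Nat.add_sub_cancel]; ring

/-- `(ρ, ψ)` solves the truncated averaged system on `[t₁, t₂]` up to an error of order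
`C t^(-(N+1)/(2q))` and stays in the `r`-neighbourhood of `(0, ψ₀)`. -/
def IsApproxAveraged (D : OscSystem) (N : ℕ) (C ψ₀ r t₁ t₂ : ℝ) (ρ ψ : ℝ → ℝ) : Prop :=
  ∀ t ∈ Set.Icc t₁ t₂,
    (∃ x, HasDerivWithinAt ρ x (Set.Icc t₁ t₂) t ∧
      |x - D.LamHat N (ρ t) (ψ t) t| ≤ C * D.eps t ^ (N + 1)) ∧
    (∃ y, HasDerivWithinAt ψ y (Set.Icc t₁ t₂) t ∧
      |y - D.OmHat N (ρ t) (ψ t) t| ≤ C * D.eps t ^ (N + 1)) ∧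
    |ρ t| ≤ r ∧ |ψ t - ψ₀| ≤ r

-- The Lyapunov function for the negatively damped oscillator `ψ' = e z`, `z' ≈ e^n P + e^ℓ d z`.
-- The function and the constants `θ`, `r`, `b`, `K₀`, `γ` are fixed before the error constant `C`;
-- only `K` depends on it, which keeps the size of the neighbourhood independent of the averaging
-- error.
set_option maxHeartbeats 1000000 in
theorem Valid.exists_lyapunov (hD : D.Valid) (h : D.LeadingOrders n m) {ψ₀ : ℝ}
    (hψ₀ : D.Lam n 0 ψ₀ = 0) (hνη : D.nu n ψ₀ * D.eta < 0) (hd : 0 < D.dnm n m ψ₀)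
    (hℓ : min m n + n - 1 < 2 * D.q) {N : ℕ} (hN : 4 * D.q ≤ N) :
    ∃ (W : ℝ → ℝ → ℝ → ℝ) (θ : ℕ) (r b K₀ γ : ℝ), θ < 2 * D.q ∧ 0 < r ∧ r ≤ 1 ∧ 0 < b ∧ 0 ≤ K₀ ∧
      0 < γ ∧
      (∀ ρ ψ e, |ρ| ≤ r → |ψ - ψ₀| ≤ r → 0 < e → e ≤ r →
        b * e ^ (n - 1) * (ψ - ψ₀) ^ 2 - K₀ * e ^ n ≤ W ρ ψ e ∧ W ρ ψ e ≤ K₀) ∧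
      ∀ C : ℝ, 0 ≤ C → ∃ K : ℝ, 0 ≤ K ∧ ∀ t₁ t₂ : ℝ, ∀ ρ ψ : ℝ → ℝ, 1 ≤ t₁ → D.eps t₁ ≤ r →
        D.IsApproxAveraged N C ψ₀ r t₁ t₂ ρ ψ → ∀ t ∈ Set.Icc t₁ t₂, ∃ w : ℝ,
          HasDerivWithinAt (fun t => W (ρ t) (ψ t) (D.eps t)) w (Set.Icc t₁ t₂) t ∧
          γ * D.eps t ^ θ * (W (ρ t) (ψ t) (D.eps t) - K * D.eps t ^ n) ≤ w := by
  have hn1 := h.n_mem.1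
  have hn2 := h.n_mem.2
  have hm1 := h.m_mem.1
  have hm2 := h.m_mem.2
  have hq1 := hD.q_pos
  have hq := hD.q_cast_pos
  obtain ⟨ℓ, hℓdef⟩ : ∃ ℓ, ℓ = min m n := ⟨_, rfl⟩
  have hℓn : ℓ ≤ n := hℓdef ▸ min_le_right _ _
  have hℓm : ℓ ≤ m := hℓdef ▸ min_le_left _ _
  have hℓ1 : 1 ≤ ℓ := by rw [hℓdef]; exact le_min (by omega) hn1
  rw [← hℓdef] at hℓ
  set d := D.dnm n m ψ₀ with hddef
  set A := seriesFrom n N D.Lam with hAdef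
  set H := seriesFrom m N D.Om with hHdef
  have hA : Smooth3 A := seriesFrom_smooth hD.smooth_Lam
  have hH : Smooth3 H := seriesFrom_smooth hD.smooth_Om
  have hA0 : ∀ ρ ψ, A ρ ψ 0 = D.Lam n ρ ψ := seriesFrom_zero (by omega)
  have hH0 : ∀ ρ ψ, H ρ ψ 0 = D.Om m ρ ψ := seriesFrom_zero (by omega)
  set k₃ : ℝ := 1 / (2 * D.q) with hk₃
  have hk₃0 : 0 ≤ k₃ := by positivity
  obtain ⟨P, hP, hP0, hPd, r₁, C₁, hr₁, hC₁, h₁⟩ := exists_drift_estimate hD.eta_ne_zero hA hH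
    (2 * D.q - n) (2 * D.q) hℓn hℓm k₃ (ψ₀ := ψ₀) (lam := D.lam n ψ₀) (om := D.om m ψ₀)
    (nu := D.nu n ψ₀) (by rw [hA0, hψ₀]) (by simp only [hA0, lam]) (by simp only [hA0, nu])
    (by simp only [hH0, om]) hd fun κ hκ => by
      have := D.exists_leading_bound n m ψ₀ hκ
      rwa [← hℓdef] at this
  -- The slope of `P` at `ψ₀` is `η ν = -2b`, so `exists_potential_estimate` with `2b` yields the
  -- coefficients `b` and `b/2` required later.
  have hb0 : 0 < -(D.eta * D.nu n ψ₀) / 2 := by linarith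
  obtain ⟨b, hb⟩ : ∃ b, b = -(D.eta * D.nu n ψ₀) / 2 := ⟨_, rfl⟩
  rw [← hb] at hb0
  obtain ⟨r₂, C₂, hr₂, hr₂1, hC₂, h₂⟩ := exists_potential_estimate hP (b := 2 * b) (by linarith) hP0
    (by rw [hPd, hb]; ring)
  set Z := phaseVel D.eta m H with hZdef
  have hZ : Smooth3 Z := phaseVel_smooth hH
  have hK : IsCompact (Metric.closedBall (0 : ℝ) 1 ×ˢ Metric.closedBall ψ₀ 1 ×ˢ Set.Icc (0 : ℝ) 1) :=
    (isCompact_closedBall _ _).prod ((isCompact_closedBall _ _).prod isCompact_Icc)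
  obtain ⟨C₃, h₃⟩ := hK.exists_bound_of_continuousOn hZ.continuous.continuousOn
  obtain ⟨C₄, h₄⟩ := hK.exists_bound_of_continuousOn hZ.deriv₁.continuous.continuousOn
  obtain ⟨C₅, h₅⟩ := hK.exists_bound_of_continuousOn hZ.deriv₂.continuous.continuousOn
  set c := min (min (d / 8) (b / (6 * d))) (min 1 (b / 4)) with hcdef
  have hc0 : 0 < c := lt_min (lt_min (by positivity) (by positivity)) (lt_min one_pos (by positivity))
  have hc1 : c ≤ 1 := (min_le_right _ _).trans (min_le_left _ _)
  have hc2 : c ≤ b / 4 := (min_le_right _ _).trans (min_le_right _ _)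
  have hc3 : c ≤ d / 8 := (min_le_left _ _).trans (min_le_left _ _)
  have hc4 : 6 * d * c ≤ b := by
    have : c ≤ b / (6 * d) := (min_le_left _ _).trans (min_le_right _ _)
    rw [le_div_iff₀ (by positivity)] at this
    linarith
  have hcsq : c ^ 2 ≤ b / 4 := by nlinarith
  -- `β ≥ ℓ - 1` gives `B e ≤ L` and `β ≥ n - ℓ` gives `B L ≤ X e`. The two add up to `2β ≥ n - 1`,
  -- that is, `B² ≤ X`. The hypothesis `ℓ + n - 1 < 2q` implies `β + 1 < 2q`, so the growth rate is
  -- not integrable, and `n < 2q`, so `e'` is negligible.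
  obtain ⟨β, hβ⟩ : ∃ β, β = max (ℓ - 1) (n - ℓ) := ⟨_, rfl⟩
  have hβ1 : ℓ - 1 ≤ β := hβ ▸ le_max_left _ _
  have hβ2 : n - ℓ ≤ β := hβ ▸ le_max_right _ _
  have hβ3 : β + 1 < 2 * D.q := by omega
  set V := potential P ψ₀ with hVdef
  set K₁ := C₂ + 1 + c ^ 2 with hK₁
  have hK₁0 : 0 < K₁ := by positivity
  set γ := min (d / 2) (c * b / 2) / K₁ with hγ
  have hγ0 : 0 < γ := by have := lt_min (half_pos hd) (half_pos (mul_pos hc0 hb0)); positivity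
  have hrr₁ := min_le_left r₁ r₂
  have hrr₂ := min_le_right r₁ r₂
  have n₃ := abs_nonneg C₃
  have n₄ := abs_nonneg C₄
  have n₅ := abs_nonneg C₅
  have region : ∀ ρ ψ e, |ρ| ≤ min r₁ r₂ → |ψ - ψ₀| ≤ min r₁ r₂ → 0 < e → e ≤ min r₁ r₂ →
      e ≤ 1 ∧ |Z ρ ψ e| ≤ |C₃| ∧ |deriv (fun ρ => Z ρ ψ e) ρ| ≤ |C₄| ∧
      |deriv (fun ψ => Z ρ ψ e) ψ| ≤ |C₅| := by
    intro ρ ψ e hρ hψ he her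
    have he1 : e ≤ 1 := her.trans (hrr₂.trans hr₂1)
    have hmem : (ρ, ψ, e) ∈ Metric.closedBall (0 : ℝ) 1 ×ˢ Metric.closedBall ψ₀ 1 ×ˢ
        Set.Icc (0 : ℝ) 1 := by
      refine ⟨?_, ?_, he.le, he1⟩
      · rw [Metric.mem_closedBall, Real.dist_eq, sub_zero]; exact hρ.trans (hrr₂.trans hr₂1)
      · rw [Metric.mem_closedBall, Real.dist_eq]; exact hψ.trans (hrr₂.trans hr₂1)
    exact ⟨he1, (h₃ _ hmem).trans (le_abs_self _), (h₄ _ hmem).trans (le_abs_self _),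
      (h₅ _ hmem).trans (le_abs_self _)⟩
  have hXe : ∀ e : ℝ, e ^ (n - 1) * e = e ^ n := fun e => by
    rw [← pow_succ, Nat.sub_add_cancel hn1]
  have powle : ∀ {e : ℝ} {i j : ℕ}, 0 < e → e ≤ 1 → i ≤ j → e ^ j ≤ e ^ i := fun he he1 hij =>
    pow_le_pow_of_le_one he.le he1 hij
  have hBX : ∀ e : ℝ, 0 < e → e ≤ 1 → (e ^ β) ^ 2 ≤ e ^ (n - 1) := fun e he he1 => by
    rw [← pow_mul]; exact powle he he1 (by omega)
  refine ⟨fun ρ ψ e => Z ρ ψ e ^ 2 / 2 + e ^ (n - 1) * V ψ e - c * e ^ β * (Z ρ ψ e * (ψ - ψ₀)),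
    β + 1, min r₁ r₂, b / 4, C₂ + |C₃| ^ 2 + |C₃|, γ, hβ3, lt_min hr₁ hr₂, hrr₂.trans hr₂1,
    by positivity, by positivity, hγ0, ?_, ?_⟩
  · intro ρ ψ e hρ hψ he her
    obtain ⟨he1, hz, -, -⟩ := region ρ ψ e hρ hψ he her
    obtain ⟨-, p₂, p₃, -, p₅, -⟩ := h₂ ψ e (hψ.trans hrr₂) ⟨he.le, he1⟩
    have hXn : 0 ≤ e ^ (n - 1) := by positivity
    obtain ⟨q₁, -⟩ := lyapunov_bounds (z := Z ρ ψ e) hXn (hBX e he he1) hcsq hC₂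
      (by linarith) p₃
    rw [hXe] at q₁
    refine ⟨?_, ?_⟩
    · have : 0 ≤ (|C₃| ^ 2 + |C₃|) * e ^ n := by positivity
      linarith
    · have w₁ : Z ρ ψ e ^ 2 ≤ |C₃| ^ 2 := by
        rw [← sq_abs (Z ρ ψ e)]; exact pow_le_pow_left₀ (abs_nonneg _) hz 2
      have w₂ : e ^ (n - 1) * V ψ e ≤ 1 * C₂ :=
        (mul_le_mul_of_nonneg_left ((le_abs_self _).trans p₅) hXn).trans
          (mul_le_mul_of_nonneg_right (pow_le_one₀ he.le he1) hC₂)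
      have w₃ : |c * e ^ β * (Z ρ ψ e * (ψ - ψ₀))| ≤ 1 * 1 * (|C₃| * 1) := by
        rw [abs_mul, abs_mul c, abs_mul (Z ρ ψ e), abs_of_pos hc0, abs_of_pos (pow_pos he β)]
        have := pow_le_one₀ (n := β) he.le he1
        have := hψ.trans (hrr₂.trans hr₂1)
        gcongr
      have w₄ := (abs_le.1 w₃).1
      have : 0 ≤ |C₃| ^ 2 := by positivity
      linarith
  · intro C hC
    set Cₜ := C * (1 + |C₄| + |C₅|) + C₁ + C₂ + |C₃| with hCₜ
    have hCₜ0 : 0 ≤ Cₜ := by positivity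
    set k₁ : ℝ := ((n - 1 : ℕ) : ℝ) / (2 * D.q) with hk₁
    set k₂ : ℝ := (β : ℝ) / (2 * D.q) with hk₂
    set K₂ := 2 * Cₜ ^ 2 + k₃ * Cₜ + k₁ * Cₜ + c * k₂ * Cₜ + 2 * c * Cₜ + c * Cₜ ^ 2 with hK₂
    have hk₁0 : 0 ≤ k₁ := by positivity
    have hk₂0 : 0 ≤ k₂ := by positivity
    have hK₂0 : 0 ≤ K₂ := by positivity
    -- `C₂` pays for the `O(e)` term in the upper bound of `W`, and `K₂/γ` for the error term in its
    -- derivative.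
    refine ⟨C₂ + K₂ / γ, by positivity, fun t₁ t₂ ρ ψ ht₁ het₁ hsol t ht => ?_⟩
    have ht0 : 0 < t := by linarith [ht.1]
    obtain ⟨⟨x, hx, hxe⟩, ⟨y, hy, hye⟩, hρ, hψ⟩ := hsol t ht
    have he := D.eps_pos ht0
    have her : D.eps t ≤ min r₁ r₂ := (D.eps_anti (by linarith) ht.1).trans het₁
    have hε := eps_hasDerivAt hD ht0
    have hεn := eps_pow_hasDerivAt hD ht0 (n - 1)
    have hεβ := eps_pow_hasDerivAt hD ht0 β
    rw [h.LamHat_eq N _ _ ht0] at hxe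
    rw [h.OmHat_eq hD (by omega) _ _ ht0] at hye
    have hz := hZ.hasDerivWithinAt hx hy hε.hasDerivWithinAt
    have hv3 : Smooth3 (fun ψ e (_ : ℝ) => V ψ e) :=
      (potential_smooth hP).comp contDiff_fst (by fun_prop)
    have hv := hv3.hasDerivWithinAt hy hε.hasDerivWithinAt (hasDerivWithinAt_const t _ (0 : ℝ))
    rw [(potential_hasDerivAt hP (ψ t) (D.eps t)).deriv] at hv
    simp only [zero_mul, add_zero] at hv
    have hdrift := h₁ (ρ t) (ψ t) (D.eps t) (hρ.trans hrr₁) (hψ.trans hrr₁) he (her.trans hrr₁)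
    obtain ⟨he1, bz, bz₁, bz₂⟩ := region (ρ t) (ψ t) (D.eps t) hρ hψ he her
    obtain ⟨p₁, p₂, p₃, p₄, p₅, p₆⟩ := h₂ (ψ t) (D.eps t) (hψ.trans hrr₂) ⟨he.le, he1⟩
    have hWd := (((hz.fun_pow 2).div_const 2).fun_add (hεn.hasDerivWithinAt.fun_mul hv)).fun_sub
      ((hεβ.hasDerivWithinAt.const_mul c).fun_mul (hz.fun_mul (hy.sub_const ψ₀)))
    refine ⟨_, hWd, ?_⟩
    have hm2' := phaseVel_deriv₂ (η := D.eta) (H := H) (ρ t) (ψ t) (D.eps t) hm1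
    rw [← hZdef] at hm2'
    rw [← hHdef, ← hZdef] at hye
    rw [phaseDrift, ← hZdef] at hdrift
    set e := D.eps t with hedef
    set z := Z (ρ t) (ψ t) e with hzdef
    set zρ := deriv (fun ρ => Z ρ (ψ t) e) (ρ t)
    set zψ := deriv (fun ψ => Z (ρ t) ψ e) (ψ t)
    set ze := deriv (fun e => Z (ρ t) (ψ t) e) e
    set Ve := deriv (fun e => V (ψ t) e) e
    set Pt := P (ψ t) e
    set hh := deriv (fun ψ => H (ρ t) ψ e) (ψ t)
    set At := A (ρ t) (ψ t) e
    set p := ψ t - ψ₀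
    -- Puts the contribution of `e'` under the common factor `e^n`, as in `phaseDrift` with `j = 2q
    -- - n`.
    have hq2 : e ^ (2 * D.q + 1) = e ^ n * e ^ (2 * D.q - n + 1) := by
      rw [← pow_add]; congr 1; omega
    have hM : e ^ β * e * (e ^ (n - 1) * e) = e ^ (β + 1 + n) := by rw [hXe, ← pow_succ, ← pow_add]
    -- Here `N ≥ 4q` is needed: the averaging error must be dominated by `e^(β + 1 + n)`, and both
    -- `β + 1` and `n` are at most `2q`.
    have hEn : e ^ (N + 1) ≤ e ^ β * e * (e ^ (n - 1) * e) := by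
      rw [hM]; exact powle he he1 (by omega)
    have hEJ : e ^ (n + (2 * D.q + 1)) ≤ e ^ β * e * (e ^ (n - 1) * e) := by
      rw [hM]; exact powle he he1 (by omega)
    set z' := x * zρ + y * zψ + -(e ^ (2 * D.q + 1)) / (2 * D.q) * ze with hz'
    have hz'e : |z' - e ^ (n - 1) * e * Pt - e ^ ℓ * d * z|
        ≤ d / 8 * e ^ ℓ * |z| + Cₜ * (e ^ β * e * (e ^ (n - 1) * e)) := by
      have s : z' - e ^ (n - 1) * e * Pt - e ^ ℓ * d * z
          = (e ^ n * (zρ * At - k₃ * e ^ (2 * D.q - n + 1) * ze) + e ^ m * hh * z - e ^ n * Pt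
              - e ^ ℓ * d * z) + (x - e ^ n * At) * zρ + (y - e * z) * zψ := by
        rw [hXe, hz', hq2, ← hm2', hk₃]; ring
      rw [s]
      have a₁ : |(x - e ^ n * At) * zρ| ≤ C * e ^ (N + 1) * |C₄| := by
        rw [abs_mul]; exact mul_le_mul hxe bz₁ (abs_nonneg _) (by positivity)
      have a₂ : |(y - e * z) * zψ| ≤ C * e ^ (N + 1) * |C₅| := by
        rw [abs_mul]; exact mul_le_mul hye bz₂ (abs_nonneg _) (by positivity)
      refine (abs_add_le _ _).trans ((add_le_add ((abs_add_le _ _).trans (add_le_add hdrift a₁))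
        a₂).trans ?_)
      have a₃ := mul_le_mul_of_nonneg_left hEJ hC₁
      have a₄ := mul_le_mul_of_nonneg_left hEn (by positivity : 0 ≤ C * (|C₄| + |C₅|))
      have a₅ : 0 ≤ (C + C₂ + |C₃|) * (e ^ β * e * (e ^ (n - 1) * e)) := by positivity
      rw [hCₜ]
      linarith
    have hy'e : |y - e * z| ≤ Cₜ * (e ^ β * e * (e ^ (n - 1) * e)) := by
      refine hye.trans (mul_le_mul ?_ hEn (by positivity) hCₜ0)
      have : 0 ≤ C * (|C₄| + |C₅|) := by positivity
      rw [hCₜ]; linarith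
    have hCC : 0 ≤ C * (1 + |C₄| + |C₅|) := by positivity
    have hC₂Cₜ : C₂ ≤ Cₜ := by rw [hCₜ]; linarith
    have key := lyapunov_deriv_lower_bound (e := e) (X := e ^ (n - 1)) (B := e ^ β) (L := e ^ ℓ)
      (Q := e ^ (2 * D.q)) (d := d) (b := b) (c := c) (C := Cₜ) (k₁ := k₁) (k₂ := k₂) (k₃ := k₃)
      (z := z) (p := p) (P := Pt) (V := V (ψ t) e) (Ve := Ve) (z' := z') (y' := y) he he1
      (by positivity) (pow_le_one₀ he.le he1) (by positivity) (pow_le_one₀ he.le he1) (by positivity)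
      (by rw [← pow_succ]; exact powle he he1 (by omega))
      (by rw [hXe, ← pow_add]; exact powle he he1 (by omega))
      (by rw [← pow_succ, ← pow_succ]; exact powle he he1 (by omega))
      (by rw [hXe, ← pow_succ]; exact powle he he1 (by omega))
      hd hc0 hc3 hc4 hCₜ0 hk₁0 hk₂0 hk₃0 (bz.trans (by rw [hCₜ]; linarith))
      (hψ.trans (hrr₂.trans hr₂1)) (p₄.trans hC₂Cₜ) (p₅.trans hC₂Cₜ) (p₆.trans hC₂Cₜ) hz'e hy'e
      (by
        have := mul_le_mul_of_nonneg_right hC₂Cₜ he.le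
        linarith)
    have hXn : 0 ≤ e ^ (n - 1) := by positivity
    obtain ⟨-, q₂⟩ := lyapunov_bounds (z := z) hXn (hBX e he he1) hcsq hC₂
      (by linarith) p₃
    have hγ1 : γ * K₁ ≤ d / 2 := by
      rw [hγ, div_mul_cancel₀ _ hK₁0.ne']; exact min_le_left _ _
    have hγ2 : γ * K₁ ≤ c * b / 2 := by
      rw [hγ, div_mul_cancel₀ _ hK₁0.ne']; exact min_le_right _ _
    have hXp : 0 ≤ e ^ (n - 1) * p ^ 2 := by positivity
    have g₁ : γ * (K₁ * (z ^ 2 + e ^ (n - 1) * p ^ 2))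
        ≤ d / 2 * z ^ 2 + c * b / 2 * (e ^ (n - 1) * p ^ 2) := by
      have := mul_le_mul_of_nonneg_right hγ1 (sq_nonneg z)
      have := mul_le_mul_of_nonneg_right hγ2 hXp
      linarith
    have g₂ := mul_le_mul_of_nonneg_left q₂ hγ0.le
    have g₃ : γ * ((C₂ + K₂ / γ) * (e ^ (n - 1) * e)) = γ * (C₂ * (e ^ (n - 1) * e))
        + K₂ * (e ^ (n - 1) * e) := by field_simp
    have g₄ := mul_le_mul_of_nonneg_left (show γ * (z ^ 2 / 2 + e ^ (n - 1) * V (ψ t) e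
        - c * e ^ β * (z * p) - (C₂ + K₂ / γ) * (e ^ (n - 1) * e))
        ≤ d / 2 * z ^ 2 + c * b / 2 * (e ^ (n - 1) * p ^ 2) - K₂ * (e ^ (n - 1) * e) by
      linarith) (by positivity : 0 ≤ e ^ β * e)
    rw [← hXe]
    have hfin : γ * e ^ (β + 1) * (z ^ 2 / 2 + e ^ (n - 1) * V (ψ t) e
        - c * e ^ β * (z * p) - (C₂ + K₂ / γ) * (e ^ (n - 1) * e))
        ≤ z * z' - e ^ (n - 1) * (Pt * y) - e ^ (n - 1) * (Ve * (k₃ * (e ^ (2 * D.q) * e)))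
          - k₁ * e ^ (n - 1) * e ^ (2 * D.q) * V (ψ t) e
          + c * (k₂ * (e ^ β * e ^ (2 * D.q))) * (z * p) - c * e ^ β * (z' * p)
          - c * e ^ β * (z * y) := by
      refine le_trans (le_trans (le_of_eq ?_) g₄) (le_trans (le_of_eq ?_) key)
      · rw [pow_succ]; ring
      · ring
    refine hfin.trans (le_of_eq ?_)
    simp only [Nat.cast_ofNat, Nat.add_one_sub_one, pow_one]
    rw [hk₁, hk₂, hk₃, pow_succ e (2 * D.q)]
    ring

end OscSystem

/-! ### Divergence of the growth integral and escape of averaged trajectories -/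

namespace OscSystem

variable {D : OscSystem} {n m : ℕ}

/-- `t^(-θ/(2q))` has exponent above `-1`, so its integral diverges. -/
theorem Valid.exists_primitive_eps_pow (hD : D.Valid) {θ : ℕ} (hθ : θ < 2 * D.q) :
    ∃ G : ℝ → ℝ, (∀ t, 0 < t → HasDerivAt G (D.eps t ^ θ) t) ∧ Tendsto G atTop atTop := by
  have hq := hD.q_cast_pos
  have hθ' : (θ : ℝ) < 2 * D.q := by exact_mod_cast hθ
  have hσ : 0 < 1 - (θ : ℝ) / (2 * D.q) := by
    rw [sub_pos, div_lt_one (by positivity)]; exact hθ'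
  refine ⟨fun t => t ^ (1 - (θ : ℝ) / (2 * D.q)) / (1 - (θ : ℝ) / (2 * D.q)), fun t ht => ?_,
    (tendsto_rpow_atTop hσ).atTop_div_const hσ⟩
  refine ((Real.hasDerivAt_rpow_const (Or.inl ht.ne')).div_const _).congr_deriv ?_
  rw [D.eps_pow ht, mul_div_cancel_left₀ _ hσ.ne']
  congr 1; ring

/-- If `|ψ(t₁) - ψ₀| ≥ δ`, then `W` starts above a positive `w` that dominates the error `K e^n`; it
then grows without bound, against `W ≤ K₀`. The time `t₂` depends only on `t₁` and the constants,
not on the trajectory. -/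
theorem Valid.averaged_instability (hD : D.Valid) (h : D.LeadingOrders n m) {ψ₀ : ℝ}
    (hψ₀ : D.Lam n 0 ψ₀ = 0) (hνη : D.nu n ψ₀ * D.eta < 0) (hd : 0 < D.dnm n m ψ₀)
    (hℓ : min m n + n - 1 < 2 * D.q) {N : ℕ} (hN : 4 * D.q ≤ N) :
    ∃ r : ℝ, 0 < r ∧ r ≤ 1 ∧ ∀ C δ : ℝ, 0 ≤ C → 0 < δ → ∃ T : ℝ, 1 ≤ T ∧ ∀ t₁, T ≤ t₁ →
      ∃ t₂, t₁ < t₂ ∧ ∀ ρ ψ : ℝ → ℝ, D.IsApproxAveraged N C ψ₀ r t₁ t₂ ρ ψ → |ψ t₁ - ψ₀| < δ := by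
  obtain ⟨W, θ, r, b, K₀, γ, hθ, hr, hr1, hb, hK₀, hγ, hW, hder⟩ :=
    hD.exists_lyapunov h hψ₀ hνη hd hℓ hN
  obtain ⟨G, hG, hGtop⟩ := hD.exists_primitive_eps_pow hθ
  refine ⟨r, hr, hr1, fun C δ hC hδ => ?_⟩
  obtain ⟨K, hK, hWK⟩ := hder C hC
  -- Such small `e` makes `(K₀ + K) e^n` at most half of `w = (b/2) e^(n-1) δ²`; the extra `1` only
  -- prevents a zero denominator.
  have hsmall : 0 < min r (b * δ ^ 2 / (4 * (K₀ + K + 1))) := lt_min hr (by positivity)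
  obtain ⟨T, hT⟩ := eventually_atTop.1 ((eps_tendsto hD).eventually (ge_mem_nhds hsmall))
  refine ⟨max 1 T, le_max_left _ _, fun t₁ ht₁ => ?_⟩
  have h1 : 1 ≤ t₁ := (le_max_left _ _).trans ht₁
  have he := D.eps_pos (t := t₁) (by linarith)
  have her := hT t₁ ((le_max_right _ _).trans ht₁)
  have her1 : D.eps t₁ ≤ r := her.trans (min_le_left _ _)
  have her2 := her.trans (min_le_right _ _)
  rw [le_div_iff₀ (by positivity)] at her2
  set X := D.eps t₁ ^ (n - 1) with hX
  have hX0 : 0 < X := by positivity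
  have hXe : D.eps t₁ ^ n = X * D.eps t₁ := by
    rw [hX, ← pow_succ, Nat.sub_add_cancel h.n_mem.1]
  set w := b / 2 * X * δ ^ 2 with hw
  have hw0 : 0 < w := by positivity
  -- Late enough for the linear lower bound of `growth_of_deriv_ge` to exceed `K₀`.
  obtain ⟨t₂, ht₂, ht₂'⟩ := ((hGtop.eventually_gt_atTop (G t₁ + K₀ / (w / 2 * γ))).and
    (eventually_gt_atTop t₁)).exists
  refine ⟨t₂, ht₂', fun ρ ψ hsol => ?_⟩
  by_contra! hlt
  have hder' := hWK t₁ t₂ ρ ψ h1 her1 hsol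
  choose! w' hw' using hder'
  have hregion : ∀ t ∈ Set.Icc t₁ t₂, 0 < D.eps t ∧ D.eps t ≤ D.eps t₁ := fun t ht =>
    ⟨D.eps_pos (by linarith [ht.1]), D.eps_anti (by linarith) ht.1⟩
  have hKe : (K₀ + K) * D.eps t₁ ^ n ≤ w / 2 := by
    have h2 := mul_le_mul_of_nonneg_left her2 hX0.le
    have h3 : 0 ≤ X * D.eps t₁ := by positivity
    rw [hXe, hw]
    linarith
  have hp0 : 0 ≤ D.eps t₁ ^ n := by positivity
  have hstart : w ≤ W (ρ t₁) (ψ t₁) (D.eps t₁) := by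
    obtain ⟨-, -, hρ, hψ⟩ := hsol t₁ ⟨le_rfl, ht₂'.le⟩
    have h2 := (hW (ρ t₁) (ψ t₁) (D.eps t₁) hρ hψ he her1).1
    have h3 : δ ^ 2 ≤ (ψ t₁ - ψ₀) ^ 2 := by
      rw [← sq_abs (ψ t₁ - ψ₀)]; exact pow_le_pow_left₀ hδ.le hlt 2
    have h4 := mul_le_mul_of_nonneg_left h3 (by positivity : 0 ≤ b * X)
    have h5 : 0 ≤ K * D.eps t₁ ^ n := by positivity
    linarith
  have hgrow := growth_of_deriv_ge (G := G) (G' := fun t => D.eps t ^ θ) (γ := γ) ht₂'.le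
    (fun t ht => (hw' t ht).1)
    (fun t ht => (hG t (by linarith [ht.1])).hasDerivWithinAt) (fun t ht => by
      refine le_trans ?_ (hw' t ht).2
      obtain ⟨e0, e1⟩ := hregion t ht
      refine mul_le_mul_of_nonneg_left ?_ (by positivity)
      have h2 : D.eps t ^ n ≤ D.eps t₁ ^ n := pow_le_pow_left₀ e0.le e1 n
      have h3 := mul_le_mul_of_nonneg_left h2 hK
      have h4 : 0 ≤ K₀ * D.eps t₁ ^ n := by positivity
      linarith) hw0 hstart
  obtain ⟨-, -, hρ, hψ⟩ := hsol t₂ ⟨ht₂'.le, le_rfl⟩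
  obtain ⟨e0, e1⟩ := hregion t₂ ⟨ht₂'.le, le_rfl⟩
  have hend := (hW (ρ t₂) (ψ t₂) (D.eps t₂) hρ hψ e0 (e1.trans her1)).2
  have h6 : K₀ < w / 2 * γ * (G t₂ - G t₁) := by
    have : K₀ / (w / 2 * γ) < G t₂ - G t₁ := by linarith
    rw [div_lt_iff₀ (by positivity)] at this
    linarith
  linarith

end OscSystem

/-! ### Formal solutions -/

theorem exists_sub_mul_pow_isBigO {A : ℝ → ℝ} (hA : ContDiff ℝ ∞ A) {k : ℕ}
    (h : A =O[𝓝 0] fun e => e ^ k) :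
    ∃ c : ℝ, (fun e => A e - c * e ^ k) =O[𝓝 0] fun e => e ^ (k + 1) := by
  refine ⟨taylorCoeff k A, (taylor_isBigO hA (k + 1)).congr_left fun e => ?_⟩
  rw [Finset.sum_range_succ, Finset.sum_eq_zero, zero_add]
  intro i hi
  rw [taylorCoeff_eq_zero_of_isBigO hA h i (Finset.mem_range.1 hi), zero_mul]

/-- Smooth functions vanish to integer order, so little-o of one power improves to big-O of the
next. -/
theorem isBigO_succ_of_isLittleO {A : ℝ → ℝ} (hA : ContDiff ℝ ∞ A) {k : ℕ}
    (h : A =o[𝓝 0] fun e => e ^ k) : A =O[𝓝 0] fun e => e ^ (k + 1) := by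
  obtain ⟨c, hc⟩ := exists_sub_mul_pow_isBigO hA h.isBigO
  have h1 : (fun e : ℝ => e ^ (k + 1)) =o[𝓝 0] fun e : ℝ => e ^ k :=
    isLittleO_pow_pow (Nat.lt_succ_self k)
  have h2 : (fun e : ℝ => c * e ^ k) =o[𝓝 0] fun e : ℝ => e ^ k :=
    (h.sub (hc.trans_isLittleO h1)).congr_left fun e => by ring
  have h0 : c = 0 := by
    by_contra hne
    refine isLittleO_irrefl' (f' := fun e : ℝ => e ^ k) (l := 𝓝 (0 : ℝ)) ?_
      ((isLittleO_const_mul_left_iff hne).1 h2)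
    have : ∃ᶠ e : ℝ in 𝓝 0, e ≠ 0 :=
      (eventually_mem_nhdsWithin (a := (0 : ℝ)) (s := {0}ᶜ)).frequently.filter_mono nhdsWithin_le_nhds
    exact this.mono fun e he => norm_ne_zero_iff.2 (pow_ne_zero k he)
  simpa [h0] using hc

theorem isBigO_pow_mul {A : ℝ → ℝ} {i j : ℕ} (h : A =O[𝓝 0] fun e => e ^ i) :
    (fun e => e ^ j * A e) =O[𝓝 0] fun e : ℝ => e ^ (j + i) :=
  ((isBigO_refl (fun e : ℝ => e ^ j) _).mul h).congr_right fun e => (pow_add e j i).symm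

theorem isBigO_comp_add_pow {X : ℝ → ℝ → ℝ} (hX : Smooth2 X) {f : ℝ → ℝ} (hf : ContDiff ℝ ∞ f)
    (c : ℝ) {k : ℕ} (hk : 1 ≤ k) :
    (fun e => X (f e + c * e ^ k) e - X (f e) e) =O[𝓝 0] fun e => e ^ k :=
  isBigO_comp_sub (x := fun e => f e + c * e ^ k) (x' := f) (y := fun e => e) (y' := fun e => e) hX
    (hf.continuous.add (by fun_prop)) hf.continuous continuous_id continuous_id
    (by rw [zero_pow (by omega), mul_zero, add_zero]) rfl
    ((isBigO_const_mul_self c _ _).congr_left fun e => by ring) (by simpa using isBigO_zero _ _)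

theorem isBigO_comp_add_pow_linear {X : ℝ → ℝ → ℝ} (hX : Smooth2 X) {f : ℝ → ℝ}
    (hf : ContDiff ℝ ∞ f) (c : ℝ) {k : ℕ} (hk : 1 ≤ k) :
    (fun e => X (f e + c * e ^ k) e - X (f e) e - deriv (fun x => X x 0) (f 0) * c * e ^ k)
      =O[𝓝 0] fun e => e ^ (k + 1) := by
  have hX' : ContDiff ℝ ∞ (fun p : ℝ × ℝ => X p.1 p.2) := hX
  have hf' : ContDiff ℝ ∞ fun e => f e + c * e ^ k := hf.add (by fun_prop)
  refine isBigO_succ_of_isLittleO (((hX.comp hf' contDiff_id).sub (hX.comp hf contDiff_id)).sub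
    (by fun_prop)) ?_
  have hs := (hX'.contDiffAt (x := (f 0, 0))).hasStrictFDerivAt (by simp)
  set L := fderiv ℝ (fun p : ℝ × ℝ => X p.1 p.2) (f 0, 0)
  have hL : deriv (fun x => X x 0) (f 0) = L (1, 0) :=
    (hs.hasFDerivAt.comp_hasDerivAt (f := fun s => (s, (0 : ℝ))) (f 0)
      ((hasDerivAt_id' (f 0)).prodMk (hasDerivAt_const (f 0) (0 : ℝ)))).deriv
  have ht : Tendsto (fun e => ((f e + c * e ^ k, e), (f e, e))) (𝓝 0) (𝓝 ((f 0, 0), (f 0, 0))) := by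
    have h1 : Continuous fun e => ((f e + c * e ^ k, e), (f e, e)) := by
      have := hf.continuous
      fun_prop
    have h2 := h1.tendsto 0
    rwa [zero_pow (by omega), mul_zero, add_zero] at h2
  have h1 := hs.isLittleO.comp_tendsto ht
  have h2 : ∀ e : ℝ, ((f e + c * e ^ k, e) : ℝ × ℝ) - (f e, e) = (c * e ^ k) • ((1, 0) : ℝ × ℝ) :=
    fun e => by simp
  simp only [Function.comp_def, h2, map_smul, smul_eq_mul] at h1
  have h3 : (fun e : ℝ => (c * e ^ k) • ((1, 0) : ℝ × ℝ)) =O[𝓝 0] fun e : ℝ => e ^ k :=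
    IsBigO.of_bound |c| (Eventually.of_forall fun e => by
      rw [norm_smul, norm_mul, Real.norm_eq_abs]; simp [Prod.norm_def])
  refine (h1.trans_isBigO h3).congr_left fun e => ?_
  rw [hL]; simp only [id_eq]; ring

/-- Residual of the first equation of the averaged system, with leading power removed. -/
def formalResRho (L : ℝ → ℝ → ℝ → ℝ) (k : ℝ) (i : ℕ) (p f : ℝ → ℝ) (e : ℝ) : ℝ :=
  L (p e) (f e) e + k * e ^ (i + 1) * deriv p e

/-- Residual of the second equation of the averaged system, with leading power removed. -/
def formalResPhi (η : ℝ) (m : ℕ) (H : ℝ → ℝ → ℝ → ℝ) (k : ℝ) (i : ℕ) (p f : ℝ → ℝ) (e : ℝ) : ℝ :=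
  phaseVel η m H (p e) (f e) e + k * e ^ (m + i) * deriv f e

/-- The linear system for the next pair of coefficients is triangular. The amplitude correction
cancels the leading phase residual through `η`. The phase correction then cancels the leading
amplitude residual through `ν`, and, because `H` carries the factor `e^(m-1)`, it disturbs the phase
equation only at the next order. -/
theorem formal_step {η k ψ₀ : ℝ} (hη : η ≠ 0) {m i i' M : ℕ} (hm : 2 ≤ m) {L H : ℝ → ℝ → ℝ → ℝ}
    (hL : Smooth3 L) (hH : Smooth3 H) (hν : deriv (fun ψ => L 0 ψ 0) ψ₀ ≠ 0) {p f : ℝ → ℝ}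
    (hp : ContDiff ℝ ∞ p) (hf : ContDiff ℝ ∞ f) (hp0 : p 0 = 0) (hf0 : f 0 = ψ₀)
    (h₁ : formalResRho L k i p f =O[𝓝 0] fun e => e ^ (M + 1))
    (h₂ : formalResPhi η m H k i' p f =O[𝓝 0] fun e => e ^ (M + 1 + (m - 2))) :
    ∃ x y : ℝ,
      formalResRho L k i (fun e => p e + x * e ^ (M + 1 + (m - 2))) (fun e => f e + y * e ^ (M + 1))
        =O[𝓝 0] (fun e => e ^ (M + 2)) ∧
      formalResPhi η m H k i' (fun e => p e + x * e ^ (M + 1 + (m - 2)))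
        (fun e => f e + y * e ^ (M + 1)) =O[𝓝 0] (fun e => e ^ (M + 2 + (m - 2))) := by
  obtain ⟨l, rfl⟩ := Nat.exists_eq_add_of_le' hm
  rw [Nat.add_sub_cancel] at *
  have smoothRho : ∀ {p f : ℝ → ℝ}, ContDiff ℝ ∞ p → ContDiff ℝ ∞ f →
      ContDiff ℝ ∞ (formalResRho L k i p f) := fun hp hf =>
    (hL.comp hp hf contDiff_id).add (ContDiff.mul (by fun_prop) (contDiff_infty_iff_deriv.1 hp).2)
  have smoothPhi : ContDiff ℝ ∞ (formalResPhi η (l + 2) H k i' p f) :=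
    ((phaseVel_smooth hH).comp hp hf contDiff_id).add
      (ContDiff.mul (by fun_prop) (contDiff_infty_iff_deriv.1 hf).2)
  have hder : ∀ {g : ℝ → ℝ}, ContDiff ℝ ∞ g → ∀ (c : ℝ) (j : ℕ) (e : ℝ),
      deriv (fun e => g e + c * e ^ (j + 1)) e = deriv g e + c * (((j + 1 : ℕ) : ℝ) * e ^ j) :=
    fun hg c j e => by
      refine HasDerivAt.deriv (((hg.differentiable (by simp) e).hasDerivAt).add ?_)
      simpa using (hasDerivAt_pow (j + 1) e).const_mul c
  obtain ⟨β, hβ⟩ := exists_sub_mul_pow_isBigO smoothPhi h₂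
  set x : ℝ := -(β / η) with hx
  have hp' : ContDiff ℝ ∞ fun e => p e + x * e ^ (M + 1 + l) := hp.add (by fun_prop)
  have e₁ : M + 1 + l = M + l + 1 := by omega
  have hL₁ : (fun e => L (p e + x * e ^ (M + 1 + l)) (f e) e - L (p e) (f e) e)
      =O[𝓝 0] fun e => e ^ (M + 1 + l) :=
    isBigO_comp_add_pow (X := fun x e => L x (f e) e)
      (hL.comp contDiff_fst (hf.comp contDiff_snd) contDiff_snd) hp x (by omega)
  have h₁' : formalResRho L k i (fun e => p e + x * e ^ (M + 1 + l)) f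
      =O[𝓝 0] fun e => e ^ (M + 1) := by
    have h3 : (fun e : ℝ => k * x * ((M + l + 1 : ℕ) : ℝ) * e ^ (i + 1 + (M + l))) =O[𝓝 0]
        fun e : ℝ => e ^ (M + 1) :=
      (isBigO_const_mul_self _ _ _).trans (isBigO_pow_of_le (by omega))
    refine ((h₁.add (hL₁.trans (isBigO_pow_of_le (by omega)))).add h3).congr_left fun e => ?_
    simp only [formalResRho]
    rw [e₁, hder hp]
    ring
  obtain ⟨α, hα⟩ := exists_sub_mul_pow_isBigO (smoothRho hp' hf) h₁'
  set ν := deriv (fun ψ => L 0 ψ 0) ψ₀ with hνdef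
  set y : ℝ := -(α / ν) with hy
  have hf' : ContDiff ℝ ∞ fun e => f e + y * e ^ (M + 1) := hf.add (by fun_prop)
  refine ⟨x, y, ?_, ?_⟩
  · have h3 := isBigO_comp_add_pow_linear (X := fun ψ e => L (p e + x * e ^ (M + 1 + l)) ψ e)
      (hL.comp (hp'.comp contDiff_snd) contDiff_fst contDiff_snd) hf y (k := M + 1) (by omega)
    simp only [hp0, hf0] at h3
    rw [zero_pow (by omega), mul_zero, add_zero] at h3
    refine (hα.add h3).congr_left fun e => ?_
    have h4 : deriv (fun ψ => L 0 ψ 0) ψ₀ * y = -α := by rw [← hνdef, hy]; field_simp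
    rw [h4]
    simp only [formalResRho]
    ring
  · have h3 : (fun e => H (p e + x * e ^ (M + 1 + l)) (f e + y * e ^ (M + 1)) e
        - H (p e) (f e + y * e ^ (M + 1)) e) =O[𝓝 0] fun e => e ^ (M + 1) :=
      (isBigO_comp_add_pow (X := fun x e => H x (f e + y * e ^ (M + 1)) e)
        (hH.comp contDiff_fst (hf'.comp contDiff_snd) contDiff_snd) hp x (by omega)).trans
        (isBigO_pow_of_le (by omega))
    have h4 : (fun e => H (p e) (f e + y * e ^ (M + 1)) e - H (p e) (f e) e)
        =O[𝓝 0] fun e => e ^ (M + 1) :=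
      isBigO_comp_add_pow (X := fun ψ e => H (p e) ψ e)
        (hH.comp (hp.comp contDiff_snd) contDiff_fst contDiff_snd) hf y (by omega)
    -- The prefactor `e^(l+1)` with `l = m - 2` supplies the extra order that leaves the
    -- cancellation in the phase equation intact.
    have h5 := (isBigO_pow_mul (j := l + 1) (h3.add h4)).trans
      (isBigO_pow_of_le (by omega : M + 2 + l ≤ l + 1 + (M + 1)))
    have h6 : (fun e : ℝ => k * y * ((M + 1 : ℕ) : ℝ) * e ^ (l + 2 + i' + M)) =O[𝓝 0]
        fun e : ℝ => e ^ (M + 2 + l) :=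
      (isBigO_const_mul_self _ _ _).trans (isBigO_pow_of_le (by omega))
    have e₂ : M + 2 + l = M + 1 + l + 1 := by omega
    rw [← e₂] at hβ
    refine ((hβ.add h5).add h6).congr_left fun e => ?_
    have h7 : η * x = -β := by rw [hx]; field_simp
    have h8 : η * (p e + x * e ^ (M + 1 + l)) = η * p e - β * e ^ (M + 1 + l) := by
      rw [mul_add, ← mul_assoc, h7]; ring
    simp only [formalResPhi, phaseVel, h8, Nat.add_sub_cancel]
    rw [hder hf]
    ring

/-- Dependent choice: as `P M` sees only the entries up to `M`, which later updates do not touch,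
the diagonal of the successive updates satisfies every `P M`. -/
theorem exists_seq_of_forall_exists_update {α : Type*} {P : ℕ → (ℕ → α) → Prop} {s₀ : ℕ → α}
    (hcongr : ∀ M s s', (∀ k ≤ M, s k = s' k) → P M s → P M s') (h0 : P 0 s₀)
    (hstep : ∀ M s, P M s → ∃ x, P (M + 1) (Function.update s (M + 1) x)) : ∃ s, ∀ M, P M s := by
  have : Nonempty α := ⟨s₀ 0⟩
  choose! next hnext using hstep
  let seq : ℕ → ℕ → α := Nat.rec s₀ fun M s => Function.update s (M + 1) (next M s)
  have hP : ∀ M, P M (seq M) := fun M => by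
    induction M with
    | zero => exact h0
    | succ M ih => exact hnext M _ ih
  have hseq : ∀ M k, k ≤ M → seq M k = seq k k := fun M => by
    induction M with
    | zero => intro k hk; rw [Nat.le_zero.1 hk]
    | succ M ih =>
      intro k hk
      rcases hk.eq_or_lt with rfl | hlt
      · rfl
      · rw [← ih k (Nat.lt_succ_iff.1 hlt)]
        exact Function.update_of_ne hlt.ne _ _
  exact ⟨fun k => seq k k, fun M => hcongr M _ _ (hseq M) (hP M)⟩

/-- `∑_{k=1}^M c_k e^(k+j)`. -/
def coeffPoly (j : ℕ) (c : ℕ → ℝ) (M : ℕ) (e : ℝ) : ℝ :=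
  ∑ k ∈ Finset.Icc 1 M, c k * e ^ (k + j)

theorem coeffPoly_smooth (j : ℕ) (c : ℕ → ℝ) (M : ℕ) : ContDiff ℝ ∞ (coeffPoly j c M) := by
  unfold coeffPoly; fun_prop

theorem coeffPoly_zero_right (j : ℕ) (c : ℕ → ℝ) (M : ℕ) : coeffPoly j c M 0 = 0 :=
  Finset.sum_eq_zero fun k hk => by
    rw [zero_pow (by have := (Finset.mem_Icc.1 hk).1; omega), mul_zero]

theorem coeffPoly_congr {j M : ℕ} {c c' : ℕ → ℝ} (h : ∀ k ≤ M, c k = c' k) :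
    coeffPoly j c M = coeffPoly j c' M := by
  funext e
  exact Finset.sum_congr rfl fun k hk => by rw [h k (Finset.mem_Icc.1 hk).2]

theorem coeffPoly_succ (j : ℕ) (c : ℕ → ℝ) (M : ℕ) (e : ℝ) :
    coeffPoly j c (M + 1) e = coeffPoly j c M e + c (M + 1) * e ^ (M + 1 + j) := by
  rw [coeffPoly, Finset.sum_Icc_succ_top (by omega)]; rfl

theorem exists_formal_coeffs {η k ψ₀ : ℝ} (hη : η ≠ 0) {m i i' : ℕ} (hm : 2 ≤ m)
    {L H : ℝ → ℝ → ℝ → ℝ} (hL : Smooth3 L) (hH : Smooth3 H) (hL0 : L 0 ψ₀ 0 = 0)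
    (hν : deriv (fun ψ => L 0 ψ 0) ψ₀ ≠ 0) :
    ∃ a b : ℕ → ℝ, ∀ M,
      formalResRho L k i (coeffPoly (m - 2) a M) (fun e => ψ₀ + coeffPoly 0 b M e)
        =O[𝓝 0] (fun e => e ^ (M + 1)) ∧
      formalResPhi η m H k i' (coeffPoly (m - 2) a M) (fun e => ψ₀ + coeffPoly 0 b M e)
        =O[𝓝 0] (fun e => e ^ (M + 1 + (m - 2))) := by
  have key := exists_seq_of_forall_exists_update (α := ℝ × ℝ) (s₀ := fun _ => 0)
    (P := fun M s =>
      formalResRho L k i (coeffPoly (m - 2) (fun k => (s k).1) M)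
        (fun e => ψ₀ + coeffPoly 0 (fun k => (s k).2) M e) =O[𝓝 0] (fun e => e ^ (M + 1)) ∧
      formalResPhi η m H k i' (coeffPoly (m - 2) (fun k => (s k).1) M)
        (fun e => ψ₀ + coeffPoly 0 (fun k => (s k).2) M e)
        =O[𝓝 0] (fun e => e ^ (M + 1 + (m - 2)))) ?_ ?_ ?_
  · obtain ⟨s, hs⟩ := key
    exact ⟨_, _, hs⟩
  · intro M s s' h hP
    rwa [coeffPoly_congr (c := fun k => (s k).1) (c' := fun k => (s' k).1)
      fun k hk => by rw [h k hk], coeffPoly_congr (c := fun k => (s k).2) (c' := fun k => (s' k).2)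
      fun k hk => by rw [h k hk]] at hP
  -- With empty sums the amplitude residual `L 0 ψ₀ e` vanishes at `e = 0`, and the phase residual
  -- is `e^(m-1) H`, already of the required order.
  · have hz : ∀ j c, coeffPoly j c 0 = fun _ => 0 := fun j c => by
      funext e; simp [coeffPoly]
    have hLs : ContDiff ℝ ∞ fun e => L 0 ψ₀ e := hL.comp contDiff_const contDiff_const contDiff_id
    have hHs : ContDiff ℝ ∞ fun e => H 0 ψ₀ e := hH.comp contDiff_const contDiff_const contDiff_id
    simp only [hz, add_zero]
    constructor
    · refine (isBigO_of_taylorCoeff_eq_zero hLs (k := 1) fun i hi => ?_).congr_left fun e => ?_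
      · rw [Nat.lt_one_iff.1 hi, taylorCoeff_zero, hL0]
      · simp [formalResRho]
    · have := isBigO_pow_mul (j := 1 + (m - 2)) (isBigO_of_taylorCoeff_eq_zero hHs (k := 0) (by simp))
      refine this.congr_left fun e => ?_
      simp only [formalResPhi, phaseVel, deriv_const, mul_zero, zero_add, add_zero]
      ring
  · intro M s hP
    obtain ⟨x, y, h₁, h₂⟩ := formal_step hη hm hL hH hν (coeffPoly_smooth _ _ _)
      (contDiff_const.add (coeffPoly_smooth _ _ _)) (coeffPoly_zero_right _ _ _)
      (by rw [coeffPoly_zero_right, add_zero]) hP.1 hP.2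
    refine ⟨(x, y), ?_⟩
    have c₁ : coeffPoly (m - 2) (fun k => (Function.update s (M + 1) (x, y) k).1) (M + 1)
        = fun e => coeffPoly (m - 2) (fun k => (s k).1) M e + x * e ^ (M + 1 + (m - 2)) := by
      funext e
      rw [coeffPoly_succ, Function.update_self, coeffPoly_congr (c' := fun k => (s k).1)]
      intro k hk
      rw [Function.update_of_ne (by omega)]
    have c₂ : (fun e => ψ₀ + coeffPoly 0 (fun k => (Function.update s (M + 1) (x, y) k).2) (M + 1) e)
        = fun e => ψ₀ + coeffPoly 0 (fun k => (s k).2) M e + y * e ^ (M + 1) := by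
      funext e
      rw [coeffPoly_succ, Function.update_self, coeffPoly_congr (c' := fun k => (s k).2), add_zero,
        add_assoc]
      intro k hk
      rw [Function.update_of_ne (by omega)]
    rw [c₁, c₂]
    exact ⟨h₁, h₂⟩

namespace OscSystem

variable {D : OscSystem} {n m : ℕ}

theorem rhoSum_eq (D : OscSystem) (hm : 2 ≤ m) (a : ℕ → ℝ) (M : ℕ) {t : ℝ} (ht : 0 < t) :
    D.rhoSum m a M t = coeffPoly (m - 2) a M (D.eps t) := by
  refine Finset.sum_congr rfl fun k _ => ?_
  rw [D.eps_pow ht, mul_comm, Nat.cast_add, Nat.cast_sub hm]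
  congr 3; push_cast; ring

theorem phiSum_eq (D : OscSystem) (ψ₀ : ℝ) (b : ℕ → ℝ) (M : ℕ) {t : ℝ} (ht : 0 < t) :
    D.phiSum ψ₀ b M t = ψ₀ + coeffPoly 0 b M (D.eps t) := by
  rw [phiSum, coeffPoly]
  congr 1
  refine Finset.sum_congr rfl fun k _ => ?_
  rw [D.eps_pow ht, mul_comm, add_zero]

theorem deriv_comp_eps (hD : D.Valid) {p s : ℝ → ℝ} (hp : ContDiff ℝ ∞ p)
    (h : ∀ t, 0 < t → s t = p (D.eps t)) {t : ℝ} (ht : 0 < t) :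
    deriv s t = deriv p (D.eps t) * (-(D.eps t ^ (2 * D.q + 1)) / (2 * D.q)) := by
  have h1 : s =ᶠ[𝓝 t] fun t => p (D.eps t) := by
    filter_upwards [lt_mem_nhds ht] with u hu using h u hu
  rw [h1.deriv_eq]
  exact (((hp.differentiable (by simp) _).hasDerivAt).comp t (eps_hasDerivAt hD ht)).deriv

theorem Valid.tendsto_rhoSum (hD : D.Valid) (hm : 2 ≤ m) (a : ℕ → ℝ) (M : ℕ) :
    Tendsto (D.rhoSum m a M) atTop (𝓝 0) := by
  have h1 := ((coeffPoly_smooth (m - 2) a M).continuous.tendsto 0).comp (eps_tendsto hD)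
  rw [coeffPoly_zero_right] at h1
  refine h1.congr' ?_
  filter_upwards [eventually_gt_atTop 0] with t ht using (D.rhoSum_eq hm a M ht).symm

theorem Valid.tendsto_phiSum (hD : D.Valid) (ψ₀ : ℝ) (b : ℕ → ℝ) (M : ℕ) :
    Tendsto (D.phiSum ψ₀ b M) atTop (𝓝 ψ₀) := by
  have h1 := (((coeffPoly_smooth 0 b M).continuous.tendsto 0).comp (eps_tendsto hD)).const_add ψ₀
  rw [coeffPoly_zero_right, add_zero] at h1
  refine h1.congr' ?_
  filter_upwards [eventually_gt_atTop 0] with t ht using (D.phiSum_eq ψ₀ b M ht).symm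

theorem Valid.isBigO_comp_eps (hD : D.Valid) {A s : ℝ → ℝ} {k K : ℕ}
    (hA : A =O[𝓝 0] fun e => e ^ k) (hK : K ≤ k) (h : ∀ t, 0 < t → s t = A (D.eps t)) :
    s =O[atTop] fun t : ℝ => t ^ (-(K : ℝ) / (2 * D.q)) := by
  refine ((hA.trans (isBigO_pow_of_le hK)).comp_tendsto (eps_tendsto hD)).congr' ?_ ?_
  · filter_upwards [eventually_gt_atTop 0] with t ht using (h t ht).symm
  · filter_upwards [eventually_gt_atTop 0] with t ht using D.eps_pow ht K

/-- Substituting `e' = -e^(2q+1)/(2q)` turns the time derivative into a derivative in `e`; dividing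
the equations by `e^n` and `e` gives `formalResRho` and `formalResPhi` with shifts `2q - n` and `2q
- m`. `N ≥ 2q` ensures that the leading terms `Λ_n`, `Ω_m` survive the truncation. -/
theorem Valid.exists_isFormalSolution (hD : D.Valid) (h : D.LeadingOrders n m) {ψ₀ : ℝ}
    (hψ₀ : D.Lam n 0 ψ₀ = 0) (hν : D.nu n ψ₀ ≠ 0) {N : ℕ} (hN : 2 * D.q ≤ N) :
    ∃ ϱ ϕ : ℕ → ℝ, D.IsFormalSolution N m ψ₀ ϱ ϕ := by
  have hn1 := h.n_mem.1
  have hn2 := h.n_mem.2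
  have hm1 := h.m_mem.1
  have hm2 := h.m_mem.2
  have hq := hD.q_cast_pos
  set L := seriesFrom n N D.Lam with hLdef
  set H := seriesFrom m N D.Om with hHdef
  have hL : Smooth3 L := seriesFrom_smooth hD.smooth_Lam
  have hH : Smooth3 H := seriesFrom_smooth hD.smooth_Om
  have hL0 : ∀ ρ ψ, L ρ ψ 0 = D.Lam n ρ ψ := seriesFrom_zero (by omega)
  obtain ⟨a, b, hab⟩ := exists_formal_coeffs (k := 1 / (2 * D.q)) (i := 2 * D.q - n)
    (i' := 2 * D.q - m) hD.eta_ne_zero hm1 hL hH (by rw [hL0, hψ₀])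
    (by simp only [hL0]; exact hν)
  refine ⟨a, b, fun K => ?_⟩
  filter_upwards [eventually_ge_atTop K] with M hM
  obtain ⟨h₁, h₂⟩ := hab M
  refine ⟨hD.isBigO_comp_eps (isBigO_pow_mul (j := n) h₁).neg_left (by omega : K ≤ _) ?_,
    hD.isBigO_comp_eps (isBigO_pow_mul (j := 1) h₂).neg_left (by omega : K ≤ _) ?_⟩
  · intro t ht
    rw [deriv_comp_eps hD (coeffPoly_smooth (m - 2) a M) (fun t ht => D.rhoSum_eq hm1 a M ht) ht,
      h.LamHat_eq N _ _ ht, D.rhoSum_eq hm1 a M ht, D.phiSum_eq ψ₀ b M ht, formalResRho]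
    have e1 : D.eps t ^ (2 * D.q + 1) = D.eps t ^ n * D.eps t ^ (2 * D.q - n + 1) := by
      rw [← pow_add]; congr 1; omega
    rw [e1]; ring
  · intro t ht
    rw [deriv_comp_eps hD (contDiff_const.add (coeffPoly_smooth 0 b M))
      (fun t ht => D.phiSum_eq ψ₀ b M ht) ht,
      h.OmHat_eq hD (by omega) _ _ ht, D.rhoSum_eq hm1 a M ht, D.phiSum_eq ψ₀ b M ht, formalResPhi]
    rw [Nat.add_sub_cancel' hm2, pow_succ]; ring

end OscSystem

/-! ### Escape from the resonance zone -/

namespace OscSystem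

variable {D : OscSystem}

theorem IsSolutionOn.mono {t₁ t₂ s₁ s₂ : ℝ} {r φ : ℝ → ℝ} (h : D.IsSolutionOn t₁ t₂ r φ)
    (h₁ : t₁ ≤ s₁) (h₂ : s₂ ≤ t₂) : D.IsSolutionOn s₁ s₂ r φ := fun t ht => by
  have hsub : Set.Icc s₁ s₂ ⊆ Set.Icc t₁ t₂ := Set.Icc_subset_Icc h₁ h₂
  obtain ⟨a, b, c⟩ := h t (hsub ht)
  exact ⟨a, b.mono hsub, c.mono hsub⟩

/-- Only even powers of `e` occur in `phaseRate`, so its deviation from `s₀` starts at order two. -/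
theorem Valid.exists_phaseRate_bound (hD : D.Valid) :
    ∃ C : ℝ, 0 ≤ C ∧ ∀ e ∈ Set.Icc (0 : ℝ) 1, |D.phaseRate e - D.s 0| ≤ C * e ^ 2 := by
  obtain ⟨C, hC, h⟩ := exists_bound_of_taylorCoeff_eq_zero (E := ℝ)
    (B := fun _ e => D.phaseRate e - D.s 0)
    ((D.phaseRate_smooth.comp contDiff_snd).sub contDiff_const) (isCompact_singleton (x := (0 : ℝ))) 1
    fun x _ i hi => by
      rw [taylorCoeff_sub D.phaseRate_smooth contDiff_const, taylorCoeff_const]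
      interval_cases i
      · rw [taylorCoeff_zero, phaseRate_zero hD]; simp
      · rw [taylorCoeff_phaseRate, phaseCoeff, if_neg (by simp)]; simp
  exact ⟨C, hC, fun e he => h 0 rfl e he⟩

theorem Valid.freq_hasDerivAt (hD : D.Valid) : HasDerivAt D.freq D.eta D.a := by
  have hnhds : {r : ℝ | |r| ≤ D.calR} ∈ 𝓝 D.a :=
    mem_of_superset ((isOpen_lt continuous_abs continuous_const).mem_nhds hD.a_lt)
      fun r (hr : |r| < D.calR) => hr.le
  exact ((hD.freq_smooth.contDiffAt hnhds).differentiableAt (by simp)).hasDerivAt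

theorem abs_le_eps_sq (D : OscSystem) {c : ℝ}
    {h : ℝ → ℝ → ℝ → ℝ → ℝ} {hc : ℕ → ℝ → ℝ → ℝ → ℝ} (hh : IsDecayingPerturbation c D.q h hc) :
    ∃ C T : ℝ, 0 ≤ C ∧ 0 < T ∧ ∀ t, T ≤ t → ∀ r φ S, |r| ≤ c → |h r φ S t| ≤ C * D.eps t ^ 2 := by
  obtain ⟨C, T, hT, hb⟩ := hh.expansion 1 le_rfl
  refine ⟨max C 0, T, le_max_right _ _, hT, fun t ht r φ S hr => ?_⟩
  have h1 := hb t ht r φ S hr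
  rw [← D.eps_pow_two_mul (hT.trans_le ht), mul_one, Finset.Ico_self, Finset.sum_empty,
    sub_zero] at h1
  exact h1.trans (mul_le_mul_of_nonneg_right (le_max_left _ _) (sq_nonneg _))

/-- Solutions that stay close to the resonance remain in the narrow zone `|r - a| ≤ C₀ t^(-1/(2q))`
for most of the time: outside of it the phase drifts away. -/
theorem Valid.exists_escape (hD : D.Valid) (ψ₀ : ℝ) {C₀ : ℝ} (hC₀ : 0 < C₀) :
    ∃ ε T : ℝ, 0 < ε ∧ 1 ≤ T ∧ ∀ t₁, T ≤ t₁ → ∀ r φ : ℝ → ℝ, D.IsSolutionOn t₁ (2 * t₁) r φ →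
      (∀ t ∈ Set.Icc t₁ (2 * t₁), |r t - D.a| ≤ ε ∧
        |φ t - (D.kappa : ℝ) / D.varkappa * D.phase t - ψ₀| ≤ ε) →
      |r t₁ - D.a| ≤ C₀ * D.eps t₁ := by
  obtain ⟨C₁, T₁, hC₁, hT₁, b₁⟩ := abs_le_eps_sq D hD.f_class
  obtain ⟨C₂, T₂, hC₂, hT₂, b₂⟩ := abs_le_eps_sq D hD.g_class
  obtain ⟨C₃, hC₃, b₃⟩ := hD.exists_phaseRate_bound
  have hη : 0 < |D.eta| := abs_pos.2 hD.eta_ne_zero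
  have hϰ : (0 : ℝ) < D.varkappa := by exact_mod_cast hD.varkappa_pos
  obtain ⟨K, hK⟩ : ∃ K : ℝ, K = (D.kappa : ℝ) / D.varkappa := ⟨_, rfl⟩
  have hK0 : 0 ≤ K := hK ▸ by positivity
  have hres : K * D.s 0 = D.freq D.a := by
    rw [hK, div_mul_eq_mul_div, hD.resonance, mul_div_cancel_left₀ _ hϰ.ne']
  obtain ⟨ρ, hρ, hρb⟩ := Metric.eventually_nhds_iff_ball.1
    ((hasDerivAt_iff_isLittleO.1 hD.freq_hasDerivAt).def (by positivity : 0 < |D.eta| / 12))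
  set C := C₁ + (C₂ + K * C₃) + 1 with hC
  have hKC₃ : 0 ≤ K * C₃ := by positivity
  have hC1 : 1 ≤ C := by linarith
  have hC0 : 0 < C := by linarith
  -- For `|x₁| > C₀ e₁` this forces `C e₁² ≤ |η| |x₁| / 8`: the perturbations are small compared
  -- with the detuning `η x₁`.
  obtain ⟨T₃, hT₃⟩ := eventually_atTop.1 ((eps_tendsto hD).eventually
    (ge_mem_nhds (by positivity : 0 < C₀ * |D.eta| / (8 * C))))
  -- The last bound is the drift that the phase is sure to accumulate: at least `|η| x₁² / (8 C
  -- e₁²)`, more than `|η| C₀² / (8 C) ≥ 2ε`.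
  set ε := min (min (ρ / 2) 1) (|D.eta| * C₀ ^ 2 / (16 * C)) with hε
  have hε0 : 0 < ε := lt_min (lt_min (half_pos hρ) one_pos) (by positivity)
  have hε1 : ε ≤ ρ / 2 := (min_le_left _ _).trans (min_le_left _ _)
  have hε2 : ε ≤ 1 := (min_le_left _ _).trans (min_le_right _ _)
  have hε3 : ε ≤ |D.eta| * C₀ ^ 2 / (16 * C) := min_le_right _ _
  refine ⟨ε, max (max 1 T₁) (max T₂ T₃), hε0, (le_max_left _ _).trans (le_max_left _ _),
    fun t₁ ht₁ r φ hsol hnear => ?_⟩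
  rw [← hK] at hnear
  have g₁ : 1 ≤ t₁ := ((le_max_left _ _).trans (le_max_left _ _)).trans ht₁
  have g₂ : T₁ ≤ t₁ := ((le_max_right _ _).trans (le_max_left _ _)).trans ht₁
  have g₃ : T₂ ≤ t₁ := ((le_max_left _ _).trans (le_max_right _ _)).trans ht₁
  have g₄ : T₃ ≤ t₁ := ((le_max_right _ _).trans (le_max_right _ _)).trans ht₁
  by_contra! hlt
  have ht0 : 0 < t₁ := by linarith
  have he := D.eps_pos ht0
  have he1 := D.eps_le_one g₁
  have hesmall := hT₃ t₁ g₄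
  rw [le_div_iff₀ (by positivity)] at hesmall
  set x₁ := r t₁ - D.a with hx₁
  set e₁ := D.eps t₁ with he₁
  have hx0 : 0 < |x₁| := lt_of_le_of_lt (by positivity) hlt
  have hx1 : |x₁| ≤ ε := (hnear t₁ ⟨le_rfl, by linarith⟩).1
  -- With `|r'| ≤ C e₁²` this is the time in which `r - a` can change by at most half of `x₁`. It
  -- does not exceed `t₁`, because `1/t₁ = e₁^(2q) ≤ e₁²`.
  set L := |x₁| / (2 * C * e₁ ^ 2) with hL
  have hL0 : 0 < L := by positivity
  have hCL : C * e₁ ^ 2 * L = |x₁| / 2 := by rw [hL]; field_simp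
  have hLt : L ≤ t₁ := by
    have h1 : t₁⁻¹ ≤ e₁ ^ 2 := by
      rw [← eps_pow_two_q hD ht0]
      exact pow_le_pow_of_le_one he.le he1 (by have := hD.q_pos; omega)
    have h2 : 1 ≤ e₁ ^ 2 * t₁ := by
      have := mul_le_mul_of_nonneg_right h1 ht0.le
      rwa [inv_mul_cancel₀ ht0.ne'] at this
    rw [hL, div_le_iff₀ (by positivity)]
    calc |x₁| ≤ 1 := hx1.trans hε2
      _ ≤ 1 * (e₁ ^ 2 * t₁) := by linarith
      _ ≤ (2 * C) * (e₁ ^ 2 * t₁) := mul_le_mul_of_nonneg_right (by linarith) (by positivity)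
      _ = _ := by ring
  have hsub : Set.Icc t₁ (t₁ + L) ⊆ Set.Icc t₁ (2 * t₁) := Set.Icc_subset_Icc le_rfl (by linarith)
  have hsol' := hsol.mono le_rfl (by linarith : t₁ + L ≤ 2 * t₁)
  have heps : ∀ t ∈ Set.Icc t₁ (t₁ + L), 0 < D.eps t ∧ D.eps t ≤ e₁ ∧ D.eps t ^ 2 ≤ e₁ ^ 2 :=
    fun t ht => by
      have h0 := D.eps_pos (ht0.trans_le ht.1)
      have h1 := D.eps_anti ht0 ht.1
      exact ⟨h0, h1, pow_le_pow_left₀ h0.le h1 2⟩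
  have hx : ∀ t ∈ Set.Icc t₁ (t₁ + L), |r t - D.a - x₁| ≤ |x₁| / 2 := fun t ht => by
    have h1 := norm_image_sub_le_of_norm_deriv_le_segment' (C := C * e₁ ^ 2)
      (fun s hs => (hsol' s hs).2.1) (fun s hs => by
        have hs' : s ∈ Set.Icc t₁ (t₁ + L) := ⟨hs.1, hs.2.le⟩
        refine (b₁ s (g₂.trans hs.1) _ _ _ (hsol' s hs').1).trans ?_
        exact mul_le_mul (by linarith) (heps s hs').2.2 (sq_nonneg _) hC0.le) t ht
    rw [Real.norm_eq_abs] at h1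
    have h2 : C * e₁ ^ 2 * (t - t₁) ≤ C * e₁ ^ 2 * L :=
      mul_le_mul_of_nonneg_left (by linarith [ht.2]) (by positivity)
    have h3 : r t - D.a - x₁ = r t - r t₁ := by rw [hx₁]; ring
    rw [h3]
    linarith
  have hsmall : C * e₁ ^ 2 ≤ |D.eta| * |x₁| / 8 := by
    have h1 := mul_le_mul_of_nonneg_right hesmall he.le
    have h2 := mul_le_mul_of_nonneg_left hlt.le hη.le
    linarith
  -- The share `3/4` is `1/8` from the nonlinearity of the frequency, `1/8` from `g` and the phase
  -- correction, and `1/2` from the change of `r`.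
  have hψ : ∀ t ∈ Set.Icc t₁ (t₁ + L), |D.freq (r t) + D.g (r t) (φ t) (D.phase t) t
      - K * D.phaseRate (D.eps t) - D.eta * x₁| ≤ 3 / 4 * (|D.eta| * |x₁|) := fun t ht => by
    obtain ⟨h0, h1, h2⟩ := heps t ht
    have k₁ := hρb (r t) (by
      rw [Metric.mem_ball, Real.dist_eq]
      exact ((hnear t (hsub ht)).1.trans hε1).trans_lt (half_lt_self hρ))
    rw [smul_eq_mul, Real.norm_eq_abs, Real.norm_eq_abs] at k₁
    have k₂ := b₂ t (g₃.trans ht.1) (r t) (φ t) (D.phase t) (hsol' t ht).1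
    have k₃ := b₃ (D.eps t) ⟨h0.le, h1.trans he1⟩
    have k₄ := hx t ht
    have k₅ : |r t - D.a| ≤ 3 / 2 * |x₁| := by
      have := abs_add_le (r t - D.a - x₁) x₁
      rw [sub_add_cancel] at this
      linarith
    have k₆ := mul_le_mul_of_nonneg_left k₅ (by positivity : 0 ≤ |D.eta| / 12)
    have k₇ : |D.eta * (r t - D.a - x₁)| ≤ |D.eta| * (|x₁| / 2) := by
      rw [abs_mul]; exact mul_le_mul_of_nonneg_left k₄ hη.le
    have k₈ : |K * (D.phaseRate (D.eps t) - D.s 0)| ≤ K * (C₃ * D.eps t ^ 2) := by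
      rw [abs_mul, abs_of_nonneg hK0]; exact mul_le_mul_of_nonneg_left k₃ hK0
    have k₉ : (C₂ + K * C₃) * D.eps t ^ 2 ≤ C * e₁ ^ 2 :=
      mul_le_mul (by linarith) h2 (sq_nonneg _) hC0.le
    have split : D.freq (r t) + D.g (r t) (φ t) (D.phase t) t - K * D.phaseRate (D.eps t)
        - D.eta * x₁ = (D.freq (r t) - D.freq D.a - (r t - D.a) * D.eta)
          + D.g (r t) (φ t) (D.phase t) t - K * (D.phaseRate (D.eps t) - D.s 0)
          + D.eta * (r t - D.a - x₁) := by
      rw [← hres]; ring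
    rw [split, abs_le]
    rw [abs_le] at k₁ k₂ k₇ k₈
    constructor <;> linarith [k₁.1, k₁.2, k₂.1, k₂.2, k₇.1, k₇.2, k₈.1, k₈.2]
  -- Subtracting the frozen drift `η x₁ t` leaves a slope of at most three quarters of it, so at
  -- least a quarter of the drift remains in the phase.
  have hend := norm_image_sub_le_of_norm_deriv_le_segment'
    (f := fun t => φ t - K * D.phase t - D.eta * x₁ * t) (a := t₁) (b := t₁ + L)
    (C := 3 / 4 * (|D.eta| * |x₁|)) (fun t ht =>
      ((hsol' t ht).2.2.sub ((phase_hasDerivAt hD (ht0.trans_le ht.1)).hasDerivWithinAt.const_mul K)).sub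
        ((hasDerivWithinAt_id t _).const_mul (D.eta * x₁))) (fun t ht => by
      rw [Real.norm_eq_abs, mul_one]
      exact hψ t ⟨ht.1, ht.2.le⟩) (t₁ + L) ⟨by linarith, le_rfl⟩
  have n₁ := (hnear t₁ ⟨le_rfl, by linarith⟩).2
  have n₂ := (hnear (t₁ + L) ⟨by linarith, by linarith⟩).2
  set Ψ₁ := φ t₁ - K * D.phase t₁
  set Ψ₂ := φ (t₁ + L) - K * D.phase (t₁ + L)
  have e1 : Ψ₂ - D.eta * x₁ * (t₁ + L) - (Ψ₁ - D.eta * x₁ * t₁)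
      = (Ψ₂ - ψ₀) - (Ψ₁ - ψ₀) - D.eta * x₁ * L := by ring
  rw [e1, add_sub_cancel_left, Real.norm_eq_abs] at hend
  have e2 : |D.eta * x₁ * L| = |D.eta| * |x₁| * L := by
    rw [abs_mul, abs_mul, abs_of_pos hL0]
  have e3 : |D.eta| * |x₁| * L ≤ 2 * ε + 3 / 4 * (|D.eta| * |x₁|) * L := by
    rw [← e2]
    rw [abs_le] at n₁ n₂ hend
    rw [abs_le]
    constructor <;> linarith [n₁.1, n₁.2, n₂.1, n₂.2, hend.1, hend.2]
  have e4 : C * e₁ ^ 2 * (|D.eta| * |x₁| * L) ≤ C * e₁ ^ 2 * (8 * ε) :=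
    mul_le_mul_of_nonneg_left (by linarith) (by positivity)
  have e5 : C * e₁ ^ 2 * (|D.eta| * |x₁| * L) = |D.eta| * |x₁| ^ 2 / 2 := by
    rw [show C * e₁ ^ 2 * (|D.eta| * |x₁| * L) = |D.eta| * |x₁| * (C * e₁ ^ 2 * L) by ring, hCL]
    ring
  have e6 : (C₀ * e₁) ^ 2 < |x₁| ^ 2 := pow_lt_pow_left₀ hlt (by positivity) two_ne_zero
  have e7 := mul_lt_mul_of_pos_left e6 hη
  have e8 : C * (8 * ε) ≤ |D.eta| * C₀ ^ 2 / 2 := by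
    rw [le_div_iff₀ (by positivity)] at hε3
    linarith
  have e9 := mul_le_mul_of_nonneg_right e8 (sq_nonneg e₁)
  linarith

end OscSystem

/-! ### Existence and uniqueness -/

/-- Truncation of `x` to `[-b, b]`. -/
def clamp (b x : ℝ) : ℝ := max (-b) (min b x)

theorem clamp_mem {b : ℝ} (hb : 0 ≤ b) (x : ℝ) : clamp b x ∈ Set.Icc (-b) b :=
  ⟨le_max_left _ _, max_le (by linarith) (min_le_left _ _)⟩

theorem clamp_of_abs_le {b x : ℝ} (h : |x| ≤ b) : clamp b x = x := by
  rw [abs_le] at h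
  rw [clamp, min_eq_right h.2, max_eq_right h.1]

theorem clamp_lipschitz (b : ℝ) : LipschitzWith 1 (clamp b) :=
  (LipschitzWith.id.const_min b).const_max (-b)

namespace OscSystem

variable {D : OscSystem}

/-- The right-hand side of the system. -/
def field (D : OscSystem) (t : ℝ) (x : ℝ × ℝ) : ℝ × ℝ :=
  (D.f x.1 x.2 (D.phase t) t, D.freq x.1 + D.g x.1 x.2 (D.phase t) t)

theorem phase_contDiffOn (D : OscSystem) : ContDiffOn ℝ ∞ D.phase (Set.Ioi 0) := by
  intro t ht
  have ht' : t ≠ 0 := (Set.mem_Ioi.1 ht).ne'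
  refine ContDiffAt.contDiffWithinAt ?_
  unfold phase
  refine (ContDiffAt.add (by fun_prop) ?_).add (contDiffAt_const.mul (Real.contDiffAt_log.2 ht'))
  exact ContDiffAt.sum fun j _ => contDiffAt_const.mul (Real.contDiffAt_rpow_const_of_ne ht')

theorem Valid.field_contDiffOn (hD : D.Valid) :
    ContDiffOn ℝ ∞ (fun p : ℝ × ℝ × ℝ => D.field p.1 p.2) {p | 0 < p.1 ∧ |p.2.1| ≤ D.calR} := by
  have hph : ContDiffOn ℝ ∞ (fun p : ℝ × ℝ × ℝ => D.phase p.1) {p | 0 < p.1 ∧ |p.2.1| ≤ D.calR} :=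
    D.phase_contDiffOn.comp contDiffOn_fst fun p hp => hp.1
  have hmap : ContDiffOn ℝ ∞ (fun p : ℝ × ℝ × ℝ => (p.2.1, p.2.2, D.phase p.1, p.1))
      {p | 0 < p.1 ∧ |p.2.1| ≤ D.calR} :=
    ContDiffOn.prodMk (by fun_prop) (ContDiffOn.prodMk (by fun_prop) (hph.prodMk (by fun_prop)))
  exact (hD.f_class.smooth.comp hmap fun p hp => ⟨hp.2, hp.1⟩).prodMk
    ((hD.freq_smooth.comp (by fun_prop) fun p hp => hp.2).add
      (hD.g_class.smooth.comp hmap fun p hp => ⟨hp.2, hp.1⟩))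

theorem Valid.exists_field_lipschitz (hD : D.Valid) {t₁ t₂ : ℝ} (ht₁ : 0 < t₁) (B : ℝ) :
    ∃ K : NNReal, ∀ t ∈ Set.Icc t₁ t₂,
      LipschitzOnWith K (D.field t) (Set.Icc (-D.calR) D.calR ×ˢ Set.Icc (-B) B) := by
  obtain ⟨K, hK⟩ := (hD.field_contDiffOn.mono (t := Set.Icc t₁ t₂ ×ˢ Set.Icc (-D.calR) D.calR ×ˢ
    Set.Icc (-B) B) fun p hp => ⟨ht₁.trans_le hp.1.1, abs_le.2 hp.2.1⟩).exists_lipschitzOnWith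
    (by simp) ((convex_Icc _ _).prod ((convex_Icc _ _).prod (convex_Icc _ _)))
    (isCompact_Icc.prod (isCompact_Icc.prod isCompact_Icc))
  refine ⟨K, fun t ht x hx y hy => ?_⟩
  have := hK (x := (t, x)) ⟨ht, hx⟩ (y := (t, y)) ⟨ht, hy⟩
  have h2 : edist (t, x) (t, y) = edist x y := by
    rw [Prod.edist_eq, edist_self, max_eq_right zero_le]
  rwa [h2] at this

theorem IsSolutionOn.hasDerivWithinAt {t₁ t₂ t : ℝ} {r φ : ℝ → ℝ} (h : D.IsSolutionOn t₁ t₂ r φ)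
    (ht : t ∈ Set.Icc t₁ t₂) :
    HasDerivWithinAt (fun t => (r t, φ t)) (D.field t (r t, φ t)) (Set.Icc t₁ t₂) t :=
  (h t ht).2.1.prodMk (h t ht).2.2

theorem IsSolutionOn.eqOn (hD : D.Valid) {t₁ t₂ : ℝ} (ht₁ : 0 < t₁) {r φ r' φ' : ℝ → ℝ}
    (h : D.IsSolutionOn t₁ t₂ r φ) (h' : D.IsSolutionOn t₁ t₂ r' φ') (hr : r t₁ = r' t₁)
    (hφ : φ t₁ = φ' t₁) : ∀ t ∈ Set.Icc t₁ t₂, r t = r' t ∧ φ t = φ' t := by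
  have hc : ∀ {r φ : ℝ → ℝ}, D.IsSolutionOn t₁ t₂ r φ → ContinuousOn φ (Set.Icc t₁ t₂) :=
    fun h t ht => (h t ht).2.2.continuousWithinAt
  obtain ⟨B₁, hB₁⟩ := isCompact_Icc.exists_bound_of_continuousOn (hc h)
  obtain ⟨B₂, hB₂⟩ := isCompact_Icc.exists_bound_of_continuousOn (hc h')
  obtain ⟨K, hK⟩ := hD.exists_field_lipschitz (t₂ := t₂) ht₁ (max B₁ B₂)
  have hright : ∀ {r φ : ℝ → ℝ}, D.IsSolutionOn t₁ t₂ r φ → ∀ t ∈ Set.Ico t₁ t₂,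
      HasDerivWithinAt (fun t => (r t, φ t)) (D.field t (r t, φ t)) (Set.Ici t) t := fun h t ht =>
    (h.hasDerivWithinAt ⟨ht.1, ht.2.le⟩).mono_of_mem_nhdsWithin
      (mem_of_superset (Icc_mem_nhdsGE ht.2) (Set.Icc_subset_Icc_left ht.1))
  have key := ODE_solution_unique_of_mem_Icc_right (v := D.field) (K := K)
    (s := fun _ => Set.Icc (-D.calR) D.calR ×ˢ Set.Icc (-(max B₁ B₂)) (max B₁ B₂))
    (f := fun t => (r t, φ t)) (g := fun t => (r' t, φ' t)) (a := t₁) (b := t₂)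
    (fun t ht => hK t ⟨ht.1, ht.2.le⟩)
    (fun t ht => (h.hasDerivWithinAt ht).continuousWithinAt) (hright h)
    (fun t ht => ⟨abs_le.1 (h t ⟨ht.1, ht.2.le⟩).1,
      abs_le.1 ((hB₁ t ⟨ht.1, ht.2.le⟩).trans (le_max_left _ _))⟩)
    (fun t ht => (h'.hasDerivWithinAt ht).continuousWithinAt) (hright h')
    (fun t ht => ⟨abs_le.1 (h' t ⟨ht.1, ht.2.le⟩).1,
      abs_le.1 ((hB₂ t ⟨ht.1, ht.2.le⟩).trans (le_max_right _ _))⟩) (by rw [hr, hφ])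
  exact fun t ht => Prod.mk.injEq _ _ _ _ ▸ key ht

/-- A curve that solves the system as long as it stays in `[-calR, calR] × [-B, B]`. -/
theorem Valid.exists_clamped_solution (hD : D.Valid) {t₁ t₂ B : ℝ} (ht₁ : 0 < t₁) (ht : t₁ ≤ t₂)
    (hB : 0 ≤ B) (r₁ φ₁ : ℝ) :
    ∃ x : ℝ → ℝ × ℝ, x t₁ = (r₁, φ₁) ∧ ∀ t ∈ Set.Icc t₁ t₂,
      HasDerivWithinAt x (D.field t (clamp D.calR (x t).1, clamp B (x t).2)) (Set.Icc t₁ t₂) t := by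
  have hR : 0 ≤ D.calR := (abs_nonneg _).trans hD.a_lt.le
  obtain ⟨K, hK⟩ := hD.exists_field_lipschitz (t₂ := t₂) ht₁ B
  set S := Set.Icc (-D.calR) D.calR ×ˢ Set.Icc (-B) B with hS
  set c : ℝ × ℝ → ℝ × ℝ := fun x => (clamp D.calR x.1, clamp B x.2) with hc
  have hcS : ∀ x, c x ∈ S := fun x => ⟨clamp_mem hR _, clamp_mem hB _⟩
  have hcont : ContinuousOn (fun p : ℝ × ℝ × ℝ => D.field p.1 p.2) (Set.Icc t₁ t₂ ×ˢ S) :=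
    hD.field_contDiffOn.continuousOn.mono fun p hp => ⟨ht₁.trans_le hp.1.1, abs_le.2 hp.2.1⟩
  obtain ⟨M, hM⟩ := (isCompact_Icc.prod (isCompact_Icc.prod isCompact_Icc) :
    IsCompact (Set.Icc t₁ t₂ ×ˢ S)).exists_bound_of_continuousOn hcont
  have hcl : LipschitzWith 1 c := by
    have h1 := ((clamp_lipschitz D.calR).comp LipschitzWith.prod_fst).prodMk
      ((clamp_lipschitz B).comp LipschitzWith.prod_snd)
    simpa using h1
  -- The clamped field is globally Lipschitz in the state and bounded by `M`, so a ball of radius `M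
  -- (t₂ - t₁)` suffices and there is no restriction on the length of the interval.
  have hpl : IsPicardLindelof (fun t x => D.field t (c x)) (⟨t₁, le_rfl, ht⟩ : Set.Icc t₁ t₂)
      (r₁, φ₁) (Real.toNNReal M * Real.toNNReal (t₂ - t₁)) 0 (Real.toNNReal M) K := by
    refine ⟨fun t ht => ?_, fun x _ => ?_, fun t ht x _ => ?_, ?_⟩
    · have := (hK t ht).comp (hcl.lipschitzOnWith (s := Set.univ)) fun x _ => hcS x
      rw [mul_one] at this
      exact this.mono (Set.subset_univ _)
    · exact hcont.comp (by fun_prop : Continuous fun t : ℝ => (t, c x)).continuousOn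
        fun t ht => ⟨ht, hcS x⟩
    · exact (hM (t, c x) ⟨ht, hcS x⟩).trans (Real.le_coe_toNNReal M)
    · rw [NNReal.coe_mul, Real.coe_toNNReal (t₂ - t₁) (by linarith), NNReal.coe_zero, sub_zero,
        sub_self, max_eq_left (by linarith)]
  obtain ⟨x, hx, hx'⟩ := hpl.exists_eq_forall_mem_Icc_hasDerivWithinAt₀
  exact ⟨x, hx, hx'⟩

end OscSystem

/-! ### Instability of the phase-locking regime -/

namespace OscSystem

variable {D : OscSystem} {n m : ℕ}

/-- A solution that stays `ε`-close must, by `exists_escape`, lie in the narrow zone where averaging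
is valid, and by `averaged_instability` it must have started with `ψ` close to `ψ₀`. The change of
variables and the width of the zone then cost only multiples of `e(t₁)`. -/
theorem Valid.exists_no_trapped_solution (hD : D.Valid) (h : D.LeadingOrders n m) {ψ₀ : ℝ}
    (hψ₀ : D.Lam n 0 ψ₀ = 0) (hνη : D.nu n ψ₀ * D.eta < 0) (hd : 0 < D.dnm n m ψ₀)
    (hℓ : min m n + n - 1 < 2 * D.q) :
    ∃ ε : ℝ, 0 < ε ∧ ∀ δ : ℝ, 0 < δ → ∃ T : ℝ, 1 ≤ T ∧ ∀ t₁, T ≤ t₁ → ∃ t₂, t₁ < t₂ ∧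
      ∀ r φ : ℝ → ℝ, D.IsSolutionOn t₁ t₂ r φ →
        (∀ t ∈ Set.Icc t₁ t₂, |r t - D.a| ≤ ε ∧
          |φ t - (D.kappa : ℝ) / D.varkappa * D.phase t - ψ₀| ≤ ε) →
        |r t₁ - D.a| + |φ t₁ - (D.kappa : ℝ) / D.varkappa * D.phase t₁ - ψ₀| < δ := by
  obtain ⟨r₀, hr₀, hr₀1, hinst⟩ :=
    hD.averaged_instability h hψ₀ hνη hd hℓ (N := 4 * D.q) le_rfl
  obtain ⟨C, T₁, hC, hT₁, havg⟩ := hD.averaging ψ₀ (4 * D.q)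
  obtain ⟨ε₁, T₂, hε₁, hT₂, hesc⟩ := hD.exists_escape ψ₀ (half_pos hr₀)
  refine ⟨min ε₁ (r₀ / 2), lt_min hε₁ (half_pos hr₀), fun δ hδ => ?_⟩
  obtain ⟨T₃, hT₃, hinst'⟩ := hinst C (δ / 2) hC (half_pos hδ)
  have hmin : 0 < min (r₀ / 2) (δ / 2) := lt_min (half_pos hr₀) (half_pos hδ)
  obtain ⟨T₄, hT₄⟩ := eventually_atTop.1 ((eps_tendsto hD).eventually
    (ge_mem_nhds (div_pos hmin (by positivity : 0 < C + 1))))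
  refine ⟨max (max T₁ T₂) (max T₃ T₄), hT₁.trans ((le_max_left _ _).trans (le_max_left _ _)),
    fun t₁ ht₁ => ?_⟩
  have g₁ : T₁ ≤ t₁ := ((le_max_left _ _).trans (le_max_left _ _)).trans ht₁
  have g₂ : T₂ ≤ t₁ := ((le_max_right _ _).trans (le_max_left _ _)).trans ht₁
  have g₃ : T₃ ≤ t₁ := ((le_max_left _ _).trans (le_max_right _ _)).trans ht₁
  have g₄ : T₄ ≤ t₁ := ((le_max_right _ _).trans (le_max_right _ _)).trans ht₁
  obtain ⟨t₂, ht₂, hno⟩ := hinst' t₁ g₃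
  -- The escape lemma at time `t` needs the solution on `[t, 2t]`; doubling the horizon makes it
  -- available for every `t ≤ t₂`.
  refine ⟨2 * t₂, by linarith, fun r φ hsol hnear => ?_⟩
  have hzone : ∀ t ∈ Set.Icc t₁ t₂, |r t - D.a| ≤ r₀ / 2 * D.eps t := fun t ht =>
    hesc t (g₂.trans ht.1) r φ (hsol.mono ht.1 (by linarith [ht.2])) fun s hs => by
      have := hnear s ⟨ht.1.trans hs.1, hs.2.trans (by linarith [ht.2])⟩
      exact ⟨this.1.trans (min_le_left _ _), this.2.trans (min_le_left _ _)⟩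
  have hphase : ∀ t ∈ Set.Icc t₁ t₂,
      |φ t - (D.kappa : ℝ) / D.varkappa * D.phase t - ψ₀| ≤ r₀ / 2 := fun t ht =>
    (hnear t ⟨ht.1, by linarith [ht.2]⟩).2.trans (min_le_right _ _)
  have heps : ∀ t ∈ Set.Icc t₁ t₂, 0 < D.eps t ∧ C * D.eps t ≤ r₀ / 2 ∧
      (C + r₀ / 2) * D.eps t ≤ δ / 2 := fun t ht => by
    have h1 := D.eps_pos (t := t) (by linarith [ht.1])
    have h2 := hT₄ t (g₄.trans ht.1)
    rw [le_div_iff₀ (by positivity)] at h2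
    have h3 := h2.trans (min_le_left _ _)
    have h4 := h2.trans (min_le_right _ _)
    have h5 := mul_le_mul_of_nonneg_right (by linarith : r₀ / 2 ≤ 1) h1.le
    exact ⟨h1, by linarith, by linarith⟩
  obtain ⟨ρ, ψ, hav⟩ := havg t₁ t₂ r φ g₁ (hsol.mono le_rfl (by linarith)) fun t ht => by
    refine ⟨(hzone t ht).trans ?_, (hphase t ht).trans (by linarith)⟩
    exact mul_le_of_le_one_left (heps t ht).1.le (by linarith)
  have hstart := hno ρ ψ fun t ht => by
    obtain ⟨a₁, a₂, a₃, a₄⟩ := hav t ht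
    obtain ⟨e₁, e₂, -⟩ := heps t ht
    refine ⟨a₁, a₂, ?_, ?_⟩
    · have h1 : |(r t - D.a) / D.eps t| ≤ r₀ / 2 := by
        rw [abs_div, abs_of_pos e₁, div_le_iff₀ e₁]; exact hzone t ht
      have h2 := abs_add_le (ρ t - (r t - D.a) / D.eps t) ((r t - D.a) / D.eps t)
      rw [sub_add_cancel] at h2
      linarith
    · have h2 := abs_add_le (ψ t - (φ t - (D.kappa : ℝ) / D.varkappa * D.phase t))
        (φ t - (D.kappa : ℝ) / D.varkappa * D.phase t - ψ₀)
      rw [sub_add_sub_cancel] at h2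
      linarith [hphase t ht]
  have hmem : t₁ ∈ Set.Icc t₁ t₂ := ⟨le_rfl, ht₂.le⟩
  obtain ⟨-, -, -, a₄⟩ := hav t₁ hmem
  obtain ⟨-, -, e₃⟩ := heps t₁ hmem
  have h2 := abs_sub_le (φ t₁ - (D.kappa : ℝ) / D.varkappa * D.phase t₁) (ψ t₁) ψ₀
  rw [abs_sub_comm _ (ψ t₁)] at h2
  linarith [hzone t₁ hmem]

theorem abs_regimeDist_sub_le (D : OscSystem) (m : ℕ) (ψ₀ : ℝ) (ϱ ϕ : ℕ → ℝ) (M : ℕ)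
    (r φ t : ℝ) :
    |D.regimeDist m ψ₀ ϱ ϕ M r φ t
        - (|r - D.a| + |φ - (D.kappa : ℝ) / D.varkappa * D.phase t - ψ₀|)|
      ≤ |D.eps t * D.rhoSum m ϱ M t| + |D.phiSum ψ₀ ϕ M t - ψ₀| := by
  have h1 := abs_abs_sub_abs_le_abs_sub (r - D.a - D.eps t * D.rhoSum m ϱ M t) (r - D.a)
  have h2 := abs_abs_sub_abs_le_abs_sub (φ - (D.kappa : ℝ) / D.varkappa * D.phase t
    - D.phiSum ψ₀ ϕ M t) (φ - (D.kappa : ℝ) / D.varkappa * D.phase t - ψ₀)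
  rw [sub_sub_cancel_left, abs_neg] at h1
  rw [sub_sub_sub_cancel_left, abs_sub_comm ψ₀] at h2
  change |(|r - D.a - D.eps t * D.rhoSum m ϱ M t| + |φ - (D.kappa : ℝ) / D.varkappa * D.phase t
    - D.phiSum ψ₀ ϕ M t|) - _| ≤ _
  rw [add_sub_add_comm]
  exact (abs_add_le _ _).trans (add_le_add h1 h2)

theorem Valid.regimeDist_continuousOn (hD : D.Valid) (hm : 2 ≤ m) (ψ₀ : ℝ) (ϱ ϕ : ℕ → ℝ) (M : ℕ)
    {r φ : ℝ → ℝ} {s : Set ℝ} (hs : s ⊆ Set.Ioi 0) (hr : ContinuousOn r s)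
    (hφ : ContinuousOn φ s) :
    ContinuousOn (fun t => D.regimeDist m ψ₀ ϱ ϕ M (r t) (φ t) t) s := by
  have heps : ContinuousOn D.eps s := fun t ht =>
    (eps_hasDerivAt hD (hs ht)).continuousAt.continuousWithinAt
  have hph : ContinuousOn D.phase s := D.phase_contDiffOn.continuousOn.mono hs
  have h1 : ContinuousOn (D.rhoSum m ϱ M) s :=
    ((coeffPoly_smooth (m - 2) ϱ M).continuous.comp_continuousOn heps).congr
      fun t ht => D.rhoSum_eq hm ϱ M (hs ht)
  have h2 : ContinuousOn (D.phiSum ψ₀ ϕ M) s :=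
    (continuousOn_const.add ((coeffPoly_smooth 0 ϕ M).continuous.comp_continuousOn heps)).congr
      fun t ht => D.phiSum_eq ψ₀ ϕ M (hs ht)
  exact (((hr.sub continuousOn_const).sub (heps.mul h1)).abs).add
    (((hφ.sub (hph.const_mul _)).sub h2).abs)

/-- The clamped equation has a solution on all of `[t₁, t₂]`, and it solves the true system as long
as the distance is at most `ε`. If that held throughout, `hno` would be contradicted, so there is a
first exit time; uniqueness carries the conclusion to every solution with the same data. -/
theorem Valid.exists_exit (hD : D.Valid) (hm : 2 ≤ m) (ψ₀ : ℝ) (ϱ ϕ : ℕ → ℝ) (M : ℕ)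
    {ε t₁ t₂ r₁ φ₁ : ℝ} (hε : 0 < ε) (hεR : 2 * ε ≤ D.calR - |D.a|) (ht₁ : 0 < t₁) (ht : t₁ < t₂)
    (hclose : ∀ t ∈ Set.Icc t₁ t₂, |D.eps t * D.rhoSum m ϱ M t| + |D.phiSum ψ₀ ϕ M t - ψ₀| ≤ ε)
    (hstart : D.regimeDist m ψ₀ ϱ ϕ M r₁ φ₁ t₁ < ε)
    (hno : ∀ r φ : ℝ → ℝ, D.IsSolutionOn t₁ t₂ r φ → r t₁ = r₁ → φ t₁ = φ₁ →
      ∃ t ∈ Set.Icc t₁ t₂,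
        2 * ε < |r t - D.a| + |φ t - (D.kappa : ℝ) / D.varkappa * D.phase t - ψ₀|) :
    ∃ te, t₁ < te ∧ (∃ r φ : ℝ → ℝ, D.IsSolutionOn t₁ te r φ ∧ r t₁ = r₁ ∧ φ t₁ = φ₁) ∧
      ∀ r φ : ℝ → ℝ, D.IsSolutionOn t₁ te r φ → r t₁ = r₁ → φ t₁ = φ₁ →
        ε ≤ D.regimeDist m ψ₀ ϱ ϕ M (r te) (φ te) te := by
  have hpos : Set.Icc t₁ t₂ ⊆ Set.Ioi 0 := fun t ht => ht₁.trans_le ht.1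
  obtain ⟨P, hP⟩ := isCompact_Icc.exists_bound_of_continuousOn
    ((D.phase_contDiffOn.continuousOn.mono hpos).const_mul ((D.kappa : ℝ) / D.varkappa))
  have hP0 : 0 ≤ P := (norm_nonneg _).trans (hP t₁ ⟨le_rfl, ht.le⟩)
  obtain ⟨x, hx₁, hx⟩ := hD.exists_clamped_solution ht₁ ht.le
    -- This bound on the angle is never reached before exit: `φ` is within `2ε` of the rotating
    -- phase, bounded by `P`, plus `ψ₀`.
    (by positivity : 0 ≤ 2 * ε + P + |ψ₀|) r₁ φ₁
  have hr₁ : (x t₁).1 = r₁ := by rw [hx₁]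
  have hφ₁ : (x t₁).2 = φ₁ := by rw [hx₁]
  set d : ℝ → ℝ := fun t => D.regimeDist m ψ₀ ϱ ϕ M (x t).1 (x t).2 t with hd
  have hxc : ContinuousOn x (Set.Icc t₁ t₂) := fun t ht => (hx t ht).continuousWithinAt
  have hdc : ContinuousOn d (Set.Icc t₁ t₂) :=
    hD.regimeDist_continuousOn hm ψ₀ ϱ ϕ M hpos hxc.fst hxc.snd
  have hd2 : ∀ t ∈ Set.Icc t₁ t₂, d t ≤ ε →
      |(x t).1 - D.a| + |(x t).2 - (D.kappa : ℝ) / D.varkappa * D.phase t - ψ₀| ≤ 2 * ε := by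
    intro t ht hdt
    have := (abs_le.1 ((D.abs_regimeDist_sub_le m ψ₀ ϱ ϕ M (x t).1 (x t).2 t).trans
      (hclose t ht))).1
    linarith
  have hgen : ∀ t₃ ∈ Set.Icc t₁ t₂, (∀ t ∈ Set.Icc t₁ t₃, d t ≤ ε) →
      D.IsSolutionOn t₁ t₃ (fun t => (x t).1) (fun t => (x t).2) := by
    intro t₃ ht₃ hle t ht
    have ht' : t ∈ Set.Icc t₁ t₂ := ⟨ht.1, ht.2.trans ht₃.2⟩
    have h1 := hd2 t ht' (hle t ht)
    have hr : |(x t).1| ≤ D.calR := by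
      have h2 := abs_add_le ((x t).1 - D.a) D.a
      rw [sub_add_cancel] at h2
      linarith [abs_nonneg ((x t).2 - (D.kappa : ℝ) / D.varkappa * D.phase t - ψ₀)]
    have hφ : |(x t).2| ≤ 2 * ε + P + |ψ₀| := by
      have h2 := abs_add_three ((x t).2 - (D.kappa : ℝ) / D.varkappa * D.phase t - ψ₀)
        ((D.kappa : ℝ) / D.varkappa * D.phase t) ψ₀
      have h3 := hP t ht'
      rw [Real.norm_eq_abs] at h3
      rw [show (x t).2 - (D.kappa : ℝ) / D.varkappa * D.phase t - ψ₀
        + (D.kappa : ℝ) / D.varkappa * D.phase t + ψ₀ = (x t).2 by ring] at h2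
      linarith [abs_nonneg ((x t).1 - D.a)]
    have h4 := (hx t ht').mono (Set.Icc_subset_Icc_right ht₃.2)
    rw [clamp_of_abs_le hr, clamp_of_abs_le hφ] at h4
    exact ⟨hr, h4.fst, h4.snd⟩
  have hne : (Set.Icc t₁ t₂ ∩ d ⁻¹' Set.Ici ε).Nonempty := by
    by_contra hempty
    have hlt : ∀ t ∈ Set.Icc t₁ t₂, d t ≤ ε := fun t ht => by
      by_contra! hgt
      exact hempty ⟨t, ht, hgt.le⟩
    obtain ⟨t, ht', hgt⟩ := hno _ _ (hgen t₂ ⟨ht.le, le_rfl⟩ hlt) hr₁ hφ₁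
    exact absurd (hd2 t ht' (hlt t ht')) hgt.not_ge
  obtain ⟨te, ⟨hte, hdte⟩, hleast⟩ :=
    (isCompact_Icc.of_isClosed_subset (hdc.preimage_isClosed_of_isClosed isClosed_Icc isClosed_Ici)
      Set.inter_subset_left).exists_isLeast hne
  have hdt₁ : d t₁ < ε := by rw [hd]; simp only [hr₁, hφ₁]; exact hstart
  have hlt : t₁ < te := hte.1.lt_of_ne (by rintro rfl; exact absurd hdte hdt₁.not_ge)
  have hsub : Set.Icc t₁ te ⊆ Set.Icc t₁ t₂ := Set.Icc_subset_Icc_right hte.2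
  -- By minimality of `te` and the intermediate value theorem the distance is exactly `ε` there, so
  -- the clamp is inactive up to and including `te`.
  have hdeq : d te = ε := by
    obtain ⟨s, hs, hds⟩ := intermediate_value_Icc hte.1 (hdc.mono hsub) ⟨hdt₁.le, hdte⟩
    rwa [le_antisymm hs.2 (hleast ⟨hsub hs, hds.ge⟩)] at hds
  have hsol := hgen te hte fun t ht => by
    rcases ht.2.eq_or_lt with rfl | h
    · exact hdeq.le
    · by_contra! hgt
      exact absurd (hleast ⟨hsub ht, hgt.le⟩) h.not_ge
  refine ⟨te, hlt, ⟨_, _, hsol, hr₁, hφ₁⟩, fun r φ hrφ hr hφ => ?_⟩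
  obtain ⟨e₁, e₂⟩ := hrφ.eqOn hD ht₁ hsol (hr.trans hr₁.symm) (hφ.trans hφ₁.symm) te ⟨hlt.le, le_rfl⟩
  rw [e₁, e₂]
  exact hdte

end OscSystem

end

theorem mainTheorem4 (D : OscSystem) (hD : D.Valid) (n m : ℕ) (hnm : D.LeadingOrders n m)
    (ψ₀ : ℝ) (hψ₀ : D.Lam n 0 ψ₀ = 0) (hν : D.nu n ψ₀ ≠ 0)
    (hνη : D.nu n ψ₀ * D.eta < 0) (hd : 0 < D.dnm n m ψ₀)
    (hℓ : min m n + n - 1 < 2 * D.q) :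
    ∃ N₀ : ℕ, ∃ ε : ℝ, 0 < ε ∧ ∀ N : ℕ, N₀ ≤ N →
      (∃ ϱ ϕ : ℕ → ℝ, D.IsFormalSolution N m ψ₀ ϱ ϕ) ∧
      ∀ ϱ ϕ : ℕ → ℝ, D.IsFormalSolution N m ψ₀ ϱ ϕ →
        ∀ M : ℕ, ∀ δ : ℝ, 0 < δ → δ < ε →
          ∃ T : ℝ, 1 ≤ T ∧ ∀ tstar : ℝ, T ≤ tstar → ∀ rstar φstar : ℝ,
            δ ≤ D.regimeDist m ψ₀ ϱ ϕ M rstar φstar tstar →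
            D.regimeDist m ψ₀ ϱ ϕ M rstar φstar tstar < ε →
            ∃ te : ℝ, tstar < te ∧
              (∃ r φ : ℝ → ℝ, D.IsSolutionOn tstar te r φ ∧
                r tstar = rstar ∧ φ tstar = φstar) ∧
              ∀ r φ : ℝ → ℝ, D.IsSolutionOn tstar te r φ →
                r tstar = rstar → φ tstar = φstar →
                ε ≤ D.regimeDist m ψ₀ ϱ ϕ M (r te) (φ te) te := by
  have hm := hnm.m_mem.1
  obtain ⟨ε₀, hε₀, htrap⟩ := hD.exists_no_trapped_solution hnm hψ₀ hνη hd hℓ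
  have hgap : 0 < D.calR - |D.a| := sub_pos.2 hD.a_lt
  -- Halving leaves room for the regime to differ from `(a, ψ₀)` by up to `ε`: a distance `2ε` is
  -- still covered by the trapping result and keeps `|r| ≤ calR`.
  have hε : 0 < min (ε₀ / 2) ((D.calR - |D.a|) / 2) := lt_min (half_pos hε₀) (half_pos hgap)
  refine ⟨2 * D.q, min (ε₀ / 2) ((D.calR - |D.a|) / 2), hε, fun N hN =>
    ⟨hD.exists_isFormalSolution hnm hψ₀ hν hN, fun ϱ ϕ _ M δ hδ _ => ?_⟩⟩
  have hε₁ := min_le_left (ε₀ / 2) ((D.calR - |D.a|) / 2)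
  have hε₂ := min_le_right (ε₀ / 2) ((D.calR - |D.a|) / 2)
  set ε := min (ε₀ / 2) ((D.calR - |D.a|) / 2)
  -- At late times the regime is within `δ/2` of `(a, ψ₀)`, so starting at distance at least `δ`
  -- from it means starting at least `δ/2` from `(a, ψ₀)`.
  obtain ⟨T₁, hT₁, htrap'⟩ := htrap (δ / 2) (half_pos hδ)
  have hlim : Tendsto (fun t => |D.eps t * D.rhoSum m ϱ M t| + |D.phiSum ψ₀ ϕ M t - ψ₀|)
      atTop (𝓝 0) := by
    have h := (((OscSystem.eps_tendsto hD).mul (hD.tendsto_rhoSum hm ϱ M)).abs).add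
      (((hD.tendsto_phiSum ψ₀ ϕ M).sub_const ψ₀).abs)
    simpa using h
  obtain ⟨T₂, hT₂⟩ := eventually_atTop.1
    (hlim.eventually (ge_mem_nhds (lt_min hε (half_pos hδ))))
  refine ⟨max T₁ T₂, hT₁.trans (le_max_left _ _), fun t₁ ht₁ r₁ φ₁ hge hlt => ?_⟩
  have g₁ : T₁ ≤ t₁ := (le_max_left _ _).trans ht₁
  have g₂ : T₂ ≤ t₁ := (le_max_right _ _).trans ht₁
  obtain ⟨t₂, ht₂, hno⟩ := htrap' t₁ g₁
  refine hD.exists_exit hm ψ₀ ϱ ϕ M hε (by linarith) (by linarith) ht₂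
    (fun t ht => (hT₂ t (g₂.trans ht.1)).trans (min_le_left _ _)) hlt fun r φ hsol hr hφ => ?_
  by_contra! hnear
  have h₁ := hno r φ hsol fun t ht => by
    have := hnear t ht
    constructor <;> linarith [abs_nonneg (r t - D.a),
      abs_nonneg (φ t - (D.kappa : ℝ) / D.varkappa * D.phase t - ψ₀)]
  rw [hr, hφ] at h₁
  have h₂ := (abs_le.1 ((D.abs_regimeDist_sub_le m ψ₀ ϱ ϕ M r₁ φ₁ t₁).trans
    ((hT₂ t₁ g₂).trans (min_le_right _ _)))).2
  linarith
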